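/- **Setting.** Let $N$ clients have data distributions $\mathcal D_i,\tilde{\mathcal D}_i$ and losses $\tilde f_i(x,\xi)$, $\tilde h_i(x,\zeta)$ on $\mathbb R^n$, differentiable in $x$. Put $f_i(x)=\mathbb E_{\xi\sim\mathcal D_i}[\tilde f_i(x,\xi)]$, $h_i(x)=\mathbb E_{\zeta\sim\tilde{\mathcal D}_i}[\tilde h_i(x,\zeta)]$, $f=\frac1N\sum_i f_i$, $h=\frac1N\sum_i h_i$, $X_h^*=\arg\min_{\mathbb R^n}h$, $f_\eta=h+\eta f$. Assume: all $f_i,h_i$ are convex and $L_f$-, respectively $L_h$-smooth; $X_h^*\neq\emptyset$; $\inf f>-\infty$; $\nabla\tilde f_i(x,\xi)$ and $\nabla\tilde h_i(x,\zeta)$ are unbiased estimators of $\nabla f_i(x)$, $\nabla h_i(x)$ with variances at most $\sigma_f^2$, $\sigma_h^2$; and for $F\in\{f,h\}$ there are $G_F\ge 0$, $B_F\ge1$ with $\frac1N\sum_i\|\nabla F_i(x)\|^2\le G_F^2+2L_FB_F^2(F(x)-\inf F)$ for all $x$. Let $x^*$ be any solution of $\min_{x\in X_h^*}f(x)$, $f^*=f(x^*)$,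 $h^*=\min h$, and let $x_\eta^*$ be any minimizer of $f_\eta$ over $\mathbb R^n$ (both assumed to exist). $X_h^*$ is called $\alpha$-weak sharp of order $\kappa\ge1$ ($\alpha>0$) if $h(x)-h^*\ge\alpha\,\mathrm{dist}(x,X_h^*)^\kappa$ for all $x\in\mathbb R^n$. **R-FedAvg.** From a square-integrable $x^0$, in each round $S$ clients are sampled uniformly without replacement; each sampled client starts from the server model $x$, makes $K$ local steps $y_i\leftarrow y_i-\gamma_l(\eta\nabla\tilde f_i(y_i,\xi_i)+\nabla\tilde h_i(y_i,\zeta_i))$ with fresh independent samples, and the server sets $x\leftarrow x+\gamma_g\frac1S\sum_i(y_i-x)$. After $R\ge 1$ rounds the output is $\bar x^R=\frac1R\sum_{r=1}^R x^{r-1}$. Let $\gamma_g\ge1$, $\eta>0$, $\tilde\gamma=\gamma_l\gamma_gK$, $\gamma_l\le\frac1{16(L_h+\eta L_f)^2(1+B^2)K\gamma_g}$, where $B^2=\max\{4\eta L_fB_f^2,4L_hB_h^2\}$, and $G^2=\max\{1,\eta^2\}\big(2G_f^2+4L_fB_f^2(f^*-\inf f)\big)+2G_h^2+4L_hB_h^2(h^*-\inf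 h)$. Write $\tilde Q^2=\max\{0,\mathbb E\|x^0-x_\eta^*\|^2-\mathbb E\|x^R-x_\eta^*\|^2\}$, $W=\frac{9(L_h+\eta L_f)(2\eta^2\sigma_f^2+2\sigma_h^2)}K+18(L_h+\eta L_f)G^2$, $Y=\frac{2\eta^2\sigma_f^2+2\sigma_h^2}K+4(1-\frac SN)G^2$, and let $M>0$ be any number with $M\ge f^*-\mathbb E[f(\bar x^R)]$ (for instance any positive $M\ge f^*-\inf f$). **Explicit complexities.** For all real $a,b$ there is a constant $C>0$ depending only on $a,b$ such that the following holds for all such problems, all such runs with $\tilde\gamma=R^{-a}$, and all $\epsilon>0$ (all expectations below are finite). [Case i] Let $\eta=R^{-b}$. (i-1) If $0\le b<a$, $a+b<1$ and $R\ge C\Big(\big(\tfrac{\tilde Q^2}{\epsilon}\big)^{\frac1{1-(a+b)}}+\big(\tfrac{W}{\epsilon\gamma_g^2}\big)^{\frac1{2a-b}}+\big(\tfrac{Y}{\epsilon S}\big)^{\frac1{a-b}}\Big)$, then $\mathbb E[f(\bar x^R)]-f^*\le\epsilon$. (i-2) If $0<b<a<1$ and $R\ge C\Big(\big(\tfrac{\tilde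 Q^2}{\epsilon}\big)^{\frac1{1-a}}+\big(\tfrac{W}{\epsilon\gamma_g^2}\big)^{\frac1{2a}}+\big(\tfrac{Y}{\epsilon S}\big)^{\frac1a}+\big(\tfrac M\epsilon\big)^{\frac1b}\Big)$, then $0\le\mathbb E[h(\bar x^R)]-h^*\le\epsilon$. [Case ii] If $X_h^*$ is $\alpha$-weak sharp of order $\kappa\ge1$, $\eta=R^{-b}$, $0<a<1$, $0<b\le1$, and, with $g=\|\nabla f(x^*)\|^\kappa$, $R\ge C\Big(\big(\tfrac{g\tilde Q^2}{\alpha\epsilon^\kappa}\big)^{\frac1{1-a}}+\big(\tfrac{gW}{\alpha\epsilon^\kappa\gamma_g^2}\big)^{\frac1{2a}}+\big(\tfrac{gY}{\alpha\epsilon^\kappa S}\big)^{\frac1a}+\big(\tfrac{gM}{\alpha\epsilon^\kappa}\big)^{\frac1b}\Big)$, then $\mathbb E[f(\bar x^R)]-f^*\ge-\epsilon$. [Case iii] Let $X_h^*$ be $\alpha$-weak sharp of order $1$, $0<a<1$, and let $\eta>0$ be any number with $2\eta\|\nabla f(x^*)\|\le\alpha$. (iii-1) If $R\ge C\Big(\big(\tfrac{\tilde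 Q^2}{\eta\epsilon}\big)^{\frac1{1-a}}+\big(\tfrac{W}{\eta\epsilon\gamma_g^2}\big)^{\frac1{2a}}+\big(\tfrac{Y}{\eta\epsilon S}\big)^{\frac1a}\Big)$, then $\mathbb E[f(\bar x^R)]-f^*\le\epsilon$. (iii-2) If $R\ge C\Big(\big(\tfrac{\tilde Q^2}{\epsilon}\big)^{\frac1{1-a}}+\big(\tfrac{W}{\epsilon\gamma_g^2}\big)^{\frac1{2a}}+\big(\tfrac{Y}{\epsilon S}\big)^{\frac1a}\Big)$, then $0\le\mathbb E[h(\bar x^R)]-h^*\le\epsilon$. (iii-3) If, with $\rho=\|\nabla f(x^*)\|/\alpha$, $R\ge C\Big(\big(\tfrac{\rho\tilde Q^2}{\epsilon}\big)^{\frac1{1-a}}+\big(\tfrac{\rho W}{\epsilon\gamma_g^2}\big)^{\frac1{2a}}+\big(\tfrac{\rho Y}{\epsilon S}\big)^{\frac1a}\Big)$, then $\mathbb E[f(\bar x^R)]-f^*\ge-\epsilon$. **Rates.** Fix the problem, $x^*$ and a bound $D$, and consider runs with $\gamma_g\ge1$, $\tilde\gamma=R^{-1/2}$ and $\mathbb E\|x^0-x_\eta^*\|^2\le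 D$; the restriction on $\gamma_l$ is now not assumed. There are constants $C'$ independent of $\epsilon\in(0,1]$ and of the run such that the restriction on $\gamma_l$ holds automatically and: if $\eta=R^{-1/4}$ and $R\ge C'\epsilon^{-4}$, then $\mathbb E[f(\bar x^R)]-f^*\le\epsilon$ and $0\le\mathbb E[h(\bar x^R)]-h^*\le\epsilon$; if $\eta=R^{-1/4}$, $X_h^*$ is $\alpha$-weak sharp of order $\kappa$ and $R\ge C'\epsilon^{-4\kappa}$, then $\mathbb E[f(\bar x^R)]-f^*\ge-\epsilon$; if $X_h^*$ is $\alpha$-weak sharp of order $1$, $\eta>0$ is fixed with $2\eta\|\nabla f(x^*)\|\le\alpha$ and $R\ge C'\epsilon^{-2}$, then $|\mathbb E[f(\bar x^R)]-f^*|\le\epsilon$ and $0\le\mathbb E[h(\bar x^R)]-h^*\le\epsilon$. (In these rates $C'$ may depend on the problem, on $D$, and on $\alpha,\kappa,\eta$ where they appear.) -/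

import Mathlib

open MeasureTheory ProbabilityTheory

universe u v w

noncomputable section

/-- The model space `ℝⁿ` with the Euclidean norm. -/
abbrev Vec (n : ℕ) := EuclideanSpace ℝ (Fin n)

/-- The data of a federated simple bilevel problem with `N` clients: for each client `i` a data
distribution `D i` with stochastic outer loss `ft i x ξ`, and a data distribution `D' i` with
stochastic inner loss `ht i x ζ`. -/
structure FedProblem (n N : ℕ) (Ξ : Type u) (Z : Type v)
    [MeasurableSpace Ξ] [MeasurableSpace Z] where
  D : Fin N → Measure Ξ
  D' : Fin N → Measure Z
  ft : Fin N → Vec n → Ξ → ℝ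
  ht : Fin N → Vec n → Z → ℝ

/-- The constants of the standing assumptions: smoothness `Lf, Lh`, standard deviations `σf, σh`
of the stochastic gradients, and gradient dissimilarity `Gf, Gh, Bf, Bh`. -/
structure FedConstants where
  (Lf Lh σf σh Gf Gh Bf Bh : ℝ)

namespace FedProblem

variable {n N : ℕ} {Ξ : Type u} {Z : Type v} [MeasurableSpace Ξ] [MeasurableSpace Z]
variable (Pr : FedProblem n N Ξ Z)

/-- Local outer objective `f_i(x) = E[ft_i(x, ξ_i)]`. -/
def fi (i : Fin N) (x : Vec n) : ℝ := ∫ ξ, Pr.ft i x ξ ∂(Pr.D i)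

/-- Local inner objective `h_i(x) = E[ht_i(x, ζ_i)]`. -/
def hi (i : Fin N) (x : Vec n) : ℝ := ∫ ζ, Pr.ht i x ζ ∂(Pr.D' i)

/-- Global outer objective. -/
def f (x : Vec n) : ℝ := (1 / (N : ℝ)) * ∑ i, Pr.fi i x

/-- Global inner objective. -/
def h (x : Vec n) : ℝ := (1 / (N : ℝ)) * ∑ i, Pr.hi i x

/-- Regularized objective `f_η = h + η f`. -/
def freg (η : ℝ) (x : Vec n) : ℝ := Pr.h x + η * Pr.f x

/-- `X_h^*`, the set of minimizers of the inner objective over `ℝⁿ`. -/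
def Xh : Set (Vec n) := {x | ∀ y, Pr.h x ≤ Pr.h y}

/-- `x` solves the bilevel problem `min f` subject to `x ∈ argmin h`. -/
def IsSolution (x : Vec n) : Prop := x ∈ Pr.Xh ∧ ∀ y ∈ Pr.Xh, Pr.f x ≤ Pr.f y

/-- `x` minimizes the regularized objective over `ℝⁿ`. -/
def IsRegMin (η : ℝ) (x : Vec n) : Prop := ∀ y, Pr.freg η x ≤ Pr.freg η y

/-- `X_h^*` is `α`-weak sharp of order `κ`. -/
def IsWeakSharp (α κ : ℝ) : Prop :=
  0 < α ∧ 1 ≤ κ ∧ ∀ x, α * Metric.infDist x Pr.Xh ^ κ ≤ Pr.h x - ⨅ y, Pr.h y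

/-- The standing assumptions on the problem (convex, possibly not strongly convex, outer level). -/
structure Assumptions (c : FedConstants) : Prop where
  probD : ∀ i, IsProbabilityMeasure (Pr.D i)
  probD' : ∀ i, IsProbabilityMeasure (Pr.D' i)
  nonneg : 0 ≤ c.Lf ∧ 0 ≤ c.Lh ∧ 0 ≤ c.σf ∧ 0 ≤ c.σh ∧ 0 ≤ c.Gf ∧ 0 ≤ c.Gh
  one_le : 1 ≤ c.Bf ∧ 1 ≤ c.Bh
  -- the expected losses and the stochastic gradients make sense
  integrable_ft : ∀ i x, Integrable (Pr.ft i x) (Pr.D i)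
  integrable_ht : ∀ i x, Integrable (Pr.ht i x) (Pr.D' i)
  diff_ft : ∀ i ξ, Differentiable ℝ (fun x => Pr.ft i x ξ)
  diff_ht : ∀ i ζ, Differentiable ℝ (fun x => Pr.ht i x ζ)
  meas_ft : ∀ i, Measurable
    (fun p : Vec n × Ξ => gradient (fun x => Pr.ft i x p.2) p.1)
  meas_ht : ∀ i, Measurable
    (fun p : Vec n × Z => gradient (fun x => Pr.ht i x p.2) p.1)
  -- convexity, an inner solution exists, the outer objective is bounded below
  convex_fi : ∀ i, ConvexOn ℝ Set.univ (Pr.fi i)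
  convex_hi : ∀ i, ConvexOn ℝ Set.univ (Pr.hi i)
  nonempty_Xh : Pr.Xh.Nonempty
  bddBelow_f : BddBelow (Set.range Pr.f)
  -- smoothness
  diff_fi : ∀ i, Differentiable ℝ (Pr.fi i)
  diff_hi : ∀ i, Differentiable ℝ (Pr.hi i)
  smooth_fi : ∀ i x y, ‖gradient (Pr.fi i) x - gradient (Pr.fi i) y‖ ≤ c.Lf * ‖x - y‖
  smooth_hi : ∀ i x y, ‖gradient (Pr.hi i) x - gradient (Pr.hi i) y‖ ≤ c.Lh * ‖x - y‖
  -- unbiased stochastic gradients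
  integrable_grad_ft : ∀ i x,
    Integrable (fun ξ => gradient (fun y => Pr.ft i y ξ) x) (Pr.D i)
  integrable_grad_ht : ∀ i x,
    Integrable (fun ζ => gradient (fun y => Pr.ht i y ζ) x) (Pr.D' i)
  unbiased_f : ∀ i x,
    ∫ ξ, gradient (fun y => Pr.ft i y ξ) x ∂(Pr.D i) = gradient (Pr.fi i) x
  unbiased_h : ∀ i x,
    ∫ ζ, gradient (fun y => Pr.ht i y ζ) x ∂(Pr.D' i) = gradient (Pr.hi i) x
  -- bounded variance
  integrable_var_f : ∀ i x, Integrable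
    (fun ξ => ‖gradient (fun y => Pr.ft i y ξ) x - gradient (Pr.fi i) x‖ ^ 2) (Pr.D i)
  integrable_var_h : ∀ i x, Integrable
    (fun ζ => ‖gradient (fun y => Pr.ht i y ζ) x - gradient (Pr.hi i) x‖ ^ 2) (Pr.D' i)
  variance_f : ∀ i x,
    ∫ ξ, ‖gradient (fun y => Pr.ft i y ξ) x - gradient (Pr.fi i) x‖ ^ 2 ∂(Pr.D i) ≤ c.σf ^ 2
  variance_h : ∀ i x,
    ∫ ζ, ‖gradient (fun y => Pr.ht i y ζ) x - gradient (Pr.hi i) x‖ ^ 2 ∂(Pr.D' i) ≤ c.σh ^ 2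
  -- bounded gradient dissimilarity
  bgd_f : ∀ x, (1 / (N : ℝ)) * ∑ i, ‖gradient (Pr.fi i) x‖ ^ 2
    ≤ c.Gf ^ 2 + 2 * c.Lf * c.Bf ^ 2 * (Pr.f x - ⨅ z, Pr.f z)
  bgd_h : ∀ x, (1 / (N : ℝ)) * ∑ i, ‖gradient (Pr.hi i) x‖ ^ 2
    ≤ c.Gh ^ 2 + 2 * c.Lh * c.Bh ^ 2 * (Pr.h x - ⨅ z, Pr.h z)

/-- The constant `G²` of the regularized problem, at a bilevel solution `xs`
(for `η ≤ 1` the factor `max 1 (η ^ 2)` is `1`). -/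
def Gsq (c : FedConstants) (η : ℝ) (xs : Vec n) : ℝ :=
  max 1 (η ^ 2) *
      (2 * c.Gf ^ 2 + 4 * c.Lf * c.Bf ^ 2 * (Pr.f xs - ⨅ z, Pr.f z)) +
    2 * c.Gh ^ 2 + 4 * c.Lh * c.Bh ^ 2 * (Pr.h xs - ⨅ z, Pr.h z)

end FedProblem

/-- The smoothness constant `L_h + η L_f` of the regularized objective. -/
def FedConstants.Lreg (c : FedConstants) (η : ℝ) : ℝ := c.Lh + η * c.Lf

/-- The constant `B²` of the regularized problem. -/
def FedConstants.Bsq (c : FedConstants) (η : ℝ) : ℝ :=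
  max (4 * η * c.Lf * c.Bf ^ 2) (4 * c.Lh * c.Bh ^ 2)

/-- Parameters of R-FedAvg: number `S` of sampled clients per round, number `K` of local steps,
local and global step sizes `γl`, `γg`, regularization parameter `η`. -/
structure FedParams where
  (S K : ℕ)
  (γl γg η : ℝ)

/-- Effective step size `γl γg K`. -/
def FedParams.γeff (p : FedParams) : ℝ := p.γl * p.γg * p.K

/-- Admissible parameters for `N` clients. -/
def FedParams.Valid (p : FedParams) (N : ℕ) : Prop :=
  1 ≤ p.S ∧ p.S ≤ N ∧ 1 ≤ p.K ∧ 0 < p.γl ∧ 1 ≤ p.γg ∧ 0 < p.η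

/-- The step-size restriction `γl ≤ 1 / (16 (L_h + η L_f)² (1 + B²) K γg)`, cleared of the
denominator. -/
def FedParams.StepOK (p : FedParams) (c : FedConstants) : Prop :=
  p.γl * (16 * c.Lreg p.η ^ 2 * (1 + c.Bsq p.η) * p.K * p.γg) ≤ 1

/-- The quantity `W`. -/
def wConst {n N : ℕ} {Ξ : Type u} {Z : Type v} [MeasurableSpace Ξ] [MeasurableSpace Z]
    (Pr : FedProblem n N Ξ Z) (c : FedConstants) (p : FedParams) (xs : Vec n) : ℝ :=
  9 * c.Lreg p.η * (2 * p.η ^ 2 * c.σf ^ 2 + 2 * c.σh ^ 2) / p.K +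
    18 * c.Lreg p.η * Pr.Gsq c p.η xs

/-- The quantity `Y`. -/
def yConst {n N : ℕ} {Ξ : Type u} {Z : Type v} [MeasurableSpace Ξ] [MeasurableSpace Z]
    (Pr : FedProblem n N Ξ Z) (c : FedConstants) (p : FedParams) (xs : Vec n) : ℝ :=
  (2 * p.η ^ 2 * c.σf ^ 2 + 2 * c.σh ^ 2) / p.K +
    4 * (1 - (p.S : ℝ) / (N : ℝ)) * Pr.Gsq c p.η xs

/-- The random input of R-FedAvg: the initial point, the set of clients sampled in each round,
and the samples `(ξ, ζ)` available to client `i` in round `r` at local step `k`. -/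
structure FedRun (n N : ℕ) (Ξ : Type u) (Z : Type v) (Ω : Type w) where
  x0 : Ω → Vec n
  smp : ℕ → Ω → Finset (Fin N)
  θ : ℕ → Fin N → ℕ → Ω → Ξ × Z

namespace FedRun

variable {n N : ℕ} {Ξ : Type u} {Z : Type v} {Ω : Type w}
variable [MeasurableSpace Ξ] [MeasurableSpace Z] [MeasurableSpace Ω]

/-- The law of the random input: square-integrable initial point, `S` clients sampled uniformly
without replacement in each round, samples drawn from the clients' data distributions
(`ξ` and `ζ` independent), everything independent. -/
structure IsSampling (run : FedRun n N Ξ Z Ω) (Pr : FedProblem n N Ξ Z) (S : ℕ)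
    (μ : Measure Ω) : Prop where
  meas_x0 : Measurable run.x0
  memLp_x0 : MemLp run.x0 2 μ
  meas_smp : ∀ r, Measurable (run.smp r)
  card_smp : ∀ r ω, (run.smp r ω).card = S
  law_smp : ∀ r (A : Finset (Fin N)), A.card = S →
    μ.real {ω | run.smp r ω = A} = 1 / (N.choose S : ℝ)
  meas_θ : ∀ r i k, Measurable (run.θ r i k)
  law_θ : ∀ r i k, μ.map (run.θ r i k) = (Pr.D i).prod (Pr.D' i)
  indep_smp : iIndepFun run.smp μ
  indep_θ : iIndepFun (fun q : ℕ × Fin N × ℕ => run.θ q.1 q.2.1 q.2.2) μ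
  indep_smp_θ : IndepFun (fun ω (r : ℕ) => run.smp r ω)
    (fun ω (q : ℕ × Fin N × ℕ) => run.θ q.1 q.2.1 q.2.2 ω) μ
  indep_x0 : IndepFun run.x0
    (fun ω => (fun r : ℕ => run.smp r ω,
      fun q : ℕ × Fin N × ℕ => run.θ q.1 q.2.1 q.2.2 ω)) μ

/-- Local model of client `i` after `k` local steps started at the server model `x`, in a round
with samples `s`. -/
def localIter (Pr : FedProblem n N Ξ Z) (p : FedParams) (i : Fin N) (s : ℕ → Ξ × Z)
    (x : Vec n) : ℕ → Vec n
  | 0 => x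
  | k + 1 =>
    localIter Pr p i s x k - p.γl •
      (p.η • gradient (fun y => Pr.ft i y (s k).1) (localIter Pr p i s x k) +
        gradient (fun y => Pr.ht i y (s k).2) (localIter Pr p i s x k))

/-- The server model `x^r` of R-FedAvg after `r` communication rounds. -/
def iter (run : FedRun n N Ξ Z Ω) (Pr : FedProblem n N Ξ Z) (p : FedParams) (ω : Ω) :
    ℕ → Vec n
  | 0 => run.x0 ω
  | r + 1 =>
    run.iter Pr p ω r + p.γg •
      ((1 / ((run.smp r ω).card : ℝ)) • ∑ i ∈ run.smp r ω,
        (localIter Pr p i (fun k => run.θ r i k ω) (run.iter Pr p ω r) p.K -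
          run.iter Pr p ω r))

/-- The averaged output `(1/R) ∑_{r=1}^{R} x^{r-1}` after `R` rounds. -/
def avg (run : FedRun n N Ξ Z Ω) (Pr : FedProblem n N Ξ Z) (p : FedParams) (R : ℕ) (ω : Ω) :
    Vec n :=
  (1 / (R : ℝ)) • ∑ r ∈ Finset.range R, run.iter Pr p ω r

/-- Outer-level error `E[f(x̄^R)] - f^*`. -/
def errF (run : FedRun n N Ξ Z Ω) (Pr : FedProblem n N Ξ Z) (p : FedParams) (μ : Measure Ω)
    (xs : Vec n) (R : ℕ) : ℝ :=
  ∫ ω, Pr.f (run.avg Pr p R ω) ∂μ - Pr.f xs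

/-- Inner-level error `E[h(x̄^R)] - h^*`. -/
def errH (run : FedRun n N Ξ Z Ω) (Pr : FedProblem n N Ξ Z) (p : FedParams) (μ : Measure Ω)
    (xs : Vec n) (R : ℕ) : ℝ :=
  ∫ ω, Pr.h (run.avg Pr p R ω) ∂μ - Pr.h xs

/-- The positive part of `E‖x^0 - x_η‖² - E‖x^R - x_η‖²`. -/
def qsq (run : FedRun n N Ξ Z Ω) (Pr : FedProblem n N Ξ Z) (p : FedParams) (μ : Measure Ω)
    (xη : Vec n) (R : ℕ) : ℝ :=
  max (∫ ω, ‖run.x0 ω - xη‖ ^ 2 ∂μ - ∫ ω, ‖run.iter Pr p ω R - xη‖ ^ 2 ∂μ) 0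

/-- All expectations that enter the error metrics after `R` rounds are finite. -/
def FiniteErrors (run : FedRun n N Ξ Z Ω) (Pr : FedProblem n N Ξ Z) (p : FedParams)
    (μ : Measure Ω) (xη : Vec n) (R : ℕ) : Prop :=
  Integrable (fun ω => Pr.f (run.avg Pr p R ω)) μ ∧
  Integrable (fun ω => Pr.h (run.avg Pr p R ω)) μ ∧
  Integrable (fun ω => ‖run.x0 ω - xη‖ ^ 2) μ ∧
  Integrable (fun ω => ‖run.iter Pr p ω R - xη‖ ^ 2) μ

end FedRun

end

/-!
# Explicit complexities of regularized federated averaging for simple bilevel problems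

Write `φ = h + η f` for the regularized objective, `φ_i = h_i + η f_i` for its local parts,
`L = L_h + η L_f`, and `γ = γ_l γ_g K`. Everything follows from one estimate
(`FedRun.errH_add_errF_le`): for every point `xs`,

`E φ(x̄^R) - φ(xs) ≤ Q² / (2 γ R) + γ² W / γ_g² + 8 γ Y / S`,

whose left-hand side is `errH + η errF` when `xs` is the bilevel solution.

*One round* (`FedRun.IsSampling.round_le`). The distance to the minimizer `xη` of `φ` is followed
through a step `x ↦ x - γ U`. The inner product `E⟪U, x - xη⟫` is bounded below by convexity
without discarding the Bregman divergences of the `φ_i` between `xη` and the local models, and these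
divergences control `‖∇φ_i(y) - ∇φ_i(xη)‖²`. Since `γ L ≤ 1/4`, they pay for the part of `E‖U‖²` and
of the client drift that comes from the local models being away from `xη`. The rest of these terms
is the heterogeneity `(1/N) ∑ ‖∇φ_i(xη)‖²`. It exceeds three times the heterogeneity at `xs`, hence
three times `G²`, by at most `3 L (φ(xs) - φ(xη))`, and this gap is available because the objective
is compared with `φ(xs)` rather than with the minimum `φ(xη)`. Sampling without replacement turns
the heterogeneity into a variance with factor `(N - S) / (S (N - 1))`, as the gradients `∇φ_i(xη)`
sum to zero (`integral_norm_sq_sample_mean`); the gradient errors are uncorrelated because each one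
has mean zero given everything that does not involve its own sample
(`FedRun.IsSampling.integral_inner_noise_noise`).

*From the regularized to the bilevel errors.* As `errH ≥ 0`, the bound on `errH + η errF` bounds
`errF` from above, and a lower bound on `errF` bounds `errH` from above. With weak sharpness of
order `κ`, `f` falls below `f(xs)` by at most `‖∇f(xs)‖` times the distance to the set of inner
minimizers, so that Jensen's inequality gives `α (-errF)₊ ^ κ ≤ ‖∇f(xs)‖ ^ κ errH`
(`FedRun.neg_errF_rpow_le`). For `κ = 1` and `2 η ‖∇f(xs)‖ ≤ α` half of `errH` absorbs `-η errF`,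
and the regularization is exact. The round complexities make each term of the bound a fixed
fraction of the accuracy.
-/

noncomputable section

/-! ### Convex functions with Lipschitz gradient -/

section Convex

variable {E : Type*} [NormedAddCommGroup E] [InnerProductSpace ℝ E] [CompleteSpace E]
  {φ : E → ℝ} {G : E → E} {L : ℝ}

lemma hasDerivAt_comp_segment (hg : ∀ x, HasGradientAt φ (G x) x) (x v : E) (t : ℝ) :
    HasDerivAt (fun s : ℝ => φ (x + s • v)) (inner ℝ (G (x + t • v)) v) t := by
  have h1 : HasDerivAt (fun s : ℝ => x + s • v) v t := by
    simpa using ((hasDerivAt_id t).smul_const v).const_add x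
  have h2 := (hg (x + t • v)).hasFDerivAt.comp_hasDerivAt t h1
  rw [InnerProductSpace.toDual_apply_apply] at h2
  exact h2

/-- First-order characterisation of convexity. -/
lemma ConvexOn.add_inner_gradient_le (hc : ConvexOn ℝ Set.univ φ)
    (hg : ∀ x, HasGradientAt φ (G x) x) (x y : E) :
    φ x + inner ℝ (G x) (y - x) ≤ φ y := by
  have hd := hasDerivAt_comp_segment hg x (y - x) 0
  have hcv : ConvexOn ℝ Set.univ (fun s : ℝ => φ (x + s • (y - x))) := by
    have := hc.comp_affineMap (AffineMap.lineMap x y)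
    simpa [Function.comp_def, AffineMap.lineMap_apply, add_comm] using this
  have := hcv.le_slope_of_hasDerivAt (Set.mem_univ 0) (Set.mem_univ 1) one_pos hd
  simp [slope_def_field] at this
  linarith

/-- The descent lemma: a function with `L`-Lipschitz gradient lies below its quadratic model. -/
lemma le_add_inner_gradient_add_sq (hg : ∀ x, HasGradientAt φ (G x) x)
    (hL : ∀ x y, ‖G x - G y‖ ≤ L * ‖x - y‖) (x y : E) :
    φ y ≤ φ x + inner ℝ (G x) (y - x) + L / 2 * ‖y - x‖ ^ 2 := by
  set v := y - x with hv
  let ψ : ℝ → ℝ := fun s => φ (x + s • v) - s * inner ℝ (G x) v - L / 2 * ‖v‖ ^ 2 * s ^ 2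
  have hψ : ∀ t, HasDerivAt ψ
      (inner ℝ (G (x + t • v)) v - inner ℝ (G x) v - L / 2 * ‖v‖ ^ 2 * (2 * t)) t := by
    intro t
    refine ((hasDerivAt_comp_segment hg x v t).sub ?_).sub ?_
    · simpa using (hasDerivAt_id t).mul_const (inner ℝ (G x) v)
    · simpa using ((hasDerivAt_pow 2 t).const_mul (L / 2 * ‖v‖ ^ 2))
  have hanti : AntitoneOn ψ (Set.Icc 0 1) := by
    refine antitoneOn_of_deriv_nonpos (convex_Icc 0 1)
      (fun t _ => (hψ t).continuousAt.continuousWithinAt)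
      (fun t _ => (hψ t).differentiableAt.differentiableWithinAt) ?_
    intro t ht
    rw [interior_Icc] at ht
    rw [(hψ t).deriv, ← inner_sub_left]
    have h1 := real_inner_le_norm (G (x + t • v) - G x) v
    have h2 := hL (x + t • v) x
    have h3 : ‖x + t • v - x‖ = t * ‖v‖ := by
      rw [add_sub_cancel_left, norm_smul, Real.norm_of_nonneg ht.1.le]
    rw [h3] at h2
    nlinarith [mul_le_mul_of_nonneg_right h2 (norm_nonneg v)]
  have := hanti (Set.left_mem_Icc.2 zero_le_one) (Set.right_mem_Icc.2 zero_le_one) zero_le_one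
  simp only [ψ, one_smul, zero_smul, add_zero, hv, add_sub_cancel] at this
  simp only [hv]
  linarith

/-- The Bregman divergence controls the difference of the gradients (`L = 0` included). -/
lemma norm_gradient_sub_sq_le (hc : ConvexOn ℝ Set.univ φ)
    (hg : ∀ x, HasGradientAt φ (G x) x) (hL0 : 0 ≤ L)
    (hL : ∀ x y, ‖G x - G y‖ ≤ L * ‖x - y‖) (a b : E) :
    ‖G a - G b‖ ^ 2 ≤ 2 * L * (φ a - φ b - inner ℝ (G b) (a - b)) := by
  rcases hL0.eq_or_lt with rfl | hLp
  · have := hL a b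
    have h0 : ‖G a - G b‖ = 0 := le_antisymm (by simpa using this) (norm_nonneg _)
    simp [h0]
  set v := G a - G b with hv
  -- compare both quadratic models at the gradient step from `a`
  have h1 := hc.add_inner_gradient_le hg b (a - (1 / L) • v)
  have h2 := le_add_inner_gradient_add_sq hg hL a (a - (1 / L) • v)
  have e1 : a - (1 / L) • v - a = -((1 / L) • v) := by abel
  have e2 : a - (1 / L) • v - b = (a - b) - (1 / L) • v := by abel
  rw [e1, inner_neg_right, inner_smul_right, norm_neg, norm_smul,
    Real.norm_of_nonneg (by positivity)] at h2
  rw [e2, inner_sub_right, inner_smul_right] at h1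
  have h3 : inner ℝ (G a) v - inner ℝ (G b) v = ‖v‖ ^ 2 := by
    rw [← inner_sub_left, ← hv, real_inner_self_eq_norm_sq]
  have h4 : L / 2 * (1 / L * ‖v‖) ^ 2 = 1 / L * ‖v‖ ^ 2 / 2 := by field_simp
  have h5 : 1 / L * ‖v‖ ^ 2 / 2 ≤ φ a - φ b - inner ℝ (G b) (a - b) := by
    have : 1 / L * ‖v‖ ^ 2 = 1 / L * inner ℝ (G a) v - 1 / L * inner ℝ (G b) v := by
      rw [← h3]; ring
    linarith
  calc ‖v‖ ^ 2 = 2 * L * (1 / L * ‖v‖ ^ 2 / 2) := by field_simp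
    _ ≤ _ := by gcongr

/-- Perturbed three-point inequality: the gradient is evaluated at `y` instead of `x`. -/
lemma inner_gradient_le_of_near (hg : ∀ x, HasGradientAt φ (G x) x)
    (hL : ∀ x y, ‖G x - G y‖ ≤ L * ‖x - y‖) (x y z : E) :
    -inner ℝ (G y) (x - z) ≤
      φ z - φ x - (φ z - φ y - inner ℝ (G y) (z - y)) + L / 2 * ‖y - x‖ ^ 2 := by
  have h := le_add_inner_gradient_add_sq hg hL y x
  rw [norm_sub_rev] at h
  have e : inner ℝ (G y) (x - z) = inner ℝ (G y) (x - y) - inner ℝ (G y) (z - y) := by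
    rw [← inner_sub_right]; congr 1; abel
  linarith

lemma abs_le_quadratic (hc : ConvexOn ℝ Set.univ φ) (hg : ∀ x, HasGradientAt φ (G x) x)
    (hL : ∀ x y, ‖G x - G y‖ ≤ L * ‖x - y‖) (x : E) :
    |φ x| ≤ |φ 0| + ‖G 0‖ * ‖x‖ + |L| / 2 * ‖x‖ ^ 2 := by
  have h1 := hc.add_inner_gradient_le hg 0 x
  have h2 := le_add_inner_gradient_add_sq hg hL 0 x
  simp only [sub_zero] at h1 h2
  have h3 := abs_le.1 (abs_real_inner_le_norm (G 0) x)
  have h4 := abs_le.1 (le_refl |φ 0|)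
  have h5 : L / 2 * ‖x‖ ^ 2 ≤ |L| / 2 * ‖x‖ ^ 2 := by gcongr; exact le_abs_self L
  have h6 : 0 ≤ |L| / 2 * ‖x‖ ^ 2 := by positivity
  rw [abs_le]; constructor <;> linarith

end Convex

/-! ### Norm inequalities -/

section Norms

variable {E : Type*} [NormedAddCommGroup E]

lemma norm_sum_sq_le {ι : Type*} (s : Finset ι) (u : ι → E) :
    ‖∑ i ∈ s, u i‖ ^ 2 ≤ s.card * ∑ i ∈ s, ‖u i‖ ^ 2 :=
  (pow_le_pow_left₀ (norm_nonneg _) (norm_sum_le _ _) 2).trans sq_sum_le_card_mul_sum_sq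

/-- Young's inequality for three terms, with weights `3`, `5/3`, `15` (the sum of their
reciprocals is one). The terms are going to be the deviation of the local gradients, the
heterogeneity of the clients and the gradient noise; for the noise a large weight is affordable. -/
lemma norm_add_three_sq_le_weighted (a b c : E) :
    ‖a + b + c‖ ^ 2 ≤ 3 * ‖a‖ ^ 2 + 5 / 3 * ‖b‖ ^ 2 + 15 * ‖c‖ ^ 2 := by
  have h : ‖a + b + c‖ ≤ ‖a‖ + ‖b‖ + ‖c‖ := norm_add₃_le
  have h2 := pow_le_pow_left₀ (norm_nonneg _) h 2
  refine h2.trans ?_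
  nlinarith [sq_nonneg (9 * ‖a‖ - 5 * ‖b‖), sq_nonneg (‖a‖ - 5 * ‖c‖), sq_nonneg (‖b‖ - 9 * ‖c‖)]

variable [InnerProductSpace ℝ E]

lemma norm_add_sq_le_two (a b : E) : ‖a + b‖ ^ 2 ≤ 2 * ‖a‖ ^ 2 + 2 * ‖b‖ ^ 2 := by
  have := parallelogram_law_with_norm ℝ a b
  nlinarith [norm_nonneg (a - b), mul_self_nonneg ‖a - b‖]

/-- Young's inequality with weights `3/2` and `3`. -/
lemma norm_add_sq_le_weighted (a b : E) : ‖a + b‖ ^ 2 ≤ 3 / 2 * ‖a‖ ^ 2 + 3 * ‖b‖ ^ 2 := by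
  have h := norm_sub_sq_real a ((2 : ℝ) • b)
  have h' := norm_add_sq_real a b
  rw [inner_smul_right, norm_smul, Real.norm_of_nonneg (by norm_num : (0 : ℝ) ≤ 2)] at h
  nlinarith [sq_nonneg ‖a - (2 : ℝ) • b‖]

end Norms

/-! ### Independence and martingale noise -/

section Independence

variable {Ω : Type*} {a b c mΩ : MeasurableSpace Ω} {μ : Measure Ω} [IsProbabilityMeasure μ]

/-- Independence can be regrouped: if `a` is independent of `b`, and both together of `c`, then
`a` is independent of `b ⊔ c`. The sets `s ∩ t` with `s` in `b` and `t` in `c` form a π-system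
that generates `b ⊔ c`. -/
lemma ProbabilityTheory.Indep.regroup (ha : a ≤ mΩ) (hb : b ≤ mΩ) (hc : c ≤ mΩ)
    (hab : Indep a b μ) (habc : Indep (a ⊔ b) c μ) : Indep a (b ⊔ c) μ := by
  let p : Set (Set Ω) := {u | ∃ s t, MeasurableSet[b] s ∧ MeasurableSet[c] t ∧ u = s ∩ t}
  have hp : IsPiSystem p := by
    rintro _ ⟨s, t, hs, ht, rfl⟩ _ ⟨s', t', hs', ht', rfl⟩ _
    exact ⟨s ∩ s', t ∩ t', MeasurableSet.inter hs hs', MeasurableSet.inter ht ht',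
      Set.inter_inter_inter_comm s t s' t'⟩
  have hgen : b ⊔ c = MeasurableSpace.generateFrom p := by
    apply le_antisymm
    · refine sup_le (fun s hs => ?_) (fun t ht => ?_)
      · exact MeasurableSpace.measurableSet_generateFrom
          ⟨s, Set.univ, hs, MeasurableSet.univ, by simp⟩
      · exact MeasurableSpace.measurableSet_generateFrom
          ⟨Set.univ, t, MeasurableSet.univ, ht, by simp⟩
    · refine MeasurableSpace.generateFrom_le ?_
      rintro _ ⟨s, t, hs, ht, rfl⟩
      exact MeasurableSet.inter ((le_sup_left : b ≤ b ⊔ c) s hs) ((le_sup_right : c ≤ b ⊔ c) t ht)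
  refine IndepSets.indep ha (sup_le hb hc) (@MeasurableSpace.isPiSystem_measurableSet Ω a) hp
    (@MeasurableSpace.generateFrom_measurableSet Ω a).symm hgen ?_
  rw [IndepSets_iff]
  rintro s _ hs ⟨t, u, ht, hu, rfl⟩
  rw [Indep_iff] at hab habc
  have hbc : μ (t ∩ u) = μ t * μ u := habc t u ((le_sup_right : b ≤ a ⊔ b) t ht) hu
  rw [← Set.inter_assoc, habc _ u (MeasurableSet.inter ((le_sup_left : a ≤ a ⊔ b) s hs)
    ((le_sup_right : b ≤ a ⊔ b) t ht)) hu, hab s t hs ht, hbc, mul_assoc]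

/-- Two independent families, each split into two independent blocks `a, a'` and `b, b'`, and a
further independent σ-algebra `x`: the first blocks are independent of all the rest. -/
lemma ProbabilityTheory.Indep.regroup_blocks {a a' b b' x mΩ : MeasurableSpace Ω} {μ : Measure Ω}
    [IsProbabilityMeasure μ] (ha : a ≤ mΩ) (ha' : a' ≤ mΩ) (hb : b ≤ mΩ) (hb' : b' ≤ mΩ)
    (hx : x ≤ mΩ) (haa : Indep a a' μ) (hbb : Indep b b' μ) (hab : Indep (a ⊔ a') (b ⊔ b') μ)
    (hxx : Indep ((a ⊔ a') ⊔ (b ⊔ b')) x μ) : Indep (a ⊔ b) ((x ⊔ a') ⊔ b') μ := by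
  have h1 : Indep a (a' ⊔ (b ⊔ b')) μ := haa.regroup ha ha' (sup_le hb hb') hab
  have h2 : Indep b (b' ⊔ a') μ := hbb.regroup hb hb' ha'
    (indep_of_indep_of_le_right hab.symm le_sup_right)
  have h3 : Indep (b' ⊔ a') (b ⊔ a) μ := h2.symm.regroup (sup_le hb' ha') hb ha (by
    have e : b' ⊔ a' ⊔ b = a' ⊔ (b ⊔ b') := by ac_rfl
    rw [e]; exact h1.symm)
  have h4 : Indep ((b ⊔ a) ⊔ (b' ⊔ a')) x μ := by
    have e : (b ⊔ a) ⊔ (b' ⊔ a') = (a ⊔ a') ⊔ (b ⊔ b') := by ac_rfl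
    rw [e]; exact hxx
  have h5 := h3.symm.regroup (sup_le hb ha) (sup_le hb' ha') hx h4
  have e1 : a ⊔ b = b ⊔ a := sup_comm _ _
  have e2 : (x ⊔ a') ⊔ b' = b' ⊔ a' ⊔ x := by ac_rfl
  rw [e1, e2]
  exact h5

lemma comap_comp_le {α β : Type*} [MeasurableSpace α] [MeasurableSpace β] {F : Ω → α} {g : α → β}
    (hg : Measurable g) :
    MeasurableSpace.comap (fun ω => g (F ω)) inferInstance ≤
      MeasurableSpace.comap F inferInstance := by
  rw [show (fun ω => g (F ω)) = g ∘ F from rfl, ← MeasurableSpace.comap_comp]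
  exact MeasurableSpace.comap_mono hg.comap_le

end Independence

section Noise

lemma MeasureTheory.MemLp.integrable_inner_of_two {Ω E : Type*} {mΩ : MeasurableSpace Ω}
    {μ : Measure Ω} [NormedAddCommGroup E] [InnerProductSpace ℝ E] {f g : Ω → E}
    (hf : MemLp f 2 μ) (hg : MemLp g 2 μ) : Integrable (fun ω => inner ℝ (f ω) (g ω)) μ := by
  refine ((hf.integrable_norm_pow two_ne_zero).add (hg.integrable_norm_pow two_ne_zero)).mono'
    (hf.aestronglyMeasurable.inner hg.aestronglyMeasurable)
    (Filter.Eventually.of_forall fun ω => ?_)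
  have h := abs_real_inner_le_norm (f ω) (g ω)
  simp only [Pi.add_apply, Real.norm_eq_abs]
  nlinarith [sq_nonneg (‖f ω‖ - ‖g ω‖), norm_nonneg (f ω), norm_nonneg (g ω)]

variable {Ω Θ E : Type*} {m mΩ : MeasurableSpace Ω} [MeasurableSpace Θ]
  [NormedAddCommGroup E] [MeasurableSpace E] [BorelSpace E] [SecondCountableTopology E]
  {μ : Measure Ω} [IsProbabilityMeasure μ] {P : Measure Θ} [IsProbabilityMeasure P]
  {T : Ω → Θ} {Y : Ω → E} {e : E → Θ → E} {V : ℝ}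

/-- Noise evaluated at a point independent of the fresh sample: the second moment. -/
lemma memLp_noise (hm : m ≤ mΩ) (hT : Measurable T) (hTP : μ.map T = P)
    (hind : Indep (MeasurableSpace.comap T inferInstance) m μ) (hY : Measurable[m] Y)
    (he : Measurable (Function.uncurry e))
    (hint : ∀ y, Integrable (fun s => ‖e y s‖ ^ 2) P)
    (hvar : ∀ y, ∫ s, ‖e y s‖ ^ 2 ∂P ≤ V) :
    MemLp (fun ω => e (Y ω) (T ω)) 2 μ ∧ ∫ ω, ‖e (Y ω) (T ω)‖ ^ 2 ∂μ ≤ V := by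
  have hYm : Measurable Y := hY.mono hm le_rfl
  have hV : 0 ≤ V := (integral_nonneg fun _ => by positivity).trans (hvar 0)
  have hIF : IndepFun Y T μ := by
    rw [IndepFun_iff_Indep]
    exact (indep_of_indep_of_le_right hind hY.comap_le).symm
  have hmap := (indepFun_iff_map_prod_eq_prod_map_map hYm.aemeasurable hT.aemeasurable).1 hIF
  rw [hTP] at hmap
  have : IsProbabilityMeasure (μ.map Y) := Measure.isProbabilityMeasure_map hYm.aemeasurable
  have hmeas : Measurable (fun ω => e (Y ω) (T ω)) := he.comp (hYm.prodMk hT)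
  have hlin : ∫⁻ ω, ENNReal.ofReal (‖e (Y ω) (T ω)‖ ^ 2) ∂μ ≤ ENNReal.ofReal V := by
    have hF : Measurable (fun z : E × Θ => ENNReal.ofReal (‖e z.1 z.2‖ ^ 2)) :=
      ((he.norm).pow_const 2).ennreal_ofReal
    rw [← lintegral_map (f := fun z : E × Θ => ENNReal.ofReal (‖e z.1 z.2‖ ^ 2)) hF
      (hYm.prodMk hT), hmap, lintegral_prod _ hF.aemeasurable]
    calc _ ≤ ∫⁻ _, ENNReal.ofReal V ∂(μ.map Y) := by
          refine lintegral_mono fun y => ?_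
          rw [← ofReal_integral_eq_lintegral_ofReal (hint y)
            (Filter.Eventually.of_forall fun _ => by positivity)]
          exact ENNReal.ofReal_le_ofReal (hvar y)
      _ = _ := by simp
  have hI : Integrable (fun ω => ‖e (Y ω) (T ω)‖ ^ 2) μ := by
    refine ⟨(hmeas.norm.pow_const 2).aestronglyMeasurable, ?_⟩
    rw [hasFiniteIntegral_iff_ofReal (Filter.Eventually.of_forall fun _ => by positivity)]
    exact hlin.trans_lt ENNReal.ofReal_lt_top
  refine ⟨(memLp_two_iff_integrable_sq_norm hmeas.aestronglyMeasurable).2 hI, ?_⟩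
  rw [integral_eq_lintegral_of_nonneg_ae (Filter.Eventually.of_forall fun _ => by positivity)
    hI.aestronglyMeasurable]
  exact ENNReal.toReal_le_of_le_ofReal hV hlin

variable [InnerProductSpace ℝ E] [CompleteSpace E]

/-- Noise evaluated at a point independent of the fresh sample is orthogonal to everything that
is independent of the fresh sample. -/
lemma integral_inner_noise_eq_zero (hm : m ≤ mΩ) (hT : Measurable T) (hTP : μ.map T = P)
    (hind : Indep (MeasurableSpace.comap T inferInstance) m μ) (hY : Measurable[m] Y)
    (he : Measurable (Function.uncurry e))
    (hint1 : ∀ y, Integrable (e y) P) (hmean : ∀ y, ∫ s, e y s ∂P = 0)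
    (heL : MemLp (fun ω => e (Y ω) (T ω)) 2 μ)
    {Z : Ω → E} (hZ : Measurable[m] Z) (hZL : MemLp Z 2 μ) :
    ∫ ω, inner ℝ (e (Y ω) (T ω)) (Z ω) ∂μ = 0 := by
  have hYm : Measurable Y := hY.mono hm le_rfl
  have hZm : Measurable Z := hZ.mono hm le_rfl
  have hYZ : Measurable[m] (fun ω => (Y ω, Z ω)) := hY.prodMk hZ
  have hIF : IndepFun (fun ω => (Y ω, Z ω)) T μ := by
    rw [IndepFun_iff_Indep]
    exact (indep_of_indep_of_le_right hind hYZ.comap_le).symm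
  have hmap := (indepFun_iff_map_prod_eq_prod_map_map (hYm.prodMk hZm).aemeasurable
    hT.aemeasurable).1 hIF
  rw [hTP] at hmap
  have : IsProbabilityMeasure (μ.map fun ω => (Y ω, Z ω)) :=
    Measure.isProbabilityMeasure_map (hYm.prodMk hZm).aemeasurable
  let F : (E × E) × Θ → ℝ := fun z => inner ℝ (e z.1.1 z.2) z.1.2
  have hF : Measurable F := by
    refine Measurable.inner ?_ (measurable_snd.comp measurable_fst)
    exact he.comp ((measurable_fst.comp measurable_fst).prodMk measurable_snd)
  have hI : Integrable (fun ω => F ((Y ω, Z ω), T ω)) μ := heL.integrable_inner_of_two hZL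
  have hpair : Measurable (fun ω => ((Y ω, Z ω), T ω)) := (hYm.prodMk hZm).prodMk hT
  have hI' : Integrable F ((μ.map fun ω => (Y ω, Z ω)).prod P) := by
    rw [← hmap]
    exact (integrable_map_measure hF.aestronglyMeasurable hpair.aemeasurable).2 hI
  calc ∫ ω, inner ℝ (e (Y ω) (T ω)) (Z ω) ∂μ
      = ∫ z, F z ∂(μ.map fun ω => ((Y ω, Z ω), T ω)) :=
        (integral_map hpair.aemeasurable hF.aestronglyMeasurable).symm
    _ = ∫ yz, ∫ s, F (yz, s) ∂P ∂(μ.map fun ω => (Y ω, Z ω)) := by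
        rw [hmap, integral_prod _ hI']
    _ = 0 := by
        refine integral_eq_zero_of_ae (Filter.Eventually.of_forall fun yz => ?_)
        simp only [F, Pi.zero_apply]
        simp_rw [real_inner_comm yz.2]
        rw [integral_inner (hint1 yz.1), hmean, inner_zero_right]

end Noise

/-! ### Uniform sampling without replacement -/

section Sampling

variable {N S : ℕ} {Ω : Type*} {mΩ : MeasurableSpace Ω} {μ : Measure Ω}
  {A : Ω → Finset (Fin N)}

/-- The indicator of client `i` being sampled. -/
def sampleInd (A : Finset (Fin N)) (i : Fin N) : ℝ := if i ∈ A then 1 else 0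

lemma sampleInd_mul_self (B : Finset (Fin N)) (i : Fin N) :
    sampleInd B i * sampleInd B i = sampleInd B i := by
  unfold sampleInd; split_ifs <;> simp

lemma abs_sampleInd_le (B : Finset (Fin N)) (i : Fin N) : |sampleInd B i| ≤ 1 := by
  unfold sampleInd; split_ifs <;> simp

lemma sum_sampleInd_smul {E : Type*} [AddCommGroup E] [Module ℝ E] (B : Finset (Fin N))
    (u : Fin N → E) : ∑ i, sampleInd B i • u i = ∑ i ∈ B, u i := by
  simp [sampleInd, ite_smul, Finset.sum_ite_mem]

lemma measurable_sampleInd (i : Fin N) : Measurable fun B : Finset (Fin N) => sampleInd B i :=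
  Measurable.ite (measurableSet_mem_finset i) measurable_const measurable_const

lemma integrable_sampleInd_mul {F : Ω → ℝ} (hA : Measurable A) (hF : Integrable F μ) (i : Fin N) :
    Integrable (fun ω => sampleInd (A ω) i * F ω) μ :=
  hF.bdd_mul (c := 1) ((measurable_sampleInd i).comp hA).aestronglyMeasurable
    (Filter.Eventually.of_forall fun ω => by simpa using abs_sampleInd_le (A ω) i)

lemma integral_sampleInd_mul_sampleInd (hA : Measurable A) (i j : Fin N) :
    ∫ ω, sampleInd (A ω) i * sampleInd (A ω) j ∂μ = μ.real {ω | i ∈ A ω ∧ j ∈ A ω} := by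
  have hms : MeasurableSet {ω | i ∈ A ω ∧ j ∈ A ω} :=
    (hA (measurableSet_mem_finset i)).inter (hA (measurableSet_mem_finset j))
  rw [← integral_indicator_one hms]
  congr 1
  ext ω
  by_cases h1 : i ∈ A ω <;> by_cases h2 : j ∈ A ω <;> simp [sampleInd, h1, h2]

/-- A quantity independent of the sampled set is weighted by the inclusion probability. -/
lemma integral_sampleInd_mul {F : Ω → ℝ} {q : ℝ} (hA : Measurable A) (i : Fin N)
    (hq : ∫ ω, sampleInd (A ω) i ∂μ = q)
    (hind : IndepFun A F μ) (hF : AEStronglyMeasurable F μ) :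
    ∫ ω, sampleInd (A ω) i * F ω ∂μ = q * ∫ ω, F ω ∂μ := by
  have h : IndepFun (fun ω => sampleInd (A ω) i) F μ :=
    hind.comp (measurable_sampleInd i) measurable_id
  rw [h.integral_fun_mul_eq_mul_integral
    ((measurable_sampleInd i).comp hA).aestronglyMeasurable hF, hq]

variable [IsProbabilityMeasure μ]

/-- Probability that a fixed set `T` of clients is contained in the sampled set. -/
lemma measureReal_subset_sample (hA : Measurable A) (hcard : ∀ ω, (A ω).card = S)
    (hlaw : ∀ B : Finset (Fin N), B.card = S → μ.real {ω | A ω = B} = 1 / (N.choose S : ℝ))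
    (T : Finset (Fin N)) (hT : T.card ≤ S) :
    μ.real {ω | T ⊆ A ω} = ((N - T.card).choose (S - T.card) : ℝ) / (N.choose S : ℝ) := by
  have hset : {ω | T ⊆ A ω} =
      ⋃ B ∈ (Finset.powersetCard S Finset.univ).filter (T ⊆ ·), {ω | A ω = B} := by
    ext ω
    simp [Finset.mem_powersetCard, hcard]
  rw [hset, measureReal_biUnion_finset]
  · rw [Finset.sum_congr rfl (fun B hB => hlaw B ?_), Finset.sum_const,
      Finset.card_filter_powersetCard_subset T _ S (Finset.subset_univ _) hT]
    · simp [div_eq_mul_inv]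
    · exact (Finset.mem_powersetCard.1 (Finset.mem_filter.1 hB).1).2
  · intro B _ B' _ hBB'
    refine Set.disjoint_left.2 fun ω h1 h2 => hBB' ?_
    exact h1.symm.trans h2
  · intro B _
    exact hA (measurableSet_singleton B)

lemma measureReal_mem_sample (hA : Measurable A) (hcard : ∀ ω, (A ω).card = S)
    (hlaw : ∀ B : Finset (Fin N), B.card = S → μ.real {ω | A ω = B} = 1 / (N.choose S : ℝ))
    (hS : 1 ≤ S) (hSN : S ≤ N) (i : Fin N) :
    μ.real {ω | i ∈ A ω} = (S : ℝ) / N := by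
  have h := measureReal_subset_sample hA hcard hlaw {i} (by simpa using hS)
  simp only [Finset.singleton_subset_iff, Finset.card_singleton] at h
  rw [h]
  obtain ⟨s, rfl⟩ := Nat.exists_eq_add_of_le' hS
  obtain ⟨n, rfl⟩ := Nat.exists_eq_add_of_le' (hS.trans hSN)
  have hpos : 0 < (n + 1).choose (s + 1) := Nat.choose_pos hSN
  rw [div_eq_div_iff (by positivity) (by positivity)]
  have := Nat.add_one_mul_choose_eq n s
  simp only [Nat.add_sub_cancel]
  rw [mul_comm]
  rw [mul_comm ((s + 1 : ℕ) : ℝ)]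
  exact_mod_cast this

/-- Probability that two distinct clients are sampled, with denominators cleared. -/
lemma measureReal_mem_mem_sample (hA : Measurable A) (hcard : ∀ ω, (A ω).card = S)
    (hlaw : ∀ B : Finset (Fin N), B.card = S → μ.real {ω | A ω = B} = 1 / (N.choose S : ℝ))
    (hS : 1 ≤ S) (hSN : S ≤ N) {i j : Fin N} (hij : i ≠ j) :
    μ.real {ω | i ∈ A ω ∧ j ∈ A ω} * (N * (N - 1)) = (S : ℝ) * (S - 1) := by
  have hset : {ω | i ∈ A ω ∧ j ∈ A ω} = {ω | {i, j} ⊆ A ω} := by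
    ext ω; simp [Finset.insert_subset_iff]
  rcases hS.eq_or_lt with rfl | hS2
  · have : {ω | i ∈ A ω ∧ j ∈ A ω} = ∅ := by
      ext ω
      simp only [Set.mem_ofPred_eq, Set.mem_empty_iff_false, iff_false, not_and]
      intro h1 h2
      obtain ⟨k, hk⟩ := Finset.card_eq_one.1 (hcard ω)
      rw [hk, Finset.mem_singleton] at h1 h2
      exact hij (h1.trans h2.symm)
    rw [this]; simp
  · have hc : ({i, j} : Finset (Fin N)).card = 2 := Finset.card_pair hij
    rw [hset, measureReal_subset_sample hA hcard hlaw _ (by omega), hc]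
    obtain ⟨s, rfl⟩ := Nat.exists_eq_add_of_le' (show 2 ≤ S from hS2)
    obtain ⟨n, rfl⟩ := Nat.exists_eq_add_of_le' (show 2 ≤ N from le_trans hS2 hSN)
    have hpos : 0 < (n + 2).choose (s + 2) := Nat.choose_pos hSN
    have h1 := Nat.add_one_mul_choose_eq n s
    have h2 := Nat.add_one_mul_choose_eq (n + 1) (s + 1)
    simp only [Nat.add_sub_cancel]
    rw [div_mul_eq_mul_div, div_eq_iff (by positivity)]
    have h1' : ((n : ℝ) + 1) * n.choose s = (n + 1).choose (s + 1) * (s + 1) := by exact_mod_cast h1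
    have h2' : ((n : ℝ) + 2) * (n + 1).choose (s + 1) = (n + 2).choose (s + 2) * (s + 2) := by
      have : (n + 1 + 1) * (n + 1).choose (s + 1) = (n + 2).choose (s + 2) * (s + 1 + 1) := h2
      have := congrArg (Nat.cast (R := ℝ)) this
      push_cast at this
      linear_combination this
    push_cast
    linear_combination ((n : ℝ) + 2) * h1' + ((s : ℝ) + 1) * h2'

lemma integral_sampleInd (hA : Measurable A) (hcard : ∀ ω, (A ω).card = S)
    (hlaw : ∀ B : Finset (Fin N), B.card = S → μ.real {ω | A ω = B} = 1 / (N.choose S : ℝ))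
    (hS : 1 ≤ S) (hSN : S ≤ N) (i : Fin N) :
    ∫ ω, sampleInd (A ω) i ∂μ = (S : ℝ) / N := by
  have h := integral_sampleInd_mul_sampleInd (μ := μ) hA i i
  simp only [sampleInd_mul_self, and_self] at h
  rw [h, measureReal_mem_sample hA hcard hlaw hS hSN]

/-- Second moment of the sampled mean of centred vectors: the factor is
`(N - S) / (S (N - 1)) ≤ 2 (1 - S / N) / S`, and also at most one. -/
lemma integral_norm_sq_sample_mean {E : Type*} [NormedAddCommGroup E] [InnerProductSpace ℝ E]
    (hA : Measurable A) (hcard : ∀ ω, (A ω).card = S)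
    (hlaw : ∀ B : Finset (Fin N), B.card = S → μ.real {ω | A ω = B} = 1 / (N.choose S : ℝ))
    (hS : 1 ≤ S) (hSN : S ≤ N) (u : Fin N → E) (hu : ∑ i, u i = 0) :
    ∃ v : ℝ, 0 ≤ v ∧ v ≤ 1 ∧ v ≤ 2 / S * (1 - S / N) ∧
      ∫ ω, ‖(1 / (S : ℝ)) • ∑ i ∈ A ω, u i‖ ^ 2 ∂μ = v * (1 / N * ∑ i, ‖u i‖ ^ 2) := by
  have hS0 : (1 : ℝ) ≤ S := by exact_mod_cast hS
  have hSN' : (S : ℝ) ≤ N := by exact_mod_cast hSN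
  rcases (hS.trans hSN).eq_or_lt with hN1 | hN2
  · -- a single client: the centred vector vanishes
    subst hN1
    obtain rfl : S = 1 := le_antisymm hSN hS
    have hu0 : ∀ i, u i = 0 := fun i => by
      rw [← hu, Fin.sum_univ_one, Subsingleton.elim i 0]
    exact ⟨0, by simp [hu0]⟩
  have hN2' : (2 : ℝ) ≤ N := by exact_mod_cast hN2
  refine ⟨(N - S) / (S * (N - 1)), div_nonneg (by linarith) (by nlinarith), ?_, ?_, ?_⟩
  · rw [div_le_one (by nlinarith)]; nlinarith
  · have e : 2 / (S : ℝ) * (1 - S / N) = 2 * (N - S) / (S * N) := by field_simp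
    rw [e, div_le_div_iff₀ (by nlinarith) (by nlinarith)]
    have : 0 ≤ (N - S : ℝ) * S * (N - 2) :=
      mul_nonneg (mul_nonneg (by linarith) (by linarith)) (by linarith)
    nlinarith
  · have hpt : ∀ ω, ‖(1 / (S : ℝ)) • ∑ i ∈ A ω, u i‖ ^ 2 =
        (1 / (S : ℝ)) ^ 2 * ∑ i, ∑ j, sampleInd (A ω) i * sampleInd (A ω) j *
          inner ℝ (u i) (u j) := by
      intro ω
      rw [norm_smul, mul_pow, Real.norm_of_nonneg (by positivity), ← sum_sampleInd_smul,
        ← real_inner_self_eq_norm_sq, sum_inner]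
      simp_rw [inner_sum, inner_smul_left, inner_smul_right]
      simp [mul_assoc]
    have hint : ∀ i j, Integrable (fun ω => sampleInd (A ω) i * sampleInd (A ω) j *
        inner ℝ (u i) (u j)) μ := by
      intro i j
      refine Integrable.mul_const ?_ _
      exact integrable_sampleInd_mul hA (by
        simpa using integrable_sampleInd_mul hA (integrable_const (1 : ℝ)) j) i
    have hN1 : (N : ℝ) - 1 ≠ 0 := by linarith
    have hN0 : (N : ℝ) ≠ 0 := by linarith
    have hSne : (S : ℝ) ≠ 0 := by linarith
    set q : ℝ := S * (S - 1) / (N * (N - 1)) with hq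
    have hp : ∀ i j, μ.real {ω | i ∈ A ω ∧ j ∈ A ω} =
        q + if i = j then (S : ℝ) / N - q else 0 := by
      intro i j
      split_ifs with h
      · subst h
        simp only [and_self, measureReal_mem_sample hA hcard hlaw hS hSN]
        ring
      · have := measureReal_mem_mem_sample hA hcard hlaw hS hSN h
        rw [add_zero, hq, eq_div_iff (mul_ne_zero hN0 hN1), this]
    have hsum0 : ∑ i, ∑ j, inner ℝ (u i) (u j) = 0 := by
      simp_rw [← inner_sum, hu, inner_zero_right]; simp
    simp_rw [hpt]
    rw [integral_const_mul, integral_finsetSum _ fun i _ => integrable_finsetSum _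
      fun j _ => hint i j]
    simp_rw [integral_finsetSum _ fun j _ => hint _ j, integral_mul_const,
      integral_sampleInd_mul_sampleInd hA, hp, add_mul, Finset.sum_add_distrib, ite_mul, zero_mul,
      ← Finset.mul_sum, hsum0]
    simp only [Finset.sum_ite_eq, Finset.mem_univ, if_true, real_inner_self_eq_norm_sq,
      ← Finset.mul_sum]
    rw [hq]
    field_simp
    ring

end Sampling

/-! ### The regularized local objectives -/

lemma convexOn_finset_sum {ι E : Type*} [AddCommGroup E] [Module ℝ E] {g : ι → E → ℝ}
    (t : Finset ι) (hg : ∀ i ∈ t, ConvexOn ℝ Set.univ (g i)) :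
    ConvexOn ℝ Set.univ (fun x => ∑ i ∈ t, g i x) := by
  classical
  induction t using Finset.induction_on with
  | empty => simpa using convexOn_const (0 : ℝ) convex_univ
  | insert a t ha ih =>
    simp_rw [Finset.sum_insert ha]
    exact (hg a (Finset.mem_insert_self a t)).add
      (ih fun i hi => hg i (Finset.mem_insert_of_mem hi))

namespace FedProblem

variable {n N : ℕ} {Ξ : Type u} {Z : Type v} [MeasurableSpace Ξ] [MeasurableSpace Z]
variable (Pr : FedProblem n N Ξ Z)

/-- Regularized local objective `h_i + η f_i`. -/
def regLoc (η : ℝ) (i : Fin N) (x : Vec n) : ℝ := Pr.hi i x + η * Pr.fi i x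

/-- Gradient of the regularized local objective. -/
def regGrad (η : ℝ) (i : Fin N) (x : Vec n) : Vec n :=
  η • gradient (Pr.fi i) x + gradient (Pr.hi i) x

/-- Stochastic gradient of the regularized local objective at the sample `s = (ξ, ζ)`. -/
def stochGrad (η : ℝ) (i : Fin N) (x : Vec n) (s : Ξ × Z) : Vec n :=
  η • gradient (fun y => Pr.ft i y s.1) x + gradient (fun y => Pr.ht i y s.2) x

/-- Error of the stochastic gradient. -/
def gradNoise (η : ℝ) (i : Fin N) (x : Vec n) (s : Ξ × Z) : Vec n :=
  Pr.stochGrad η i x s - Pr.regGrad η i x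

/-- Bregman divergence of the regularized local objective. -/
def bregman (η : ℝ) (i : Fin N) (x y : Vec n) : ℝ :=
  Pr.regLoc η i x - Pr.regLoc η i y - inner ℝ (Pr.regGrad η i y) (x - y)

/-- Variance bound of the stochastic gradients of the regularized objective. -/
def varReg (c : FedConstants) (η : ℝ) : ℝ := 2 * η ^ 2 * c.σf ^ 2 + 2 * c.σh ^ 2

/-- Mean squared norm of the regularized local gradients. -/
def gradSq (η : ℝ) (x : Vec n) : ℝ := 1 / (N : ℝ) * ∑ i, ‖Pr.regGrad η i x‖ ^ 2

variable {Pr} {c : FedConstants} {η : ℝ}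

lemma avg_regLoc (η : ℝ) (x : Vec n) : 1 / (N : ℝ) * ∑ i, Pr.regLoc η i x = Pr.freg η x := by
  simp only [regLoc, freg, h, f, Finset.sum_add_distrib, ← Finset.mul_sum]
  ring

lemma gradNoise_sq_le (η : ℝ) (i : Fin N) (x : Vec n) (s : Ξ × Z) :
    ‖Pr.gradNoise η i x s‖ ^ 2 ≤
      2 * η ^ 2 * ‖gradient (fun y => Pr.ft i y s.1) x - gradient (Pr.fi i) x‖ ^ 2 +
        2 * ‖gradient (fun y => Pr.ht i y s.2) x - gradient (Pr.hi i) x‖ ^ 2 := by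
  have e : Pr.gradNoise η i x s =
      η • (gradient (fun y => Pr.ft i y s.1) x - gradient (Pr.fi i) x) +
        (gradient (fun y => Pr.ht i y s.2) x - gradient (Pr.hi i) x) := by
    simp only [gradNoise, stochGrad, regGrad, smul_sub]; abel
  rw [e]
  refine (norm_add_sq_le_two _ _).trans (le_of_eq ?_)
  rw [norm_smul, mul_pow, Real.norm_eq_abs, sq_abs]
  ring

namespace Assumptions

variable (hA : Pr.Assumptions c)
include hA

lemma convexOn_f : ConvexOn ℝ Set.univ Pr.f :=
  (convexOn_finset_sum Finset.univ fun i _ => hA.convex_fi i).smul (by positivity)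

lemma convexOn_h : ConvexOn ℝ Set.univ Pr.h :=
  (convexOn_finset_sum Finset.univ fun i _ => hA.convex_hi i).smul (by positivity)

lemma differentiable_f : Differentiable ℝ Pr.f :=
  (Differentiable.fun_sum fun i _ => hA.diff_fi i).const_mul _

lemma differentiable_h : Differentiable ℝ Pr.h :=
  (Differentiable.fun_sum fun i _ => hA.diff_hi i).const_mul _

lemma hasGradientAt_f (x : Vec n) : HasGradientAt Pr.f (gradient Pr.f x) x :=
  (hA.differentiable_f x).hasGradientAt

lemma convexOn_regLoc (hη : 0 ≤ η) (i : Fin N) : ConvexOn ℝ Set.univ (Pr.regLoc η i) :=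
  (hA.convex_hi i).add ((hA.convex_fi i).smul hη)

lemma hasGradientAt_regLoc (η : ℝ) (i : Fin N) (x : Vec n) :
    HasGradientAt (Pr.regLoc η i) (Pr.regGrad η i x) x := by
  have h1 := (hA.diff_hi i x).hasGradientAt.hasFDerivAt
  have h2 := (hA.diff_fi i x).hasGradientAt.hasFDerivAt
  rw [hasGradientAt_iff_hasFDerivAt]
  have e : InnerProductSpace.toDual ℝ (Vec n) (Pr.regGrad η i x) =
      InnerProductSpace.toDual ℝ (Vec n) (gradient (Pr.hi i) x) +
        η • InnerProductSpace.toDual ℝ (Vec n) (gradient (Pr.fi i) x) := by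
    rw [regGrad, map_add, add_comm]
    simp
  rw [e]
  exact h1.add (h2.const_mul η)

lemma Lreg_nonneg (hη : 0 ≤ η) : 0 ≤ c.Lreg η :=
  add_nonneg hA.nonneg.2.1 (mul_nonneg hη hA.nonneg.1)

lemma norm_regGrad_sub_le (hη : 0 ≤ η) (i : Fin N) (x y : Vec n) :
    ‖Pr.regGrad η i x - Pr.regGrad η i y‖ ≤ c.Lreg η * ‖x - y‖ := by
  have e : Pr.regGrad η i x - Pr.regGrad η i y =
      η • (gradient (Pr.fi i) x - gradient (Pr.fi i) y) +
        (gradient (Pr.hi i) x - gradient (Pr.hi i) y) := by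
    simp only [regGrad, smul_sub]; abel
  rw [e]
  refine (norm_add_le _ _).trans ?_
  rw [norm_smul, Real.norm_of_nonneg hη, FedConstants.Lreg]
  have h1 := mul_le_mul_of_nonneg_left (hA.smooth_fi i x y) hη
  have h2 := hA.smooth_hi i x y
  linarith

lemma continuous_regGrad (hη : 0 ≤ η) (i : Fin N) : Continuous (Pr.regGrad η i) :=
  (LipschitzWith.of_dist_le_mul (K := (c.Lreg η).toNNReal) fun x y => by
    rw [dist_eq_norm, dist_eq_norm, Real.coe_toNNReal _ (hA.Lreg_nonneg hη)]
    exact hA.norm_regGrad_sub_le hη i x y).continuous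

lemma continuous_regLoc (η : ℝ) (i : Fin N) : Continuous (Pr.regLoc η i) :=
  continuous_iff_continuousAt.2 fun x => (hA.hasGradientAt_regLoc η i x).continuousAt

lemma bregman_nonneg (hη : 0 ≤ η) (i : Fin N) (x y : Vec n) : 0 ≤ Pr.bregman η i x y := by
  have := (hA.convexOn_regLoc hη i).add_inner_gradient_le (hA.hasGradientAt_regLoc η i) y x
  unfold bregman; linarith

lemma norm_regGrad_sub_sq_le (hη : 0 ≤ η) (i : Fin N) (x y : Vec n) :
    ‖Pr.regGrad η i x - Pr.regGrad η i y‖ ^ 2 ≤ 2 * c.Lreg η * Pr.bregman η i x y :=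
  norm_gradient_sub_sq_le (hA.convexOn_regLoc hη i) (hA.hasGradientAt_regLoc η i)
    (hA.Lreg_nonneg hη) (hA.norm_regGrad_sub_le hη i) x y

lemma neg_inner_regGrad_le (hη : 0 ≤ η) (i : Fin N) (x y z : Vec n) :
    -inner ℝ (Pr.regGrad η i y) (x - z) ≤
      Pr.regLoc η i z - Pr.regLoc η i x - Pr.bregman η i z y + c.Lreg η / 2 * ‖y - x‖ ^ 2 :=
  inner_gradient_le_of_near (hA.hasGradientAt_regLoc η i) (hA.norm_regGrad_sub_le hη i) x y z

/-- At a minimizer of the regularized objective the local gradients sum to zero. -/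
lemma sum_regGrad_eq_zero (hN : 0 < N) {x : Vec n} (hx : Pr.IsRegMin η x) :
    ∑ i, Pr.regGrad η i x = 0 := by
  have h1 : HasFDerivAt (fun y => ∑ i, Pr.regLoc η i y)
      (∑ i, InnerProductSpace.toDual ℝ (Vec n) (Pr.regGrad η i x)) x :=
    HasFDerivAt.fun_sum fun i _ => (hA.hasGradientAt_regLoc η i x).hasFDerivAt
  have hmin : IsLocalMin (fun y => ∑ i, Pr.regLoc η i y) x := by
    refine Filter.Eventually.of_forall fun y => ?_
    have := hx y
    rw [← avg_regLoc, ← avg_regLoc] at this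
    exact le_of_mul_le_mul_left this (by positivity)
  have h0 := hmin.hasFDerivAt_eq_zero h1
  rw [← map_sum] at h0
  exact (InnerProductSpace.toDual ℝ (Vec n)).map_eq_zero_iff.1 h0

/-- The mean Bregman divergence from a minimizer is the gap of the regularized objective. -/
lemma avg_bregman (hN : 0 < N) {x : Vec n} (hx : Pr.IsRegMin η x) (y : Vec n) :
    1 / (N : ℝ) * ∑ i, Pr.bregman η i y x = Pr.freg η y - Pr.freg η x := by
  simp only [bregman, Finset.sum_sub_distrib, ← sum_inner, hA.sum_regGrad_eq_zero hN hx,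
    inner_zero_left, sub_zero, mul_sub, avg_regLoc]

/-- The local gradients at the regularized minimizer are controlled by those at any other point
and the gap of the regularized objective. -/
lemma gradSq_le (hη : 0 ≤ η) (hN : 0 < N) {x : Vec n} (hx : Pr.IsRegMin η x) (y : Vec n) :
    Pr.gradSq η x ≤ 3 * c.Lreg η * (Pr.freg η y - Pr.freg η x) + 3 * Pr.gradSq η y := by
  have h : ∀ i, ‖Pr.regGrad η i x‖ ^ 2 ≤
      3 * c.Lreg η * Pr.bregman η i y x + 3 * ‖Pr.regGrad η i y‖ ^ 2 := by
    intro i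
    have h1 := norm_add_sq_le_weighted (Pr.regGrad η i x - Pr.regGrad η i y) (Pr.regGrad η i y)
    rw [sub_add_cancel, norm_sub_rev] at h1
    have h2 := hA.norm_regGrad_sub_sq_le hη i y x
    linarith
  have h3 := Finset.sum_le_sum fun i (_ : i ∈ Finset.univ) => h i
  rw [Finset.sum_add_distrib, ← Finset.mul_sum, ← Finset.mul_sum] at h3
  have h4 := mul_le_mul_of_nonneg_left h3 (show (0 : ℝ) ≤ 1 / N by positivity)
  rw [← hA.avg_bregman hN hx]
  unfold gradSq
  linarith

/-- At a bilevel solution the heterogeneity of the local gradients is at most `G²`. -/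
lemma gradSq_le_Gsq {xs : Vec n} : Pr.gradSq η xs ≤ Pr.Gsq c η xs := by
  have h : ∀ i, ‖Pr.regGrad η i xs‖ ^ 2 ≤
      2 * η ^ 2 * ‖gradient (Pr.fi i) xs‖ ^ 2 + 2 * ‖gradient (Pr.hi i) xs‖ ^ 2 := by
    intro i
    have h1 := norm_add_sq_le_two (η • gradient (Pr.fi i) xs) (gradient (Pr.hi i) xs)
    rw [norm_smul, mul_pow, Real.norm_eq_abs, sq_abs] at h1
    unfold regGrad; linarith
  have h3 := Finset.sum_le_sum fun i (_ : i ∈ Finset.univ) => h i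
  rw [Finset.sum_add_distrib, ← Finset.mul_sum, ← Finset.mul_sum] at h3
  have h4 := mul_le_mul_of_nonneg_left h3 (show (0 : ℝ) ≤ 1 / N by positivity)
  have hf := hA.bgd_f xs
  have hh := hA.bgd_h xs
  have hinf : 0 ≤ Pr.f xs - ⨅ z, Pr.f z := sub_nonneg.2 (ciInf_le hA.bddBelow_f xs)
  have hF : 0 ≤ 2 * c.Gf ^ 2 + 4 * c.Lf * c.Bf ^ 2 * (Pr.f xs - ⨅ z, Pr.f z) := by
    have := hA.nonneg.1
    positivity
  have h5 := mul_le_mul_of_nonneg_right (le_max_right 1 (η ^ 2)) hF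
  have h6 := mul_le_mul_of_nonneg_left hf (show 0 ≤ 2 * η ^ 2 by positivity)
  unfold gradSq Gsq
  linarith

lemma stochGrad_measurable (η : ℝ) (i : Fin N) :
    Measurable (Function.uncurry (Pr.stochGrad η i)) := by
  have h1 : Measurable fun p : Vec n × Ξ × Z => gradient (fun y => Pr.ft i y p.2.1) p.1 :=
    (hA.meas_ft i).comp (measurable_fst.prodMk (measurable_fst.comp measurable_snd))
  have h2 : Measurable fun p : Vec n × Ξ × Z => gradient (fun y => Pr.ht i y p.2.2) p.1 :=
    (hA.meas_ht i).comp (measurable_fst.prodMk (measurable_snd.comp measurable_snd))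
  exact (h1.const_smul η).add h2

lemma gradNoise_measurable (hη : 0 ≤ η) (i : Fin N) :
    Measurable (Function.uncurry (Pr.gradNoise η i)) :=
  (hA.stochGrad_measurable η i).sub ((hA.continuous_regGrad hη i).measurable.comp measurable_fst)

lemma integrable_gradNoise (η : ℝ) (i : Fin N) (x : Vec n) :
    Integrable (Pr.gradNoise η i x) ((Pr.D i).prod (Pr.D' i)) := by
  have := hA.probD i
  have := hA.probD' i
  exact ((((hA.integrable_grad_ft i x).comp_fst _).smul η).add
    ((hA.integrable_grad_ht i x).comp_snd _)).sub (integrable_const _)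

lemma integral_gradNoise (η : ℝ) (i : Fin N) (x : Vec n) :
    ∫ s, Pr.gradNoise η i x s ∂((Pr.D i).prod (Pr.D' i)) = 0 := by
  have := hA.probD i
  have := hA.probD' i
  have h1 := ((hA.integrable_grad_ft i x).comp_fst (Pr.D' i)).smul η
  have h2 := (hA.integrable_grad_ht i x).comp_snd (Pr.D i)
  unfold gradNoise stochGrad
  refine (integral_sub (h1.add h2) (integrable_const _)).trans ?_
  simp only [Pi.add_apply, Pi.smul_apply]
  refine (congrArg (· - _) (integral_add h1 h2)).trans ?_
  simp only [Pi.smul_apply]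
  rw [integral_smul,
    integral_fun_fst (fun ξ => gradient (fun y => Pr.ft i y ξ) x),
    integral_fun_snd (fun ζ => gradient (fun y => Pr.ht i y ζ) x)]
  simp [hA.unbiased_f, hA.unbiased_h, regGrad]

lemma integrable_gradNoise_sq (η : ℝ) (i : Fin N) (x : Vec n) :
    Integrable (fun s => ‖Pr.gradNoise η i x s‖ ^ 2) ((Pr.D i).prod (Pr.D' i)) := by
  have := hA.probD i
  have := hA.probD' i
  refine Integrable.mono' ((((hA.integrable_var_f i x).comp_fst (Pr.D' i)).const_mul
    (2 * η ^ 2)).add (((hA.integrable_var_h i x).comp_snd (Pr.D i)).const_mul 2))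
    ((hA.integrable_gradNoise η i x).aestronglyMeasurable.norm.pow 2)
    (Filter.Eventually.of_forall fun s => ?_)
  simpa using gradNoise_sq_le η i x s

lemma integral_gradNoise_sq_le (η : ℝ) (i : Fin N) (x : Vec n) :
    ∫ s, ‖Pr.gradNoise η i x s‖ ^ 2 ∂((Pr.D i).prod (Pr.D' i)) ≤ varReg c η := by
  have := hA.probD i
  have := hA.probD' i
  have h1 := ((hA.integrable_var_f i x).comp_fst (Pr.D' i)).const_mul (2 * η ^ 2)
  have h2 := ((hA.integrable_var_h i x).comp_snd (Pr.D i)).const_mul 2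
  refine (integral_mono (hA.integrable_gradNoise_sq η i x) (h1.add h2)
    (gradNoise_sq_le η i x)).trans ?_
  simp only [Pi.add_apply]
  rw [integral_add h1 h2, integral_const_mul, integral_const_mul,
    integral_fun_fst (fun ξ => ‖gradient (fun y => Pr.ft i y ξ) x - gradient (Pr.fi i) x‖ ^ 2),
    integral_fun_snd (fun ζ => ‖gradient (fun y => Pr.ht i y ζ) x - gradient (Pr.hi i) x‖ ^ 2)]
  have h3 := mul_le_mul_of_nonneg_left (hA.variance_f i x) (show 0 ≤ 2 * η ^ 2 by positivity)
  have h4 := hA.variance_h i x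
  simp only [probReal_univ, one_smul, varReg]
  linarith

end Assumptions

end FedProblem

/-! ### The stochastic process of the algorithm -/

namespace FedRun

variable {n N : ℕ} {Ξ : Type u} {Z : Type v} {Ω : Type w}
variable [MeasurableSpace Ξ] [MeasurableSpace Z]

lemma localIter_eq (Pr : FedProblem n N Ξ Z) (p : FedParams) (i : Fin N) (s : ℕ → Ξ × Z)
    (x : Vec n) (k : ℕ) :
    localIter Pr p i s x k =
      x - p.γl • ∑ j ∈ Finset.range k, Pr.stochGrad p.η i (localIter Pr p i s x j) (s j) := by
  induction k with
  | zero => simp [localIter]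
  | succ k ih =>
    rw [Finset.sum_range_succ, smul_add, ← sub_sub, ← ih]
    rfl

/-- The local model of client `i` in round `r` after `k` local steps. -/
def loc (run : FedRun n N Ξ Z Ω) (Pr : FedProblem n N Ξ Z) (p : FedParams) (r : ℕ) (i : Fin N)
    (k : ℕ) (ω : Ω) : Vec n :=
  localIter Pr p i (fun k => run.θ r i k ω) (run.iter Pr p ω r) k

/-- The stochastic gradient error of client `i` in round `r` at local step `k`. -/
def noise (run : FedRun n N Ξ Z Ω) (Pr : FedProblem n N Ξ Z) (p : FedParams) (r : ℕ) (i : Fin N)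
    (k : ℕ) (ω : Ω) : Vec n :=
  Pr.gradNoise p.η i (run.loc Pr p r i k ω) (run.θ r i k ω)

lemma loc_sub_iter (run : FedRun n N Ξ Z Ω) (Pr : FedProblem n N Ξ Z) (p : FedParams) (r : ℕ)
    (i : Fin N) (k : ℕ) (ω : Ω) :
    run.loc Pr p r i k ω - run.iter Pr p ω r =
      -(p.γl • ∑ j ∈ Finset.range k, (Pr.regGrad p.η i (run.loc Pr p r i j ω) +
        run.noise Pr p r i j ω)) := by
  rw [loc, localIter_eq, sub_sub_cancel_left]
  simp [noise, FedProblem.gradNoise, loc]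

/-- The information carried by the initial point, the client samples of the rounds in `I`, and the
data samples with index in `J`. -/
@[reducible]
def history (run : FedRun n N Ξ Z Ω) (I : Set ℕ) (J : Set (ℕ × Fin N × ℕ)) : MeasurableSpace Ω :=
  (MeasurableSpace.comap run.x0 inferInstance ⊔
    ⨆ r ∈ I, MeasurableSpace.comap (run.smp r) inferInstance) ⊔
    ⨆ q ∈ J, MeasurableSpace.comap (run.θ q.1 q.2.1 q.2.2) inferInstance

section Measurability

variable {run : FedRun n N Ξ Z Ω} {I : Set ℕ} {J : Set (ℕ × Fin N × ℕ)}

lemma measurable_x0_history : Measurable[run.history I J] run.x0 :=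
  measurable_iff_comap_le.2 (le_sup_left.trans le_sup_left)

lemma measurable_smp_history {r : ℕ} (hr : r ∈ I) : Measurable[run.history I J] (run.smp r) :=
  measurable_iff_comap_le.2 (((le_iSup₂ (f := fun r (_ : r ∈ I) =>
    MeasurableSpace.comap (run.smp r) inferInstance) r hr).trans le_sup_right).trans le_sup_left)

lemma measurable_θ_history {r : ℕ} {i : Fin N} {k : ℕ} (hq : (r, i, k) ∈ J) :
    Measurable[run.history I J] (run.θ r i k) :=
  measurable_iff_comap_le.2 ((le_iSup₂ (f := fun (q : ℕ × Fin N × ℕ) (_ : q ∈ J) =>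
    MeasurableSpace.comap (run.θ q.1 q.2.1 q.2.2) inferInstance) (r, i, k) hq).trans le_sup_right)

variable {Pr : FedProblem n N Ξ Z} {c : FedConstants} {p : FedParams}

lemma measurable_localIter (hA : Pr.Assumptions c) {m : MeasurableSpace Ω} {i : Fin N}
    {s : ℕ → Ω → Ξ × Z} {x : Ω → Vec n} {k : ℕ} (hx : Measurable x)
    (hs : ∀ j < k, Measurable (s j)) :
    Measurable fun ω => localIter Pr p i (fun j => s j ω) (x ω) k := by
  induction k with
  | zero => exact hx
  | succ k ih =>
    have h := ih fun j hj => hs j (hj.trans (Nat.lt_succ_self k))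
    exact h.sub (((hA.stochGrad_measurable p.η i).comp
      (h.prodMk (hs k (Nat.lt_succ_self k)))).const_smul p.γl)

lemma measurable_iter (hA : Pr.Assumptions c) {m : MeasurableSpace Ω} {r : ℕ}
    (h0 : Measurable run.x0) (hsmp : ∀ s < r, Measurable (run.smp s))
    (hθ : ∀ s < r, ∀ i k, Measurable (run.θ s i k)) :
    Measurable fun ω => run.iter Pr p ω r := by
  induction r with
  | zero => exact h0
  | succ r ih =>
    have h := ih (fun s hs => hsmp s (hs.trans (Nat.lt_succ_self r)))
      (fun s hs => hθ s (hs.trans (Nat.lt_succ_self r)))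
    have hr := hsmp r (Nat.lt_succ_self r)
    have hcard : Measurable fun ω => (1 / ((run.smp r ω).card : ℝ)) :=
      (measurable_of_countable fun B : Finset (Fin N) => 1 / (B.card : ℝ)).comp hr
    have hsum : Measurable fun ω => ∑ i ∈ run.smp r ω,
        (localIter Pr p i (fun k => run.θ r i k ω) (run.iter Pr p ω r) p.K -
          run.iter Pr p ω r) := by
      have e : (fun ω => ∑ i ∈ run.smp r ω,
          (localIter Pr p i (fun k => run.θ r i k ω) (run.iter Pr p ω r) p.K -
            run.iter Pr p ω r)) = fun ω => ∑ i, sampleInd (run.smp r ω) i •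
          (localIter Pr p i (fun k => run.θ r i k ω) (run.iter Pr p ω r) p.K -
            run.iter Pr p ω r) := funext fun ω => (sum_sampleInd_smul _ _).symm
      rw [e]
      refine Finset.measurable_sum _ fun i _ => ?_
      exact ((measurable_sampleInd i).comp hr).smul
        ((measurable_localIter hA h fun k _ => hθ r (Nat.lt_succ_self r) i k).sub h)
    exact h.add ((hcard.smul hsum).const_smul p.γg)

lemma measurable_iter_history (hA : Pr.Assumptions c) {r : ℕ} (hI : ∀ s < r, s ∈ I)
    (hJ : ∀ s < r, ∀ i k, (s, i, k) ∈ J) :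
    Measurable[run.history I J] fun ω => run.iter Pr p ω r :=
  measurable_iter hA measurable_x0_history (fun s hs => measurable_smp_history (hI s hs))
    fun s hs i k => measurable_θ_history (hJ s hs i k)

lemma measurable_loc_history (hA : Pr.Assumptions c) {r : ℕ} {i : Fin N} {k : ℕ}
    (hI : ∀ s < r, s ∈ I) (hJ : ∀ s < r, ∀ i k, (s, i, k) ∈ J) (hJ' : ∀ j < k, (r, i, j) ∈ J) :
    Measurable[run.history I J] (run.loc Pr p r i k) :=
  measurable_localIter (s := fun j => run.θ r i j) (x := fun ω => run.iter Pr p ω r) hA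
    (measurable_iter_history hA hI hJ) fun j hj => measurable_θ_history (hJ' j hj)

lemma measurable_noise (hA : Pr.Assumptions c) (hη : 0 ≤ p.η) {m : MeasurableSpace Ω} {r : ℕ}
    {i : Fin N} {k : ℕ} (h1 : Measurable (run.loc Pr p r i k)) (h2 : Measurable (run.θ r i k)) :
    Measurable (run.noise Pr p r i k) := by
  have e : run.noise Pr p r i k = Function.uncurry (Pr.gradNoise p.η i) ∘
      fun ω => (run.loc Pr p r i k ω, run.θ r i k ω) := by
    funext ω
    simp only [noise, Function.comp_apply, Function.uncurry_apply_pair]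
  rw [e]
  exact Measurable.comp (hA.gradNoise_measurable hη i) (Measurable.prodMk h1 h2)

lemma measurable_noise_history (hA : Pr.Assumptions c) (hη : 0 ≤ p.η) {r : ℕ} {i : Fin N} {k : ℕ}
    (hI : ∀ s < r, s ∈ I) (hJ : ∀ s < r, ∀ i k, (s, i, k) ∈ J) (hJ' : ∀ j ≤ k, (r, i, j) ∈ J) :
    Measurable[run.history I J] (run.noise Pr p r i k) :=
  measurable_noise hA hη (measurable_loc_history hA hI hJ fun j hj => hJ' j hj.le)
    (measurable_θ_history (hJ' k le_rfl))

lemma measurable_iter_ne (hA : Pr.Assumptions c) (r : ℕ) :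
    Measurable[run.history {s | s ≠ r} Set.univ] fun ω => run.iter Pr p ω r :=
  measurable_iter_history hA (fun _ hs => hs.ne) fun _ _ _ _ => Set.mem_univ _

lemma measurable_loc_ne (hA : Pr.Assumptions c) (r : ℕ) (i : Fin N) (k : ℕ) :
    Measurable[run.history {s | s ≠ r} Set.univ] (run.loc Pr p r i k) :=
  measurable_loc_history hA (fun _ hs => hs.ne) (fun _ _ _ _ => Set.mem_univ _)
    fun _ _ => Set.mem_univ _

lemma measurable_noise_ne (hA : Pr.Assumptions c) (hη : 0 ≤ p.η) (r : ℕ) (i : Fin N) (k : ℕ) :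
    Measurable[run.history {s | s ≠ r} Set.univ] (run.noise Pr p r i k) :=
  measurable_noise_history hA hη (fun _ hs => hs.ne) (fun _ _ _ _ => Set.mem_univ _)
    fun _ _ => Set.mem_univ _

lemma measurable_norm_sq {m : MeasurableSpace Ω} {F : Ω → Vec n} (hF : Measurable F) :
    Measurable fun ω => ‖F ω‖ ^ 2 :=
  hF.norm.pow_const 2

lemma measurable_inner_sub_const {m : MeasurableSpace Ω} {F X : Ω → Vec n} (hF : Measurable F)
    (hX : Measurable X) (x : Vec n) : Measurable fun ω => (inner ℝ (F ω) (X ω - x) : ℝ) :=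
  hF.inner (hX.sub measurable_const)

end Measurability

variable [mΩ : MeasurableSpace Ω] {μ : Measure Ω}
variable {run : FedRun n N Ξ Z Ω} {Pr : FedProblem n N Ξ Z} {c : FedConstants} {p : FedParams}
variable {S : ℕ}

namespace IsSampling

variable (hS : run.IsSampling Pr S μ)
include hS

lemma history_le (I : Set ℕ) (J : Set (ℕ × Fin N × ℕ)) : run.history I J ≤ mΩ :=
  sup_le (sup_le hS.meas_x0.comap_le (iSup₂_le fun r _ => (hS.meas_smp r).comap_le))
    (iSup₂_le fun q _ => (hS.meas_θ q.1 q.2.1 q.2.2).comap_le)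

variable [IsProbabilityMeasure μ]

/-- A part of the samples is independent of the initial point together with any disjoint part of
the samples. -/
lemma indep_samples {I I' : Set ℕ} {J J' : Set (ℕ × Fin N × ℕ)} (hI : Disjoint I I')
    (hJ : Disjoint J J') :
    Indep ((⨆ r ∈ I, MeasurableSpace.comap (run.smp r) inferInstance) ⊔
        ⨆ q ∈ J, MeasurableSpace.comap (run.θ q.1 q.2.1 q.2.2) inferInstance)
      (run.history I' J') μ := by
  have hsm : ∀ r, MeasurableSpace.comap (run.smp r) inferInstance ≤ mΩ :=
    fun r => (hS.meas_smp r).comap_le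
  have hθm : ∀ q : ℕ × Fin N × ℕ,
      MeasurableSpace.comap (run.θ q.1 q.2.1 q.2.2) inferInstance ≤ mΩ :=
    fun q => (hS.meas_θ q.1 q.2.1 q.2.2).comap_le
  have hsmp : ∀ r, MeasurableSpace.comap (run.smp r) inferInstance ≤
      MeasurableSpace.comap (fun ω (r : ℕ) => run.smp r ω) inferInstance := fun r =>
    comap_comp_le (F := fun ω (r : ℕ) => run.smp r ω) (measurable_pi_apply r)
  have hθ : ∀ q : ℕ × Fin N × ℕ, MeasurableSpace.comap (run.θ q.1 q.2.1 q.2.2) inferInstance ≤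
      MeasurableSpace.comap (fun ω (q : ℕ × Fin N × ℕ) => run.θ q.1 q.2.1 q.2.2 ω)
        inferInstance := fun q =>
    comap_comp_le (F := fun ω (q : ℕ × Fin N × ℕ) => run.θ q.1 q.2.1 q.2.2 ω)
      (measurable_pi_apply q)
  have hpair1 := comap_comp_le (F := fun ω => ((fun r : ℕ => run.smp r ω),
    (fun q : ℕ × Fin N × ℕ => run.θ q.1 q.2.1 q.2.2 ω))) measurable_fst
  have hpair2 := comap_comp_le (F := fun ω => ((fun r : ℕ => run.smp r ω),
    (fun q : ℕ × Fin N × ℕ => run.θ q.1 q.2.1 q.2.2 ω))) measurable_snd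
  refine Indep.regroup_blocks (iSup₂_le fun r _ => hsm r) (iSup₂_le fun r _ => hsm r)
    (iSup₂_le fun q _ => hθm q) (iSup₂_le fun q _ => hθm q) hS.meas_x0.comap_le
    (indep_iSup_of_disjoint hsm hS.indep_smp hI) (indep_iSup_of_disjoint hθm hS.indep_θ hJ) ?_ ?_
  · have h := (IndepFun_iff_Indep _ _ _).1 hS.indep_smp_θ
    exact indep_of_indep_of_le_left (indep_of_indep_of_le_right h
      (sup_le (iSup₂_le fun q _ => hθ q) (iSup₂_le fun q _ => hθ q)))
      (sup_le (iSup₂_le fun r _ => hsmp r) (iSup₂_le fun r _ => hsmp r))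
  · have h := ((IndepFun_iff_Indep _ _ _).1 hS.indep_x0).symm
    refine indep_of_indep_of_le_left h (sup_le (sup_le ?_ ?_) (sup_le ?_ ?_))
    · exact iSup₂_le fun r _ => (hsmp r).trans hpair1
    · exact iSup₂_le fun r _ => (hsmp r).trans hpair1
    · exact iSup₂_le fun q _ => (hθ q).trans hpair2
    · exact iSup₂_le fun q _ => (hθ q).trans hpair2

lemma indep_θ_history {r : ℕ} {i : Fin N} {k : ℕ} {I : Set ℕ} {J : Set (ℕ × Fin N × ℕ)}
    (hJ : (r, i, k) ∉ J) :
    Indep (MeasurableSpace.comap (run.θ r i k) inferInstance) (run.history I J) μ := by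
  refine indep_of_indep_of_le_left (hS.indep_samples (I := ∅) (J := {(r, i, k)}) (by simp)
    (by simpa using hJ)) ?_
  simp

lemma indep_smp_history {r : ℕ} {I : Set ℕ} {J : Set (ℕ × Fin N × ℕ)} (hI : r ∉ I) :
    Indep (MeasurableSpace.comap (run.smp r) inferInstance) (run.history I J) μ := by
  refine indep_of_indep_of_le_left (hS.indep_samples (I := {r}) (J := ∅) (by simpa using hI)
    (by simp)) ?_
  simp

end IsSampling

end FedRun

/-! ### Second moments along the run -/

section Orthogonal

variable {Ω E ι : Type*} {mΩ : MeasurableSpace Ω} {μ : Measure Ω} [NormedAddCommGroup E]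
  [InnerProductSpace ℝ E]

/-- Pythagoras for pairwise orthogonal square-integrable random vectors. -/
lemma integral_norm_sq_sum_of_orthogonal (s : Finset ι) {w : ι → Ω → E}
    (hw : ∀ q ∈ s, MemLp (w q) 2 μ)
    (horth : ∀ q ∈ s, ∀ q' ∈ s, q ≠ q' → ∫ ω, inner ℝ (w q ω) (w q' ω) ∂μ = 0) :
    ∫ ω, ‖∑ q ∈ s, w q ω‖ ^ 2 ∂μ = ∑ q ∈ s, ∫ ω, ‖w q ω‖ ^ 2 ∂μ := by
  classical
  have hpt : ∀ ω, ‖∑ q ∈ s, w q ω‖ ^ 2 = ∑ q ∈ s, ∑ q' ∈ s, inner ℝ (w q ω) (w q' ω) := by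
    intro ω
    rw [← real_inner_self_eq_norm_sq, sum_inner]
    simp_rw [inner_sum]
  have hint : ∀ q ∈ s, ∀ q' ∈ s, Integrable (fun ω => inner ℝ (w q ω) (w q' ω)) μ :=
    fun q hq q' hq' => (hw q hq).integrable_inner_of_two (hw q' hq')
  simp_rw [hpt]
  rw [integral_finsetSum _ fun q hq => integrable_finsetSum _ fun q' hq' => hint q hq q' hq']
  refine Finset.sum_congr rfl fun q hq => ?_
  rw [integral_finsetSum _ fun q' hq' => hint q hq q' hq', Finset.sum_eq_single q]
  · simp_rw [real_inner_self_eq_norm_sq]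
  · intro q' hq' hne
    exact horth q hq q' hq' (Ne.symm hne)
  · exact fun h => absurd hq h

lemma memLp_sampleInd_smul {N : ℕ} {A : Ω → Finset (Fin N)} (hA : Measurable A) {F : Ω → E}
    (hF : MemLp F 2 μ) (i : Fin N) : MemLp (fun ω => sampleInd (A ω) i • F ω) 2 μ := by
  refine hF.of_le (((measurable_sampleInd i).comp hA).aestronglyMeasurable.smul
    hF.aestronglyMeasurable) (Filter.Eventually.of_forall fun ω => ?_)
  rw [norm_smul, Real.norm_eq_abs]
  exact mul_le_of_le_one_left (norm_nonneg _) (abs_sampleInd_le _ _)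

end Orthogonal

/-- Mean of `q i k` over the clients `i` and the local steps `k < K`. -/
def clientMean (N K : ℕ) (q : Fin N → ℕ → ℝ) : ℝ :=
  1 / ((N : ℝ) * K) * ∑ i, ∑ k ∈ Finset.range K, q i k

section ClientMean

variable {N K : ℕ} {q q' : Fin N → ℕ → ℝ}

lemma clientMean_mono (h : ∀ i, ∀ k < K, q i k ≤ q' i k) :
    clientMean N K q ≤ clientMean N K q' := by
  unfold clientMean
  gcongr with i _ k hk
  exact h i k (Finset.mem_range.1 hk)

lemma clientMean_add : clientMean N K (fun i k => q i k + q' i k) =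
    clientMean N K q + clientMean N K q' := by
  simp only [clientMean, Finset.sum_add_distrib, mul_add]

lemma clientMean_sub : clientMean N K (fun i k => q i k - q' i k) =
    clientMean N K q - clientMean N K q' := by
  simp only [clientMean, Finset.sum_sub_distrib, mul_sub]

lemma clientMean_const_mul (a : ℝ) : clientMean N K (fun i k => a * q i k) =
    a * clientMean N K q := by
  simp only [clientMean, ← Finset.mul_sum]; ring

lemma clientMean_const_left (hK : 0 < K) (a : Fin N → ℝ) :
    clientMean N K (fun i _ => a i) = 1 / (N : ℝ) * ∑ i, a i := by
  simp only [clientMean, Finset.sum_const, Finset.card_range, nsmul_eq_mul, ← Finset.mul_sum]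
  field_simp

end ClientMean

namespace FedRun

variable {n N : ℕ} {Ξ : Type u} {Z : Type v} {Ω : Type w}
variable [MeasurableSpace Ξ] [MeasurableSpace Z] [mΩ : MeasurableSpace Ω]
variable {μ : Measure Ω} [IsProbabilityMeasure μ]
variable {run : FedRun n N Ξ Z Ω} {Pr : FedProblem n N Ξ Z} {c : FedConstants} {p : FedParams}

omit [IsProbabilityMeasure μ] in
/-- A round is one step of length `γeff` along the mean of the stochastic gradients, split into
local gradients and errors, over the sampled clients and the local steps. -/
lemma iter_succ_eq (hS : run.IsSampling Pr p.S μ) (hK : 0 < p.K) (r : ℕ) (ω : Ω) :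
    run.iter Pr p ω (r + 1) = run.iter Pr p ω r -
      p.γeff • ((1 / ((p.S : ℝ) * p.K)) • ∑ i ∈ run.smp r ω, ∑ k ∈ Finset.range p.K,
        (Pr.regGrad p.η i (run.loc Pr p r i k ω) + run.noise Pr p r i k ω)) := by
  have h : run.iter Pr p ω (r + 1) = run.iter Pr p ω r + p.γg •
      ((1 / ((run.smp r ω).card : ℝ)) • ∑ i ∈ run.smp r ω,
        (run.loc Pr p r i p.K ω - run.iter Pr p ω r)) := rfl
  rw [h]
  simp_rw [loc_sub_iter]
  rw [hS.card_smp, Finset.sum_neg_distrib, ← Finset.smul_sum, smul_neg, smul_neg, ← sub_eq_add_neg,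
    smul_smul, smul_smul, smul_smul]
  congr 2
  have : (p.K : ℝ) ≠ 0 := by positivity
  unfold FedParams.γeff
  field_simp

variable (hA : Pr.Assumptions c) (hη : 0 ≤ p.η)

include hA hη in
omit [IsProbabilityMeasure μ] in
lemma memLp_regGrad [IsFiniteMeasure μ] {Y : Ω → Vec n} (hY : MemLp Y 2 μ) (i : Fin N) :
    MemLp (fun ω => Pr.regGrad p.η i (Y ω)) 2 μ := by
  have h0 : MemLp (fun ω => c.Lreg p.η * ‖Y ω‖) 2 μ := hY.norm.const_mul (c.Lreg p.η)
  have h : MemLp (fun ω => ‖Pr.regGrad p.η i 0‖ + c.Lreg p.η * ‖Y ω‖) 2 μ :=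
    MemLp.add (f := fun _ => ‖Pr.regGrad p.η i 0‖) (memLp_const _) h0
  refine h.of_le ((hA.continuous_regGrad hη i).comp_aestronglyMeasurable hY.aestronglyMeasurable)
    (Filter.Eventually.of_forall fun ω => ?_)
  have h1 := hA.norm_regGrad_sub_le hη i (Y ω) 0
  have h2 := norm_sub_norm_le (Pr.regGrad p.η i (Y ω)) (Pr.regGrad p.η i 0)
  rw [sub_zero] at h1
  refine le_trans ?_ (le_abs_self _)
  linarith

namespace IsSampling

variable (hS : run.IsSampling Pr p.S μ)
include hA hη hS

lemma memLp_noise_and_integral_le (r : ℕ) (i : Fin N) (k : ℕ) :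
    MemLp (run.noise Pr p r i k) 2 μ ∧
      ∫ ω, ‖run.noise Pr p r i k ω‖ ^ 2 ∂μ ≤ FedProblem.varReg c p.η := by
  have := hA.probD i
  have := hA.probD' i
  refine memLp_noise (m := run.history Set.univ {q | q ≠ (r, i, k)}) (Y := run.loc Pr p r i k)
    (e := Pr.gradNoise p.η i) (T := run.θ r i k) (hS.history_le _ _) (hS.meas_θ r i k)
    (hS.law_θ r i k) (hS.indep_θ_history (by simp)) ?_ (hA.gradNoise_measurable hη i)
    (hA.integrable_gradNoise_sq p.η i) (hA.integral_gradNoise_sq_le p.η i)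
  refine measurable_loc_history hA (fun _ _ => Set.mem_univ _) (fun s hs j l h => ?_)
    (fun j hj h => ?_)
  · exact hs.ne (Prod.ext_iff.1 h).1
  · exact hj.ne (Prod.ext_iff.1 (Prod.ext_iff.1 h).2).2

/-- A gradient error is orthogonal to everything that does not involve its own data sample. -/
lemma integral_inner_noise (r : ℕ) (i : Fin N) (k : ℕ) {Q : Ω → Vec n}
    (hQ : Measurable[run.history Set.univ {q | q ≠ (r, i, k)}] Q) (hQL : MemLp Q 2 μ) :
    ∫ ω, inner ℝ (run.noise Pr p r i k ω) (Q ω) ∂μ = 0 := by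
  have := hA.probD i
  have := hA.probD' i
  refine integral_inner_noise_eq_zero (m := run.history Set.univ {q | q ≠ (r, i, k)})
    (Y := run.loc Pr p r i k)
    (e := Pr.gradNoise p.η i) (T := run.θ r i k) (hS.history_le _ _) (hS.meas_θ r i k)
    (hS.law_θ r i k) (hS.indep_θ_history (by simp)) ?_ (hA.gradNoise_measurable hη i)
    (hA.integrable_gradNoise p.η i) (hA.integral_gradNoise p.η i)
    (hS.memLp_noise_and_integral_le hA hη r i k).1 hQ hQL
  refine measurable_loc_history hA (fun _ _ => Set.mem_univ _) (fun s hs j l h => ?_)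
    (fun j hj h => ?_)
  · exact hs.ne (Prod.ext_iff.1 h).1
  · exact hj.ne (Prod.ext_iff.1 (Prod.ext_iff.1 h).2).2

lemma memLp_loc {r : ℕ} (hX : MemLp (fun ω => run.iter Pr p ω r) 2 μ) (i : Fin N) (k : ℕ) :
    MemLp (run.loc Pr p r i k) 2 μ := by
  induction k using Nat.strong_induction_on with
  | _ k ih =>
    have e : run.loc Pr p r i k = fun ω => run.iter Pr p ω r -
        p.γl • ∑ j ∈ Finset.range k, (Pr.regGrad p.η i (run.loc Pr p r i j ω) +
          run.noise Pr p r i j ω) := by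
      funext ω
      have := run.loc_sub_iter Pr p r i k ω
      rw [sub_eq_iff_eq_add] at this
      rw [this]; abel
    rw [e]
    have h : MemLp (fun ω => ∑ j ∈ Finset.range k, (Pr.regGrad p.η i (run.loc Pr p r i j ω) +
        run.noise Pr p r i j ω)) 2 μ :=
      memLp_finsetSum (f := fun j ω => Pr.regGrad p.η i (run.loc Pr p r i j ω) +
        run.noise Pr p r i j ω) (Finset.range k) fun j hj =>
        (memLp_regGrad hA hη (ih j (Finset.mem_range.1 hj)) i).add
          (hS.memLp_noise_and_integral_le hA hη r i j).1
    exact hX.sub (h.const_smul p.γl)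

lemma memLp_iter (hK : 0 < p.K) (r : ℕ) : MemLp (fun ω => run.iter Pr p ω r) 2 μ := by
  induction r with
  | zero => exact hS.memLp_x0
  | succ r ih =>
    simp_rw [iter_succ_eq hS hK]
    have e : (fun ω => ∑ i ∈ run.smp r ω, ∑ k ∈ Finset.range p.K,
        (Pr.regGrad p.η i (run.loc Pr p r i k ω) + run.noise Pr p r i k ω)) =
        fun ω => ∑ i, sampleInd (run.smp r ω) i • ∑ k ∈ Finset.range p.K,
        (Pr.regGrad p.η i (run.loc Pr p r i k ω) + run.noise Pr p r i k ω) :=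
      funext fun ω => (sum_sampleInd_smul _ _).symm
    have h1 : ∀ i, MemLp (fun ω => ∑ k ∈ Finset.range p.K,
        (Pr.regGrad p.η i (run.loc Pr p r i k ω) + run.noise Pr p r i k ω)) 2 μ := fun i =>
      memLp_finsetSum (f := fun k ω => Pr.regGrad p.η i (run.loc Pr p r i k ω) +
        run.noise Pr p r i k ω) (Finset.range p.K) fun k _ =>
        (memLp_regGrad hA hη (hS.memLp_loc hA hη ih i k) i).add
          (hS.memLp_noise_and_integral_le hA hη r i k).1
    have h2 := memLp_finsetSum (f := fun i ω => sampleInd (run.smp r ω) i •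
        ∑ k ∈ Finset.range p.K, (Pr.regGrad p.η i (run.loc Pr p r i k ω) +
          run.noise Pr p r i k ω)) Finset.univ fun i _ =>
        memLp_sampleInd_smul (hS.meas_smp r) (h1 i) i
    rw [← e] at h2
    have h3 := (h2.const_smul (1 / ((p.S : ℝ) * p.K))).const_smul p.γeff
    exact ih.sub h3

/-- Errors of the stochastic gradients at different clients or local steps are uncorrelated, also
after weighting by a bounded function of the sampled clients. -/
lemma integral_inner_noise_noise (r : ℕ) {i j : Fin N} {k l : ℕ} (h : (i, k) ≠ (j, l))
    (a : Finset (Fin N) → ℝ) (ha : ∀ B, |a B| ≤ 1) :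
    ∫ ω, a (run.smp r ω) * inner ℝ (run.noise Pr p r i k ω) (run.noise Pr p r j l ω) ∂μ = 0 := by
  -- the error with the later sample is the martingale difference
  wlog hlt : i ≠ j ∨ l < k generalizing i j k l
  · simp_rw [fun ω => real_inner_comm (run.noise Pr p r j l ω) (run.noise Pr p r i k ω)]
    push Not at hlt
    refine this h.symm (Or.inr (lt_of_le_of_ne hlt.2 fun hkl => h ?_))
    rw [hlt.1, hkl]
  have ham : Measurable a := measurable_of_countable a
  have hL := (hS.memLp_noise_and_integral_le hA hη r j l).1
  have hmem : MemLp (fun ω => a (run.smp r ω) • run.noise Pr p r j l ω) 2 μ := by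
    refine hL.of_le ((ham.comp (hS.meas_smp r)).aestronglyMeasurable.smul hL.aestronglyMeasurable)
      (Filter.Eventually.of_forall fun ω => ?_)
    rw [norm_smul, Real.norm_eq_abs]
    exact mul_le_of_le_one_left (norm_nonneg _) (ha _)
  have hsm : Measurable[run.history Set.univ {q | q ≠ (r, i, k)}] (run.smp r) :=
    measurable_smp_history (Set.mem_univ r)
  have hno : Measurable[run.history Set.univ {q | q ≠ (r, i, k)}] (run.noise Pr p r j l) := by
    refine measurable_noise_history hA hη (fun _ _ => Set.mem_univ _) (fun s hs j' l' h' => ?_)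
      (fun l' hl' h' => ?_)
    · exact hs.ne (Prod.ext_iff.1 h').1
    · have h2 := Prod.ext_iff.1 (Prod.ext_iff.1 h').2
      rcases hlt with hne | hlt
      · exact hne h2.1.symm
      · exact (hl'.trans_lt hlt).ne h2.2
  have h0 := hS.integral_inner_noise hA hη r i k ((ham.comp hsm).smul hno) hmem
  refine Eq.trans (integral_congr_ae (Filter.Eventually.of_forall fun ω => ?_)) h0
  simp only [Pi.smul_apply', Function.comp_apply]
  rw [inner_smul_right]

end IsSampling

end FedRun

/-! ### Descent in one communication round -/

lemma integrable_comp_of_memLp_two {Ω E : Type*} {mΩ : MeasurableSpace Ω} {μ : Measure Ω}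
    [IsFiniteMeasure μ] [NormedAddCommGroup E] [InnerProductSpace ℝ E] [CompleteSpace E]
    {φ : E → ℝ} {G : E → E} {L : ℝ} (hc : ConvexOn ℝ Set.univ φ)
    (hg : ∀ x, HasGradientAt φ (G x) x) (hL : ∀ x y, ‖G x - G y‖ ≤ L * ‖x - y‖)
    {Y : Ω → E} (hY : MemLp Y 2 μ) : Integrable (fun ω => φ (Y ω)) μ := by
  have hφ : Continuous φ := continuous_iff_continuousAt.2 fun x => (hg x).continuousAt
  have h1 : Integrable (fun ω => ‖Y ω‖) μ := (hY.integrable one_le_two).norm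
  have h2 : Integrable (fun ω => ‖Y ω‖ ^ 2) μ := hY.integrable_norm_pow two_ne_zero
  have h3 : Integrable (fun ω => |φ 0| + ‖G 0‖ * ‖Y ω‖ + |L| / 2 * ‖Y ω‖ ^ 2) μ :=
    ((integrable_const |φ 0|).add (h1.const_mul ‖G 0‖)).add (h2.const_mul (|L| / 2))
  exact h3.mono' (hφ.comp_aestronglyMeasurable hY.aestronglyMeasurable)
    (Filter.Eventually.of_forall fun ω => abs_le_quadratic hc hg hL (Y ω))

namespace FedProblem.Assumptions

variable {n N : ℕ} {Ξ : Type u} {Z : Type v} {Ω : Type w}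
variable [MeasurableSpace Ξ] [MeasurableSpace Z] [mΩ : MeasurableSpace Ω]
variable {μ : Measure Ω} [IsFiniteMeasure μ]
variable {Pr : FedProblem n N Ξ Z} {c : FedConstants} {η : ℝ}
variable (hA : Pr.Assumptions c) {Y : Ω → Vec n} (hY : MemLp Y 2 μ)
include hA hY

lemma integrable_f_comp : Integrable (fun ω => Pr.f (Y ω)) μ :=
  (integrable_finsetSum Finset.univ fun i _ => integrable_comp_of_memLp_two (hA.convex_fi i)
    (fun x => (hA.diff_fi i x).hasGradientAt) (hA.smooth_fi i) hY).const_mul (1 / (N : ℝ))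

lemma integrable_h_comp : Integrable (fun ω => Pr.h (Y ω)) μ :=
  (integrable_finsetSum Finset.univ fun i _ => integrable_comp_of_memLp_two (hA.convex_hi i)
    (fun x => (hA.diff_hi i x).hasGradientAt) (hA.smooth_hi i) hY).const_mul (1 / (N : ℝ))

lemma integrable_freg_comp : Integrable (fun ω => Pr.freg η (Y ω)) μ :=
  (hA.integrable_h_comp hY).add ((hA.integrable_f_comp hY).const_mul η)

lemma integrable_regLoc_comp (hη : 0 ≤ η) (i : Fin N) :
    Integrable (fun ω => Pr.regLoc η i (Y ω)) μ :=
  integrable_comp_of_memLp_two (hA.convexOn_regLoc hη i) (hA.hasGradientAt_regLoc η i)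
    (hA.norm_regGrad_sub_le hη i) hY

lemma integrable_bregman_comp (hη : 0 ≤ η) (i : Fin N) (x : Vec n) :
    Integrable (fun ω => Pr.bregman η i x (Y ω)) μ := by
  have h : Integrable (fun ω => c.Lreg η / 2 * ‖x - Y ω‖ ^ 2) μ :=
    (((memLp_const x).sub hY).integrable_norm_pow two_ne_zero).const_mul (c.Lreg η / 2)
  have hcont : Continuous fun y => Pr.bregman η i x y :=
    (continuous_const.sub (hA.continuous_regLoc η i)).sub
      ((hA.continuous_regGrad hη i).inner (continuous_const.sub continuous_id))
  refine h.mono' (hcont.comp_aestronglyMeasurable hY.aestronglyMeasurable)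
    (Filter.Eventually.of_forall fun ω => ?_)
  rw [Real.norm_of_nonneg (hA.bregman_nonneg hη i x (Y ω))]
  have := le_add_inner_gradient_add_sq (hA.hasGradientAt_regLoc η i)
    (hA.norm_regGrad_sub_le hη i) (Y ω) x
  unfold bregman
  linarith

end FedProblem.Assumptions

namespace FedRun

variable {n N : ℕ} {Ξ : Type u} {Z : Type v} {Ω : Type w}
variable [MeasurableSpace Ξ] [MeasurableSpace Z] [mΩ : MeasurableSpace Ω]
variable {μ : Measure Ω} [IsProbabilityMeasure μ]
variable {run : FedRun n N Ξ Z Ω} {Pr : FedProblem n N Ξ Z} {c : FedConstants} {p : FedParams}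

namespace IsSampling

section SampledSums

variable (hS : run.IsSampling Pr p.S μ)
include hS

omit [IsProbabilityMeasure μ] in
lemma memLp_sampled_sum (r : ℕ) (a : ℝ) {F : Fin N → ℕ → Ω → Vec n}
    (hF : ∀ i k, MemLp (F i k) 2 μ) :
    MemLp (fun ω => a • ∑ i ∈ run.smp r ω, ∑ k ∈ Finset.range p.K, F i k ω) 2 μ := by
  have e : (fun ω => ∑ i ∈ run.smp r ω, ∑ k ∈ Finset.range p.K, F i k ω) =
      fun ω => ∑ i, sampleInd (run.smp r ω) i • ∑ k ∈ Finset.range p.K, F i k ω :=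
    funext fun ω => (sum_sampleInd_smul _ _).symm
  have h1 : ∀ i, MemLp (fun ω => ∑ k ∈ Finset.range p.K, F i k ω) 2 μ := fun i =>
    memLp_finsetSum (Finset.range p.K) fun k _ => hF i k
  have h2 := memLp_finsetSum (f := fun i ω => sampleInd (run.smp r ω) i •
    ∑ k ∈ Finset.range p.K, F i k ω) Finset.univ fun i _ =>
    memLp_sampleInd_smul (hS.meas_smp r) (h1 i) i
  rw [← e] at h2
  exact h2.const_smul a

/-- The expected mean over the sampled clients is the mean over all clients, for quantities that do
not depend on the sampling of the round. -/
lemma integral_sampled_mean (hS1 : 1 ≤ p.S) (hSN : p.S ≤ N) (r : ℕ) {F : Fin N → ℕ → Ω → ℝ}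
    (hm : ∀ i k, Measurable[run.history {s | s ≠ r} Set.univ] (F i k))
    (hI : ∀ i k, Integrable (F i k) μ) :
    Integrable (fun ω => 1 / ((p.S : ℝ) * p.K) *
        ∑ i ∈ run.smp r ω, ∑ k ∈ Finset.range p.K, F i k ω) μ ∧
      ∫ ω, 1 / ((p.S : ℝ) * p.K) * ∑ i ∈ run.smp r ω, ∑ k ∈ Finset.range p.K, F i k ω ∂μ =
        clientMean N p.K fun i k => ∫ ω, F i k ω ∂μ := by
  have e : (fun ω => ∑ i ∈ run.smp r ω, ∑ k ∈ Finset.range p.K, F i k ω) =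
      fun ω => ∑ i, ∑ k ∈ Finset.range p.K, sampleInd (run.smp r ω) i * F i k ω := by
    funext ω
    rw [← sum_sampleInd_smul]
    simp_rw [smul_eq_mul, Finset.mul_sum]
  have hint : ∀ i k, Integrable (fun ω => sampleInd (run.smp r ω) i * F i k ω) μ := fun i k =>
    integrable_sampleInd_mul (hS.meas_smp r) (hI i k) i
  have hint2 : ∀ i, Integrable (fun ω => ∑ k ∈ Finset.range p.K,
      sampleInd (run.smp r ω) i * F i k ω) μ := fun i =>
    integrable_finsetSum (Finset.range p.K) fun k _ => hint i k
  have hval : ∀ i k, ∫ ω, sampleInd (run.smp r ω) i * F i k ω ∂μ =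
      (p.S : ℝ) / N * ∫ ω, F i k ω ∂μ := fun i k => by
    have hq := integral_sampleInd (hS.meas_smp r) (hS.card_smp r) (hS.law_smp r) hS1 hSN i
    refine integral_sampleInd_mul (hS.meas_smp r) i hq ?_ (hI i k).aestronglyMeasurable
    rw [IndepFun_iff_Indep]
    exact indep_of_indep_of_le_right (hS.indep_smp_history (I := {s | s ≠ r}) (by simp))
      (hm i k).comap_le
  constructor
  · have h := (integrable_finsetSum Finset.univ fun i _ => hint2 i).const_mul
      (1 / ((p.S : ℝ) * p.K))
    simp only [← congrFun e] at h
    exact h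
  · rw [integral_const_mul, e, integral_finsetSum Finset.univ fun i _ => hint2 i]
    simp_rw [integral_finsetSum (Finset.range p.K) fun k _ => hint _ k, hval, ← Finset.mul_sum]
    have : (p.S : ℝ) ≠ 0 := by positivity
    unfold clientMean
    rw [← mul_assoc]
    congr 1
    field_simp

end SampledSums

section Round

variable (hA : Pr.Assumptions c) (hη : 0 ≤ p.η) (hS : run.IsSampling Pr p.S μ)
include hA hη hS

/-- The accumulated gradient error of a round: the samples are uncorrelated, so the variance is
divided by the number `S K` of samples. -/
lemma integral_noise_mean_sq_le (hS1 : 1 ≤ p.S) (hSN : p.S ≤ N) (hK : 0 < p.K) (r : ℕ) :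
    ∫ ω, ‖(1 / ((p.S : ℝ) * p.K)) • ∑ i ∈ run.smp r ω, ∑ k ∈ Finset.range p.K,
      run.noise Pr p r i k ω‖ ^ 2 ∂μ ≤ FedProblem.varReg c p.η / ((p.S : ℝ) * p.K) := by
  let w : Fin N × ℕ → Ω → Vec n := fun q ω =>
    sampleInd (run.smp r ω) q.1 • run.noise Pr p r q.1 q.2 ω
  have hw : ∀ q, MemLp (w q) 2 μ := fun q =>
    memLp_sampleInd_smul (hS.meas_smp r) (hS.memLp_noise_and_integral_le hA hη r q.1 q.2).1 q.1
  have e : ∀ ω, ∑ i ∈ run.smp r ω, ∑ k ∈ Finset.range p.K, run.noise Pr p r i k ω =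
      ∑ q ∈ Finset.univ ×ˢ Finset.range p.K, w q ω := by
    intro ω
    rw [← sum_sampleInd_smul, Finset.sum_product]
    simp only [w, Finset.smul_sum]
  have hzero : ∀ q q' : Fin N × ℕ, q ≠ q' → ∫ ω, inner ℝ (w q ω) (w q' ω) ∂μ = 0 := by
    intro q q' hne
    refine Eq.trans (integral_congr_ae (Filter.Eventually.of_forall fun ω => ?_))
      (hS.integral_inner_noise_noise hA hη r hne (fun B => sampleInd B q.1 * sampleInd B q'.1)
        fun B => ?_)
    · simp only [w, inner_smul_left, inner_smul_right, conj_trivial]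
      ring
    · rw [abs_mul]
      exact mul_le_one₀ (abs_sampleInd_le B q.1) (abs_nonneg _) (abs_sampleInd_le B q'.1)
  have horth := integral_norm_sq_sum_of_orthogonal (Finset.univ ×ˢ Finset.range p.K)
    (fun q _ => hw q) (fun q _ q' _ hne => hzero q q' hne)
  have hbound : ∀ q, ∫ ω, ‖w q ω‖ ^ 2 ∂μ ≤ (p.S : ℝ) / N * FedProblem.varReg c p.η := by
    intro q
    have h1 : ∀ ω, ‖w q ω‖ ^ 2 =
        sampleInd (run.smp r ω) q.1 * ‖run.noise Pr p r q.1 q.2 ω‖ ^ 2 := fun ω => by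
      simp only [w]
      rw [norm_smul, mul_pow, Real.norm_eq_abs, sq_abs, sq, sampleInd_mul_self]
    simp_rw [h1]
    have hq := integral_sampleInd (hS.meas_smp r) (hS.card_smp r) (hS.law_smp r) hS1 hSN q.1
    have hms := measurable_norm_sq (measurable_noise_ne (run := run) hA hη r q.1 q.2)
    rw [integral_sampleInd_mul (F := fun ω => ‖run.noise Pr p r q.1 q.2 ω‖ ^ 2) (hS.meas_smp r)
      q.1 hq ?_ (hms.mono (hS.history_le _ _) le_rfl).aestronglyMeasurable]
    · gcongr
      exact (hS.memLp_noise_and_integral_le hA hη r q.1 q.2).2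
    · rw [IndepFun_iff_Indep]
      exact indep_of_indep_of_le_right (hS.indep_smp_history (I := {s | s ≠ r}) (by simp))
        hms.comap_le
  have hpt : ∀ ω, ‖(1 / ((p.S : ℝ) * p.K)) • ∑ i ∈ run.smp r ω, ∑ k ∈ Finset.range p.K,
      run.noise Pr p r i k ω‖ ^ 2 = (1 / ((p.S : ℝ) * p.K)) ^ 2 *
        ‖∑ q ∈ Finset.univ ×ˢ Finset.range p.K, w q ω‖ ^ 2 := fun ω => by
    rw [e, norm_smul, mul_pow, Real.norm_eq_abs, sq_abs]
  simp_rw [hpt]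
  rw [integral_const_mul, horth]
  have hN0 : (N : ℝ) ≠ 0 := by
    have : 0 < N := lt_of_lt_of_le hS1 hSN
    positivity
  have hS0 : (p.S : ℝ) ≠ 0 := by positivity
  have hK0 : (p.K : ℝ) ≠ 0 := by positivity
  calc (1 / ((p.S : ℝ) * p.K)) ^ 2 * ∑ q ∈ Finset.univ ×ˢ Finset.range p.K, ∫ ω, ‖w q ω‖ ^ 2 ∂μ
      ≤ (1 / ((p.S : ℝ) * p.K)) ^ 2 * ∑ _q ∈ (Finset.univ : Finset (Fin N)) ×ˢ Finset.range p.K,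
          (p.S : ℝ) / N * FedProblem.varReg c p.η := by
        gcongr with q _; exact hbound q
    _ = _ := by
        rw [Finset.sum_const, Finset.card_product, Finset.card_univ, Fintype.card_fin,
          Finset.card_range, nsmul_eq_mul]
        push_cast
        field_simp

/-- Client drift: the local models stay close to the server model. -/
lemma clientMean_drift_le (hN : 0 < N) (hK : 0 < p.K) {r : ℕ}
    (hX : MemLp (fun ω => run.iter Pr p ω r) 2 μ) :
    clientMean N p.K (fun i k => ∫ ω, ‖run.loc Pr p r i k ω - run.iter Pr p ω r‖ ^ 2 ∂μ) ≤
      (p.γl * p.K) ^ 2 *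
        (clientMean N p.K (fun i k => ∫ ω, ‖Pr.regGrad p.η i (run.loc Pr p r i k ω)‖ ^ 2 ∂μ) +
          FedProblem.varReg c p.η / p.K) := by
  set V := FedProblem.varReg c p.η
  have hV : 0 ≤ V := by simp only [V, FedProblem.varReg]; positivity
  let q : Fin N → ℕ → ℝ := fun i k => ∫ ω, ‖Pr.regGrad p.η i (run.loc Pr p r i k ω)‖ ^ 2 ∂μ
  have hq0 : ∀ i k, 0 ≤ q i k := fun i k => integral_nonneg fun _ => by positivity
  have hgL : ∀ i k, MemLp (fun ω => Pr.regGrad p.η i (run.loc Pr p r i k ω)) 2 μ := fun i k =>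
    memLp_regGrad hA hη (hS.memLp_loc hA hη hX i k) i
  have hnL : ∀ i k, MemLp (run.noise Pr p r i k) 2 μ := fun i k =>
    (hS.memLp_noise_and_integral_le hA hη r i k).1
  -- the accumulated errors of `k` local steps of a client
  have hnoise : ∀ i k, ∫ ω, ‖∑ j ∈ Finset.range k, run.noise Pr p r i j ω‖ ^ 2 ∂μ ≤ k * V := by
    intro i k
    rw [integral_norm_sq_sum_of_orthogonal (Finset.range k) (fun j _ => hnL i j)]
    · calc _ ≤ ∑ _j ∈ Finset.range k, V := Finset.sum_le_sum fun j _ =>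
            (hS.memLp_noise_and_integral_le hA hη r i j).2
        _ = k * V := by simp
    · intro j _ l _ hne
      have := hS.integral_inner_noise_noise hA hη r (i := i) (j := i) (k := j) (l := l)
        (fun h => hne (Prod.ext_iff.1 h).2) (fun _ => 1) (fun _ => by simp)
      simpa using this
  have hstep : ∀ i k, ∫ ω, ‖run.loc Pr p r i k ω - run.iter Pr p ω r‖ ^ 2 ∂μ ≤
      p.γl ^ 2 * (2 * k * (∑ j ∈ Finset.range k, q i j + V)) := by
    intro i k
    have hpt : ∀ ω, ‖run.loc Pr p r i k ω - run.iter Pr p ω r‖ ^ 2 ≤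
        p.γl ^ 2 * (2 * (k * ∑ j ∈ Finset.range k, ‖Pr.regGrad p.η i (run.loc Pr p r i j ω)‖ ^ 2) +
          2 * ‖∑ j ∈ Finset.range k, run.noise Pr p r i j ω‖ ^ 2) := by
      intro ω
      rw [loc_sub_iter, norm_neg, norm_smul, mul_pow, Real.norm_eq_abs, sq_abs,
        Finset.sum_add_distrib]
      gcongr
      refine (norm_add_sq_le_two _ _).trans ?_
      gcongr
      simpa using norm_sum_sq_le (Finset.range k)
        fun j => Pr.regGrad p.η i (run.loc Pr p r i j ω)
    have hI1 : ∀ j, Integrable (fun ω => ‖Pr.regGrad p.η i (run.loc Pr p r i j ω)‖ ^ 2) μ :=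
      fun j => (hgL i j).integrable_norm_pow two_ne_zero
    have hI2 : Integrable (fun ω => 2 * (k * ∑ j ∈ Finset.range k,
        ‖Pr.regGrad p.η i (run.loc Pr p r i j ω)‖ ^ 2)) μ :=
      ((integrable_finsetSum (Finset.range k) fun j _ => hI1 j).const_mul (k : ℝ)).const_mul 2
    have hI3 : Integrable (fun ω => 2 * ‖∑ j ∈ Finset.range k, run.noise Pr p r i j ω‖ ^ 2) μ :=
      ((memLp_finsetSum (f := fun j ω => run.noise Pr p r i j ω) (Finset.range k)
        fun j _ => hnL i j).integrable_norm_pow two_ne_zero).const_mul 2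
    have hI0 : Integrable (fun ω => ‖run.loc Pr p r i k ω - run.iter Pr p ω r‖ ^ 2) μ :=
      ((hS.memLp_loc hA hη hX i k).sub hX).integrable_norm_pow two_ne_zero
    refine (integral_mono hI0 ((hI2.add hI3).const_mul (p.γl ^ 2)) hpt).trans ?_
    simp only [Pi.add_apply]
    rw [integral_const_mul, integral_add hI2 hI3, integral_const_mul, integral_const_mul,
      integral_const_mul, integral_finsetSum (Finset.range k) fun j _ => hI1 j]
    have h1 := hnoise i k
    have h2 : 0 ≤ p.γl ^ 2 := sq_nonneg _
    refine mul_le_mul_of_nonneg_left ?_ h2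
    simp only [q]
    linarith
  have hsum : ∀ i, ∑ k ∈ Finset.range p.K,
      ∫ ω, ‖run.loc Pr p r i k ω - run.iter Pr p ω r‖ ^ 2 ∂μ ≤
      (p.γl * p.K) ^ 2 * (∑ k ∈ Finset.range p.K, q i k + V) := by
    intro i
    set B := ∑ k ∈ Finset.range p.K, q i k + V with hB
    have hB0 : 0 ≤ B := add_nonneg (Finset.sum_nonneg fun k _ => hq0 i k) hV
    have hgauss : ∑ k ∈ Finset.range p.K, (2 * k : ℝ) ≤ (p.K : ℝ) ^ 2 := by
      have h := Finset.sum_range_id_mul_two p.K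
      have h' : (∑ k ∈ Finset.range p.K, (k : ℝ)) * 2 = p.K * (p.K - 1 : ℕ) := by
        have h2 := congrArg (Nat.cast : ℕ → ℝ) h
        rwa [Nat.cast_mul, Nat.cast_sum, Nat.cast_mul] at h2
      rw [← Finset.mul_sum, mul_comm, h', sq]
      gcongr
      exact Nat.sub_le _ _
    calc _ ≤ ∑ k ∈ Finset.range p.K, p.γl ^ 2 * (2 * k * B) := by
          refine Finset.sum_le_sum fun k hk => (hstep i k).trans ?_
          have : ∑ j ∈ Finset.range k, q i j ≤ ∑ j ∈ Finset.range p.K, q i j :=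
            Finset.sum_le_sum_of_subset_of_nonneg
              (Finset.range_mono (Finset.mem_range.1 hk).le) fun j _ _ => hq0 i j
          rw [hB]
          gcongr
      _ = p.γl ^ 2 * ((∑ k ∈ Finset.range p.K, (2 * k : ℝ)) * B) := by
          rw [Finset.sum_mul, Finset.mul_sum]
      _ ≤ p.γl ^ 2 * ((p.K : ℝ) ^ 2 * B) := by gcongr
      _ = _ := by ring
  have hN0 : (N : ℝ) ≠ 0 := by positivity
  have hK0 : (p.K : ℝ) ≠ 0 := by positivity
  unfold clientMean
  calc _ ≤ 1 / ((N : ℝ) * p.K) * ∑ i, (p.γl * p.K) ^ 2 * (∑ k ∈ Finset.range p.K, q i k + V) := by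
        gcongr with i _
        exact hsum i
    _ = _ := by
        rw [← Finset.mul_sum, Finset.sum_add_distrib, Finset.sum_const, Finset.card_univ,
          Fintype.card_fin, nsmul_eq_mul]
        simp only [q]
        field_simp

/-- Progress of the expected update direction towards a point `x`, up to the client drift. The
Bregman divergences that the convexity estimate would usually discard are kept: they absorb the
second moment of the update. -/
lemma neg_integral_inner_update_le (hS1 : 1 ≤ p.S) (hSN : p.S ≤ N) (hK : 0 < p.K) {r : ℕ}
    (hX : MemLp (fun ω => run.iter Pr p ω r) 2 μ) (x : Vec n) :
    -∫ ω, inner ℝ ((1 / ((p.S : ℝ) * p.K)) • ∑ i ∈ run.smp r ω, ∑ k ∈ Finset.range p.K,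
        (Pr.regGrad p.η i (run.loc Pr p r i k ω) + run.noise Pr p r i k ω))
        (run.iter Pr p ω r - x) ∂μ ≤
      Pr.freg p.η x - ∫ ω, Pr.freg p.η (run.iter Pr p ω r) ∂μ -
        clientMean N p.K (fun i k => ∫ ω, Pr.bregman p.η i x (run.loc Pr p r i k ω) ∂μ) +
        c.Lreg p.η / 2 * clientMean N p.K
          (fun i k => ∫ ω, ‖run.loc Pr p r i k ω - run.iter Pr p ω r‖ ^ 2 ∂μ) := by
  have hgL : ∀ i k, MemLp (fun ω => Pr.regGrad p.η i (run.loc Pr p r i k ω)) 2 μ := fun i k =>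
    memLp_regGrad hA hη (hS.memLp_loc hA hη hX i k) i
  have hnL : ∀ i k, MemLp (run.noise Pr p r i k) 2 μ := fun i k =>
    (hS.memLp_noise_and_integral_le hA hη r i k).1
  have hXx : MemLp (fun ω => run.iter Pr p ω r - x) 2 μ := hX.sub (memLp_const x)
  let F : Fin N → ℕ → Ω → ℝ := fun i k ω =>
    inner ℝ (Pr.regGrad p.η i (run.loc Pr p r i k ω) + run.noise Pr p r i k ω)
      (run.iter Pr p ω r - x)
  have hI1 : ∀ i k, Integrable (fun ω => inner ℝ (Pr.regGrad p.η i (run.loc Pr p r i k ω))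
      (run.iter Pr p ω r - x)) μ := fun i k => (hgL i k).integrable_inner_of_two hXx
  have hI2 : ∀ i k, Integrable (fun ω => inner ℝ (run.noise Pr p r i k ω)
      (run.iter Pr p ω r - x)) μ := fun i k => (hnL i k).integrable_inner_of_two hXx
  have hFI : ∀ i k, Integrable (F i k) μ := fun i k =>
    ((hgL i k).add (hnL i k)).integrable_inner_of_two hXx
  have hFm : ∀ i k, Measurable[run.history {s | s ≠ r} Set.univ] (F i k) := fun i k =>
    measurable_inner_sub_const (((hA.continuous_regGrad hη i).measurable.comp
      (measurable_loc_ne hA r i k)).add (measurable_noise_ne hA hη r i k))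
      (measurable_iter_ne hA r) x
  have hpt : ∀ ω, inner ℝ ((1 / ((p.S : ℝ) * p.K)) • ∑ i ∈ run.smp r ω, ∑ k ∈ Finset.range p.K,
        (Pr.regGrad p.η i (run.loc Pr p r i k ω) + run.noise Pr p r i k ω))
        (run.iter Pr p ω r - x) = 1 / ((p.S : ℝ) * p.K) *
        ∑ i ∈ run.smp r ω, ∑ k ∈ Finset.range p.K, F i k ω := by
    intro ω
    rw [inner_smul_left, sum_inner]
    simp_rw [sum_inner]
    simp [F]
  simp_rw [hpt]
  rw [(hS.integral_sampled_mean hS1 hSN r hFm hFI).2]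
  have hFv : ∀ i k, ∫ ω, F i k ω ∂μ =
      ∫ ω, inner ℝ (Pr.regGrad p.η i (run.loc Pr p r i k ω)) (run.iter Pr p ω r - x) ∂μ := by
    intro i k
    have h0 : ∫ ω, inner ℝ (run.noise Pr p r i k ω) (run.iter Pr p ω r - x) ∂μ = 0 := by
      refine hS.integral_inner_noise hA hη r i k ?_ hXx
      have hm : Measurable[run.history Set.univ {q | q ≠ (r, i, k)}]
          fun ω => run.iter Pr p ω r :=
        measurable_iter_history hA (fun _ _ => Set.mem_univ _)
          fun s hs j l h => hs.ne (Prod.ext_iff.1 h).1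
      exact hm.sub measurable_const
    simp only [F, inner_add_left]
    rw [integral_add (hI1 i k) (hI2 i k), h0, add_zero]
  have hB : ∀ i k, Integrable (fun ω => Pr.bregman p.η i x (run.loc Pr p r i k ω)) μ :=
    fun i k => hA.integrable_bregman_comp (hS.memLp_loc hA hη hX i k) hη i x
  have hR : ∀ i, Integrable (fun ω => Pr.regLoc p.η i (run.iter Pr p ω r)) μ :=
    fun i => hA.integrable_regLoc_comp hX hη i
  have hD : ∀ i k, Integrable (fun ω => ‖run.loc Pr p r i k ω - run.iter Pr p ω r‖ ^ 2) μ :=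
    fun i k => ((hS.memLp_loc hA hη hX i k).sub hX).integrable_norm_pow two_ne_zero
  have hterm : ∀ i k, -∫ ω, F i k ω ∂μ ≤
      ((Pr.regLoc p.η i x - ∫ ω, Pr.regLoc p.η i (run.iter Pr p ω r) ∂μ) -
        ∫ ω, Pr.bregman p.η i x (run.loc Pr p r i k ω) ∂μ) +
        c.Lreg p.η / 2 * ∫ ω, ‖run.loc Pr p r i k ω - run.iter Pr p ω r‖ ^ 2 ∂μ := by
    intro i k
    rw [hFv, ← integral_neg]
    refine (integral_mono (hI1 i k).neg ((((integrable_const (Pr.regLoc p.η i x)).sub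
      (hR i)).sub (hB i k)).add ((hD i k).const_mul (c.Lreg p.η / 2)))
      fun ω => hA.neg_inner_regGrad_le hη i (run.iter Pr p ω r) (run.loc Pr p r i k ω) x).trans
      (le_of_eq ?_)
    have e1 := integral_add (((integrable_const (Pr.regLoc p.η i x)).sub (hR i)).sub (hB i k))
      ((hD i k).const_mul (c.Lreg p.η / 2))
    have e2 := integral_sub ((integrable_const (Pr.regLoc p.η i x)).sub (hR i)) (hB i k)
    have e3 := integral_sub (integrable_const (Pr.regLoc p.η i x)) (hR i)
    simp only [Pi.add_apply, Pi.sub_apply] at e1 e2 ⊢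
    rw [e1, e2, e3, integral_const_mul]
    simp
  have hN : 0 < N := lt_of_lt_of_le hS1 hSN
  have hneg : -clientMean N p.K (fun i k => ∫ ω, F i k ω ∂μ) =
      clientMean N p.K (fun i k => -∫ ω, F i k ω ∂μ) := by
    rw [← neg_one_mul, ← clientMean_const_mul]
    simp only [neg_one_mul]
  rw [hneg]
  refine (clientMean_mono fun i k _ => hterm i k).trans (le_of_eq ?_)
  rw [clientMean_add, clientMean_sub, clientMean_const_mul, clientMean_const_left hK,
    Finset.sum_sub_distrib, mul_sub, FedProblem.avg_regLoc,
    ← integral_finsetSum Finset.univ fun i _ => hR i, ← integral_const_mul]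
  simp_rw [FedProblem.avg_regLoc]

end Round

end IsSampling

end FedRun

/-- How the estimates of a round combine. Here `g L ≤ 1/4` makes the Bregman divergences `B` and
the gap `φs - φη`, which enter with coefficients `-2 g`, absorb all terms of second order in `g`
that are multiples of them: drift and second moment contribute at most `(1/4 + 3/2) g B` and
`(3/8 + 5/4) g (φs - φη)`. -/
lemma round_arith {g L B D q H Gs V U I F φη φs γg S K s m : ℝ} (hg : 0 ≤ g) (hL : 0 ≤ L)
    (hgL : g * L ≤ 1 / 4) (hγg : 1 ≤ γg) (hB : 0 ≤ B) (hδ : 0 ≤ φs - φη) (hGs : 0 ≤ Gs)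
    (hS : 0 < S) (hK : 0 < K) (hs0 : 0 ≤ s) (hs1 : s ≤ 1) (hs2 : s ≤ 2 / S * m)
    (hprog : -I ≤ φη - F - B + L / 2 * D) (hdrift : D ≤ g ^ 2 / γg ^ 2 * (q + V / K))
    (hgrad : q ≤ 4 * L * B + 2 * H) (hhet : H ≤ 3 * L * (φs - φη) + 3 * Gs)
    (hupd : U ≤ 6 * L * B + 5 / 3 * (s * H) + 15 * (V / (S * K))) :
    2 * g * (F - φs) ≤ 2 * g * I - g ^ 2 * U + g ^ 3 / γg ^ 2 * (L * (V / K) + 6 * L * Gs) +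
      g ^ 2 / S * (15 * (V / K) + 10 * m * Gs) := by
  set δ := φs - φη with hδdef
  set ρ := g ^ 2 / γg ^ 2 with hρ
  have hρ0 : 0 ≤ ρ := by positivity
  have hρg : ρ ≤ g ^ 2 := div_le_self (sq_nonneg g) (one_le_pow₀ hγg)
  have hgL0 : 0 ≤ g * L := mul_nonneg hg hL
  have hsq : (g * L) ^ 2 ≤ 1 / 16 := by nlinarith
  -- drift
  have hD : D ≤ ρ * (4 * L * B + 6 * L * δ + 6 * Gs + V / K) :=
    hdrift.trans (mul_le_mul_of_nonneg_left (by linarith) hρ0)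
  have hD' : g * L * D ≤ g * (1 / 4 * B + 3 / 8 * δ) + g * L * ρ * (6 * Gs + V / K) := by
    have h1 := mul_le_mul_of_nonneg_left hD hgL0
    have h2 : L ^ 2 * ρ ≤ 1 / 16 := by
      have := mul_le_mul_of_nonneg_left hρg (sq_nonneg L)
      linarith
    have h3 : g * (L ^ 2 * ρ) * (4 * B + 6 * δ) ≤ g * (1 / 16) * (4 * B + 6 * δ) := by gcongr
    linarith
  -- second moment
  have hH : s * H ≤ 3 * L * δ + 6 * (m / S) * Gs := by
    have h1 := mul_le_mul_of_nonneg_left hhet hs0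
    have h2 : s * (3 * L * δ) ≤ 1 * (3 * L * δ) := by gcongr
    have h3 : s * (3 * Gs) ≤ 2 / S * m * (3 * Gs) := by gcongr
    have h4 : 2 / S * m * (3 * Gs) = 6 * (m / S) * Gs := by ring
    linarith
  have hU : g ^ 2 * U ≤ g * (3 / 2 * B + 5 / 4 * δ) +
      g ^ 2 * (10 * (m / S) * Gs + 15 * (V / (S * K))) := by
    have h1 : g ^ 2 * U ≤ g ^ 2 * (6 * L * B + 5 / 3 * (3 * L * δ + 6 * (m / S) * Gs) +
        15 * (V / (S * K))) := mul_le_mul_of_nonneg_left (by linarith) (sq_nonneg g)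
    have h2 : g * (g * L) * (6 * B + 5 * δ) ≤ g * (1 / 4) * (6 * B + 5 * δ) := by gcongr
    linarith
  have e1 : g ^ 3 / γg ^ 2 * (L * (V / K) + 6 * L * Gs) = g * L * ρ * (6 * Gs + V / K) := by
    rw [hρ]; ring
  have e2 : g ^ 2 / S * (15 * (V / K) + 10 * m * Gs) =
      g ^ 2 * (10 * (m / S) * Gs + 15 * (V / (S * K))) := by
    field_simp
    ring
  have hp := mul_le_mul_of_nonneg_left hprog (show 0 ≤ 2 * g by linarith)
  rw [e1, e2]
  have hgB : 0 ≤ g * B := mul_nonneg hg hB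
  have hgδ : 0 ≤ g * δ := mul_nonneg hg hδ
  have e3 : g * (F - φs) = g * F - g * δ - g * φη := by rw [hδdef]; ring
  linarith

namespace FedRun

variable {n N : ℕ} {Ξ : Type u} {Z : Type v} {Ω : Type w}
variable [MeasurableSpace Ξ] [MeasurableSpace Z] [mΩ : MeasurableSpace Ω]
variable {μ : Measure Ω} [IsProbabilityMeasure μ]
variable {run : FedRun n N Ξ Z Ω} {Pr : FedProblem n N Ξ Z} {c : FedConstants} {p : FedParams}

namespace IsSampling

variable (hA : Pr.Assumptions c) (hη : 0 ≤ p.η) (hS : run.IsSampling Pr p.S μ)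
include hA hη hS

/-- Mean squared norm of the local gradients along the local steps. -/
lemma clientMean_regGrad_sq_le (hK : 0 < p.K) {r : ℕ}
    (hX : MemLp (fun ω => run.iter Pr p ω r) 2 μ) (x : Vec n) :
    clientMean N p.K (fun i k => ∫ ω, ‖Pr.regGrad p.η i (run.loc Pr p r i k ω)‖ ^ 2 ∂μ) ≤
      4 * c.Lreg p.η *
        clientMean N p.K (fun i k => ∫ ω, Pr.bregman p.η i x (run.loc Pr p r i k ω) ∂μ) +
      2 * Pr.gradSq p.η x := by
  have h : ∀ i k, ∫ ω, ‖Pr.regGrad p.η i (run.loc Pr p r i k ω)‖ ^ 2 ∂μ ≤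
      4 * c.Lreg p.η * ∫ ω, Pr.bregman p.η i x (run.loc Pr p r i k ω) ∂μ +
        2 * ‖Pr.regGrad p.η i x‖ ^ 2 := by
    intro i k
    have hB := hA.integrable_bregman_comp (hS.memLp_loc hA hη hX i k) hη i x
    have hG := (memLp_regGrad hA hη (hS.memLp_loc hA hη hX i k) i).integrable_norm_pow two_ne_zero
    refine (integral_mono hG ((hB.const_mul (4 * c.Lreg p.η)).add (integrable_const
      (2 * ‖Pr.regGrad p.η i x‖ ^ 2))) fun ω => ?_).trans (le_of_eq ?_)
    · have h1 := norm_add_sq_le_two (Pr.regGrad p.η i (run.loc Pr p r i k ω) -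
        Pr.regGrad p.η i x) (Pr.regGrad p.η i x)
      rw [sub_add_cancel, norm_sub_rev] at h1
      have h2 := hA.norm_regGrad_sub_sq_le hη i x (run.loc Pr p r i k ω)
      simp only [Pi.add_apply]
      linarith
    · simp only [Pi.add_apply]
      rw [integral_add (hB.const_mul (4 * c.Lreg p.η)) (integrable_const _), integral_const_mul]
      simp
  refine (clientMean_mono fun i k _ => h i k).trans (le_of_eq ?_)
  rw [clientMean_add, clientMean_const_mul, clientMean_const_left hK, ← Finset.mul_sum]
  unfold FedProblem.gradSq
  ring

/-- Second moment of the sampled deviations of the local gradients from those at `x`. -/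
lemma integral_deviation_mean_sq_le (hS1 : 1 ≤ p.S) (hSN : p.S ≤ N) (hK : 0 < p.K) {r : ℕ}
    (hX : MemLp (fun ω => run.iter Pr p ω r) 2 μ) (x : Vec n) :
    ∫ ω, ‖(1 / ((p.S : ℝ) * p.K)) • ∑ i ∈ run.smp r ω, ∑ k ∈ Finset.range p.K,
        (Pr.regGrad p.η i (run.loc Pr p r i k ω) - Pr.regGrad p.η i x)‖ ^ 2 ∂μ ≤
      2 * c.Lreg p.η *
        clientMean N p.K (fun i k => ∫ ω, Pr.bregman p.η i x (run.loc Pr p r i k ω) ∂μ) := by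
  have hdL : ∀ i k, MemLp (fun ω => Pr.regGrad p.η i (run.loc Pr p r i k ω) -
      Pr.regGrad p.η i x) 2 μ := fun i k =>
    (memLp_regGrad hA hη (hS.memLp_loc hA hη hX i k) i).sub (memLp_const _)
  have hdI : ∀ i k, Integrable (fun ω => ‖Pr.regGrad p.η i (run.loc Pr p r i k ω) -
      Pr.regGrad p.η i x‖ ^ 2) μ := fun i k => (hdL i k).integrable_norm_pow two_ne_zero
  have hdm : ∀ i k, Measurable[run.history {s | s ≠ r} Set.univ]
      fun ω => ‖Pr.regGrad p.η i (run.loc Pr p r i k ω) - Pr.regGrad p.η i x‖ ^ 2 := fun i k =>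
    measurable_norm_sq (((hA.continuous_regGrad hη i).measurable.comp
      (measurable_loc_ne hA r i k)).sub measurable_const)
  have hmean := hS.integral_sampled_mean hS1 hSN r hdm hdI
  have hS0 : (p.S : ℝ) ≠ 0 := by positivity
  have hK0 : (p.K : ℝ) ≠ 0 := by positivity
  have hpt : ∀ ω, ‖(1 / ((p.S : ℝ) * p.K)) • ∑ i ∈ run.smp r ω, ∑ k ∈ Finset.range p.K,
        (Pr.regGrad p.η i (run.loc Pr p r i k ω) - Pr.regGrad p.η i x)‖ ^ 2 ≤
      1 / ((p.S : ℝ) * p.K) * ∑ i ∈ run.smp r ω, ∑ k ∈ Finset.range p.K,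
        ‖Pr.regGrad p.η i (run.loc Pr p r i k ω) - Pr.regGrad p.η i x‖ ^ 2 := by
    intro ω
    rw [norm_smul, mul_pow, Real.norm_eq_abs, sq_abs, ← Finset.sum_product',
      ← Finset.sum_product']
    have h := norm_sum_sq_le (run.smp r ω ×ˢ Finset.range p.K) fun q =>
      Pr.regGrad p.η q.1 (run.loc Pr p r q.1 q.2 ω) - Pr.regGrad p.η q.1 x
    rw [Finset.card_product, hS.card_smp, Finset.card_range] at h
    push_cast at h
    refine (mul_le_mul_of_nonneg_left h (by positivity)).trans (le_of_eq ?_)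
    field_simp
  refine (integral_mono ((hS.memLp_sampled_sum r _ hdL).integrable_norm_pow two_ne_zero)
    hmean.1 hpt).trans ?_
  rw [hmean.2, ← clientMean_const_mul]
  refine clientMean_mono fun i k _ => ?_
  rw [← integral_const_mul]
  refine integral_mono (hdI i k) ((hA.integrable_bregman_comp (hS.memLp_loc hA hη hX i k) hη i
    x).const_mul (2 * c.Lreg p.η)) fun ω => ?_
  rw [norm_sub_rev]
  exact hA.norm_regGrad_sub_sq_le hη i x _

/-- Second moment of the update direction, relative to a minimizer `x` of the regularized
objective; `s` is the factor of sampling without replacement. -/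
lemma integral_update_sq_le (hS1 : 1 ≤ p.S) (hSN : p.S ≤ N) (hK : 0 < p.K) {r : ℕ}
    (hX : MemLp (fun ω => run.iter Pr p ω r) 2 μ) {x : Vec n} (hx : Pr.IsRegMin p.η x) :
    ∃ s : ℝ, 0 ≤ s ∧ s ≤ 1 ∧ s ≤ 2 / p.S * (1 - p.S / N) ∧
    ∫ ω, ‖(1 / ((p.S : ℝ) * p.K)) • ∑ i ∈ run.smp r ω, ∑ k ∈ Finset.range p.K,
        (Pr.regGrad p.η i (run.loc Pr p r i k ω) + run.noise Pr p r i k ω)‖ ^ 2 ∂μ ≤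
      6 * c.Lreg p.η *
        clientMean N p.K (fun i k => ∫ ω, Pr.bregman p.η i x (run.loc Pr p r i k ω) ∂μ) +
      5 / 3 * (s * Pr.gradSq p.η x) +
      15 * (FedProblem.varReg c p.η / ((p.S : ℝ) * p.K)) := by
  have hN : 0 < N := lt_of_lt_of_le hS1 hSN
  obtain ⟨s, hs0, hs1, hs2, hs⟩ := integral_norm_sq_sample_mean (hS.meas_smp r) (hS.card_smp r)
    (hS.law_smp r) hS1 hSN (fun i => Pr.regGrad p.η i x) (hA.sum_regGrad_eq_zero hN hx)
  refine ⟨s, hs0, hs1, hs2, ?_⟩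
  have hK0 : (p.K : ℝ) ≠ 0 := by positivity
  have hgL : ∀ i k, MemLp (fun ω => Pr.regGrad p.η i (run.loc Pr p r i k ω)) 2 μ := fun i k =>
    memLp_regGrad hA hη (hS.memLp_loc hA hη hX i k) i
  have hnL : ∀ i k, MemLp (run.noise Pr p r i k) 2 μ := fun i k =>
    (hS.memLp_noise_and_integral_le hA hη r i k).1
  have hdL : ∀ i k, MemLp (fun ω => Pr.regGrad p.η i (run.loc Pr p r i k ω) -
      Pr.regGrad p.η i x) 2 μ := fun i k => (hgL i k).sub (memLp_const _)
  let U1 : Ω → Vec n := fun ω => (1 / ((p.S : ℝ) * p.K)) • ∑ i ∈ run.smp r ω,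
    ∑ k ∈ Finset.range p.K, (Pr.regGrad p.η i (run.loc Pr p r i k ω) - Pr.regGrad p.η i x)
  let U2 : Ω → Vec n := fun ω => (1 / (p.S : ℝ)) • ∑ i ∈ run.smp r ω, Pr.regGrad p.η i x
  let U3 : Ω → Vec n := fun ω => (1 / ((p.S : ℝ) * p.K)) • ∑ i ∈ run.smp r ω,
    ∑ k ∈ Finset.range p.K, run.noise Pr p r i k ω
  have hU2 : ∀ ω, U2 ω = (1 / ((p.S : ℝ) * p.K)) • ∑ i ∈ run.smp r ω,
      ∑ k ∈ Finset.range p.K, Pr.regGrad p.η i x := fun ω => by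
    simp only [U2, Finset.sum_const, Finset.card_range, ← Finset.smul_sum,
      ← Nat.cast_smul_eq_nsmul ℝ, smul_smul]
    congr 1
    field_simp
  have hsplit : ∀ ω, (1 / ((p.S : ℝ) * p.K)) • ∑ i ∈ run.smp r ω, ∑ k ∈ Finset.range p.K,
      (Pr.regGrad p.η i (run.loc Pr p r i k ω) + run.noise Pr p r i k ω) =
      U1 ω + U2 ω + U3 ω := by
    intro ω
    rw [hU2]
    simp only [U1, U3, ← smul_add, ← Finset.sum_add_distrib, sub_add_cancel]
  have hL1 : Integrable (fun ω => ‖U1 ω‖ ^ 2) μ :=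
    (hS.memLp_sampled_sum r _ hdL).integrable_norm_pow two_ne_zero
  have hL2 : Integrable (fun ω => ‖U2 ω‖ ^ 2) μ := by
    simp_rw [hU2]
    exact (hS.memLp_sampled_sum r _ (F := fun i _ _ => Pr.regGrad p.η i x)
      fun i _ => memLp_const _).integrable_norm_pow two_ne_zero
  have hL3 : Integrable (fun ω => ‖U3 ω‖ ^ 2) μ :=
    (hS.memLp_sampled_sum r _ hnL).integrable_norm_pow two_ne_zero
  have hL : Integrable (fun ω => ‖(1 / ((p.S : ℝ) * p.K)) • ∑ i ∈ run.smp r ω,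
      ∑ k ∈ Finset.range p.K, (Pr.regGrad p.η i (run.loc Pr p r i k ω) +
        run.noise Pr p r i k ω)‖ ^ 2) μ :=
    (hS.memLp_sampled_sum r _ fun i k => (hgL i k).add (hnL i k)).integrable_norm_pow two_ne_zero
  have h1 := hS.integral_deviation_mean_sq_le hA hη hS1 hSN hK hX x
  have h3 := hS.integral_noise_mean_sq_le hA hη hS1 hSN hK r
  refine (integral_mono hL (((hL1.const_mul 3).add (hL2.const_mul (5 / 3))).add
    (hL3.const_mul 15)) fun ω => ?_).trans ?_
  · simp only [Pi.add_apply]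
    rw [hsplit]
    exact norm_add_three_sq_le_weighted _ _ _
  · simp only [Pi.add_apply]
    have e1 := integral_add ((hL1.const_mul 3).add (hL2.const_mul (5 / 3))) (hL3.const_mul 15)
    have e2 := integral_add (hL1.const_mul 3) (hL2.const_mul (5 / 3))
    simp only [Pi.add_apply] at e1
    rw [e1, e2, integral_const_mul, integral_const_mul, integral_const_mul]
    have e3 : ∫ ω, ‖U2 ω‖ ^ 2 ∂μ = s * Pr.gradSq p.η x := hs
    rw [e3]
    simp only [U1, U3]
    linarith

/-- One communication round. The reference point is the regularized minimizer `xη`, the objective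
gap is measured at the point `xs`: the difference `f_η(xs) - f_η(xη)` pays for the heterogeneity at
`xη` in excess of that at `xs`. -/
lemma round_le (hS1 : 1 ≤ p.S) (hSN : p.S ≤ N) (hK : 0 < p.K) (hγg : 1 ≤ p.γg)
    (hγ0 : 0 ≤ p.γeff) (hγL : p.γeff * c.Lreg p.η ≤ 1 / 4) (r : ℕ)
    {xη : Vec n} (hx : Pr.IsRegMin p.η xη) (xs : Vec n) :
    2 * p.γeff * (∫ ω, Pr.freg p.η (run.iter Pr p ω r) ∂μ - Pr.freg p.η xs) ≤
      ∫ ω, ‖run.iter Pr p ω r - xη‖ ^ 2 ∂μ - ∫ ω, ‖run.iter Pr p ω (r + 1) - xη‖ ^ 2 ∂μ +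
      p.γeff ^ 3 / p.γg ^ 2 * (c.Lreg p.η * (FedProblem.varReg c p.η / p.K) +
        6 * c.Lreg p.η * Pr.gradSq p.η xs) +
      p.γeff ^ 2 / p.S * (15 * (FedProblem.varReg c p.η / p.K) +
        10 * (1 - (p.S : ℝ) / N) * Pr.gradSq p.η xs) := by
  have hX := hS.memLp_iter hA hη hK r
  have hX' := hS.memLp_iter hA hη hK (r + 1)
  have hN : 0 < N := lt_of_lt_of_le hS1 hSN
  have hgL : ∀ i k, MemLp (fun ω => Pr.regGrad p.η i (run.loc Pr p r i k ω)) 2 μ := fun i k =>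
    memLp_regGrad hA hη (hS.memLp_loc hA hη hX i k) i
  have hnL : ∀ i k, MemLp (run.noise Pr p r i k) 2 μ := fun i k =>
    (hS.memLp_noise_and_integral_le hA hη r i k).1
  obtain ⟨s, hs0, hs1, hs2, hupd⟩ := hS.integral_update_sq_le hA hη hS1 hSN hK hX hx
  have hprog := hS.neg_integral_inner_update_le hA hη hS1 hSN hK hX xη
  have hdrift := hS.clientMean_drift_le hA hη hN hK hX
  have hgrad := hS.clientMean_regGrad_sq_le hA hη hK hX xη
  have hhet := hA.gradSq_le hη hN hx xs
  have hB0 : 0 ≤ clientMean N p.K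
      (fun i k => ∫ ω, Pr.bregman p.η i xη (run.loc Pr p r i k ω) ∂μ) := by
    have := clientMean_mono (N := N) (K := p.K) (q := fun _ _ => 0)
      (q' := fun i k => ∫ ω, Pr.bregman p.η i xη (run.loc Pr p r i k ω) ∂μ)
      fun i k _ => integral_nonneg fun ω => hA.bregman_nonneg hη i _ _
    simpa [clientMean] using this
  have hsq : ∫ ω, ‖run.iter Pr p ω (r + 1) - xη‖ ^ 2 ∂μ =
      ∫ ω, ‖run.iter Pr p ω r - xη‖ ^ 2 ∂μ - 2 * p.γeff *
        ∫ ω, inner ℝ ((1 / ((p.S : ℝ) * p.K)) • ∑ i ∈ run.smp r ω, ∑ k ∈ Finset.range p.K,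
          (Pr.regGrad p.η i (run.loc Pr p r i k ω) + run.noise Pr p r i k ω))
          (run.iter Pr p ω r - xη) ∂μ +
        p.γeff ^ 2 * ∫ ω, ‖(1 / ((p.S : ℝ) * p.K)) • ∑ i ∈ run.smp r ω,
          ∑ k ∈ Finset.range p.K, (Pr.regGrad p.η i (run.loc Pr p r i k ω) +
            run.noise Pr p r i k ω)‖ ^ 2 ∂μ := by
    have hXx : MemLp (fun ω => run.iter Pr p ω r - xη) 2 μ := hX.sub (memLp_const xη)
    have hGL := hS.memLp_sampled_sum r (1 / ((p.S : ℝ) * p.K)) fun i k => (hgL i k).add (hnL i k)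
    simp only [Pi.add_apply] at hGL
    have hI1 := hXx.integrable_norm_pow two_ne_zero
    have hI2 := (hGL.integrable_inner_of_two hXx).const_mul (2 * p.γeff)
    have hI3 := (hGL.integrable_norm_pow two_ne_zero).const_mul (p.γeff ^ 2)
    have e2 := integral_add (hI1.sub hI2) hI3
    have e1 := integral_sub hI1 hI2
    simp only [Pi.sub_apply] at e2
    rw [← integral_const_mul, ← integral_const_mul, ← e1, ← e2]
    refine integral_congr_ae (Filter.Eventually.of_forall fun ω => ?_)
    simp only
    rw [iter_succ_eq hS hK, sub_right_comm, norm_sub_sq_real, inner_smul_right, norm_smul, mul_pow,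
      Real.norm_eq_abs, sq_abs, real_inner_comm]
    ring
  have hγeq : (p.γl * p.K) ^ 2 = p.γeff ^ 2 / p.γg ^ 2 := by
    have : p.γg ≠ 0 := by positivity
    unfold FedParams.γeff
    field_simp
  rw [hγeq] at hdrift
  have hgap : 0 ≤ Pr.freg p.η xs - Pr.freg p.η xη := sub_nonneg.2 (hx xs)
  have hL0 := hA.Lreg_nonneg hη
  have hG0 : 0 ≤ Pr.gradSq p.η xs := by unfold FedProblem.gradSq; positivity
  have hS0 : (0 : ℝ) < p.S := by positivity
  rw [hsq]
  generalize clientMean N p.K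
      (fun i k => ∫ ω, Pr.bregman p.η i xη (run.loc Pr p r i k ω) ∂μ) = B at *
  generalize clientMean N p.K
      (fun i k => ∫ ω, ‖run.loc Pr p r i k ω - run.iter Pr p ω r‖ ^ 2 ∂μ) = D at *
  generalize clientMean N p.K
      (fun i k => ∫ ω, ‖Pr.regGrad p.η i (run.loc Pr p r i k ω)‖ ^ 2 ∂μ) = q at *
  generalize (∫ ω, inner ℝ ((1 / ((p.S : ℝ) * p.K)) • ∑ i ∈ run.smp r ω,
    ∑ k ∈ Finset.range p.K, (Pr.regGrad p.η i (run.loc Pr p r i k ω) + run.noise Pr p r i k ω))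
    (run.iter Pr p ω r - xη) ∂μ) = I at *
  generalize (∫ ω, ‖(1 / ((p.S : ℝ) * p.K)) • ∑ i ∈ run.smp r ω,
    ∑ k ∈ Finset.range p.K, (Pr.regGrad p.η i (run.loc Pr p r i k ω) +
      run.noise Pr p r i k ω)‖ ^ 2 ∂μ) = U at *
  have := round_arith hγ0 hL0 hγL hγg hB0 hgap hG0 hS0 (Nat.cast_pos.2 hK) hs0 hs1 hs2 hprog
    hdrift hgrad hhet hupd
  linarith

end IsSampling

end FedRun

/-! ### Error of the averaged output -/

namespace FedRun

variable {n N : ℕ} {Ξ : Type u} {Z : Type v} {Ω : Type w}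
variable [MeasurableSpace Ξ] [MeasurableSpace Z]
variable {Pr : FedProblem n N Ξ Z} {c : FedConstants} {p : FedParams}

/-- For an effective step size at most one, the step-size restriction gives `γ L ≤ 1/4`. -/
lemma γeff_mul_Lreg_le (hA : Pr.Assumptions c) (hη : 0 ≤ p.η) (hstep : p.StepOK c)
    (hγ0 : 0 ≤ p.γeff) (hγ1 : p.γeff ≤ 1) : p.γeff * c.Lreg p.η ≤ 1 / 4 := by
  have hB : 0 ≤ c.Bsq p.η := by
    have := hA.nonneg.2.1
    exact le_max_of_le_right (by positivity)
  have hL := hA.Lreg_nonneg hη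
  have h1 : p.γeff * (16 * c.Lreg p.η ^ 2 * (1 + c.Bsq p.η)) ≤ 1 := by
    refine le_trans (le_of_eq ?_) hstep
    unfold FedParams.γeff; ring
  have h2 : p.γeff * (16 * c.Lreg p.η ^ 2) ≤ 1 := by
    refine le_trans (mul_le_mul_of_nonneg_left ?_ hγ0) h1
    exact le_mul_of_one_le_right (by positivity) (by linarith)
  have h3 : (p.γeff * c.Lreg p.η) ^ 2 ≤ (1 / 4) ^ 2 := by
    have : p.γeff * (p.γeff * (16 * c.Lreg p.η ^ 2)) ≤ 1 * 1 :=
      mul_le_mul hγ1 h2 (by positivity) zero_le_one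
    linarith
  exact le_of_sq_le_sq h3 (by norm_num)

lemma gradSq_nonneg (η : ℝ) (x : Vec n) : 0 ≤ Pr.gradSq η x := by
  unfold FedProblem.gradSq; positivity

lemma Gsq_nonneg (hA : Pr.Assumptions c) (η : ℝ) (xs : Vec n) : 0 ≤ Pr.Gsq c η xs :=
  (gradSq_nonneg η xs).trans hA.gradSq_le_Gsq

lemma wConst_nonneg (hA : Pr.Assumptions c) (hη : 0 ≤ p.η) (xs : Vec n) :
    0 ≤ wConst Pr c p xs := by
  have h1 := hA.Lreg_nonneg hη
  have h2 := Gsq_nonneg hA p.η xs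
  unfold wConst
  positivity

lemma yConst_nonneg (hA : Pr.Assumptions c) (hSN : p.S ≤ N) (xs : Vec n) :
    0 ≤ yConst Pr c p xs := by
  have h2 := Gsq_nonneg hA p.η xs
  have h3 : (0 : ℝ) ≤ 1 - p.S / N :=
    sub_nonneg.2 (div_le_one_of_le₀ (by exact_mod_cast hSN) (by positivity))
  unfold yConst
  positivity

variable [mΩ : MeasurableSpace Ω] {μ : Measure Ω} {run : FedRun n N Ξ Z Ω}

lemma qsq_nonneg (xη : Vec n) (R : ℕ) : 0 ≤ run.qsq Pr p μ xη R := le_max_right _ _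

variable [IsProbabilityMeasure μ]
variable (hA : Pr.Assumptions c) (hη : 0 ≤ p.η) (hS : run.IsSampling Pr p.S μ)
include hA hη hS

lemma memLp_avg (hK : 0 < p.K) (R : ℕ) : MemLp (fun ω => run.avg Pr p R ω) 2 μ :=
  (memLp_finsetSum (f := fun r ω => run.iter Pr p ω r) (Finset.range R) fun r _ =>
    hS.memLp_iter hA hη hK r).const_smul (1 / (R : ℝ))

lemma finiteErrors (hK : 0 < p.K) (xη : Vec n) (R : ℕ) : run.FiniteErrors Pr p μ xη R :=
  ⟨hA.integrable_f_comp (memLp_avg hA hη hS hK R), hA.integrable_h_comp (memLp_avg hA hη hS hK R),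
    (hS.memLp_x0.sub (memLp_const xη)).integrable_norm_pow two_ne_zero,
    ((hS.memLp_iter hA hη hK R).sub (memLp_const xη)).integrable_norm_pow two_ne_zero⟩

lemma errH_add_errF_eq (hK : 0 < p.K) (xs : Vec n) (R : ℕ) :
    run.errH Pr p μ xs R + p.η * run.errF Pr p μ xs R =
      ∫ ω, Pr.freg p.η (run.avg Pr p R ω) ∂μ - Pr.freg p.η xs := by
  have hL := memLp_avg hA hη hS hK R
  have e := integral_add (hA.integrable_h_comp hL) ((hA.integrable_f_comp hL).const_mul p.η)
  unfold errH errF FedProblem.freg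
  rw [e, integral_const_mul]
  ring

/-- The regularized objective at the averaged output, compared with its value at the bilevel
solution `xs`. -/
theorem errH_add_errF_le (hv : p.Valid N) (hγL : p.γeff * c.Lreg p.η ≤ 1 / 4) (hγ : 0 < p.γeff)
    {xη : Vec n} (hx : Pr.IsRegMin p.η xη) (xs : Vec n) {R : ℕ} (hR : 1 ≤ R) :
    run.errH Pr p μ xs R + p.η * run.errF Pr p μ xs R ≤
      run.qsq Pr p μ xη R / (2 * p.γeff * R) + p.γeff ^ 2 / p.γg ^ 2 * wConst Pr c p xs +
        8 * p.γeff / p.S * yConst Pr c p xs := by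
  obtain ⟨hS1, hSN, hK, -, hγg, -⟩ := hv
  have hL := memLp_avg hA hη hS hK R
  have hR0 : (0 : ℝ) < R := by exact_mod_cast hR
  have hS0 : (0 : ℝ) < p.S := by exact_mod_cast hS1
  have hK0 : (0 : ℝ) < p.K := by exact_mod_cast hK
  have hL0 := hA.Lreg_nonneg hη
  have hG := hA.gradSq_le_Gsq (η := p.η) (xs := xs)
  have hG0 := gradSq_nonneg (Pr := Pr) p.η xs
  have hW0 := wConst_nonneg (p := p) hA hη xs
  have hY0 := yConst_nonneg (p := p) hA hSN xs
  have hV0 : 0 ≤ FedProblem.varReg c p.η := by unfold FedProblem.varReg; positivity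
  have h3 : (0 : ℝ) ≤ 1 - p.S / N :=
    sub_nonneg.2 (div_le_one_of_le₀ (by exact_mod_cast hSN) (by positivity))
  have hW : c.Lreg p.η * (FedProblem.varReg c p.η / p.K) +
      6 * c.Lreg p.η * Pr.gradSq p.η xs ≤ wConst Pr c p xs := by
    have e : wConst Pr c p xs = 9 * (c.Lreg p.η * (FedProblem.varReg c p.η / p.K)) +
        18 * (c.Lreg p.η * Pr.Gsq c p.η xs) := by
      unfold wConst FedProblem.varReg; ring
    rw [e]
    have h1 := mul_le_mul_of_nonneg_left hG hL0
    have h2 : 0 ≤ c.Lreg p.η * (FedProblem.varReg c p.η / p.K) := by positivity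
    have h4 : 0 ≤ c.Lreg p.η * Pr.gradSq p.η xs := by positivity
    linarith
  have hY : 15 * (FedProblem.varReg c p.η / p.K) +
      10 * (1 - (p.S : ℝ) / N) * Pr.gradSq p.η xs ≤ 15 * yConst Pr c p xs := by
    have e : yConst Pr c p xs = FedProblem.varReg c p.η / p.K +
        4 * ((1 - (p.S : ℝ) / N) * Pr.Gsq c p.η xs) := by
      unfold yConst FedProblem.varReg; ring
    rw [e]
    have h1 := mul_le_mul_of_nonneg_left hG h3
    have h4 : 0 ≤ (1 - (p.S : ℝ) / N) * Pr.gradSq p.η xs := by positivity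
    linarith
  -- telescoping the rounds
  let d : ℕ → ℝ := fun r => ∫ ω, ‖run.iter Pr p ω r - xη‖ ^ 2 ∂μ
  let F : ℕ → ℝ := fun r => ∫ ω, Pr.freg p.η (run.iter Pr p ω r) ∂μ
  set b := p.γeff ^ 3 / p.γg ^ 2 * wConst Pr c p xs +
    p.γeff ^ 2 / p.S * (15 * yConst Pr c p xs) with hb
  have hround : ∀ r, 2 * p.γeff * (F r - Pr.freg p.η xs) ≤ d r - d (r + 1) + b := by
    intro r
    have h := hS.round_le hA hη hS1 hSN hK hγg hγ.le hγL r hx xs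
    have h1 := mul_le_mul_of_nonneg_left hW (show 0 ≤ p.γeff ^ 3 / p.γg ^ 2 by positivity)
    have h2 := mul_le_mul_of_nonneg_left hY (show 0 ≤ p.γeff ^ 2 / p.S by positivity)
    simp only [d, F]
    linarith
  have hsum : 2 * p.γeff * (∑ r ∈ Finset.range R, F r - R * Pr.freg p.η xs) ≤
      d 0 - d R + R * b := by
    have h := Finset.sum_le_sum fun r (_ : r ∈ Finset.range R) => hround r
    rw [← Finset.mul_sum, Finset.sum_sub_distrib, Finset.sum_add_distrib,
      Finset.sum_range_sub'] at h
    simpa using h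
  have hq : d 0 - d R ≤ run.qsq Pr p μ xη R := le_max_left _ _
  -- Jensen's inequality for the average
  have hconv : ConvexOn ℝ Set.univ (Pr.freg p.η) :=
    hA.convexOn_h.add (hA.convexOn_f.smul hη)
  have hjensen : ∫ ω, Pr.freg p.η (run.avg Pr p R ω) ∂μ ≤
      1 / (R : ℝ) * ∑ r ∈ Finset.range R, F r := by
    have hI : ∀ r, Integrable (fun ω => Pr.freg p.η (run.iter Pr p ω r)) μ := fun r =>
      hA.integrable_freg_comp (hS.memLp_iter hA hη hK r)
    simp only [F]
    rw [← integral_finsetSum _ fun r _ => hI r, ← integral_const_mul]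
    refine integral_mono (hA.integrable_freg_comp hL)
      ((integrable_finsetSum _ fun r _ => hI r).const_mul _) fun ω => ?_
    have h := hconv.map_sum_le (t := Finset.range R) (w := fun _ => 1 / (R : ℝ))
      (p := fun r => run.iter Pr p ω r) (fun _ _ => by positivity)
      (by simp [hR0.ne']) (fun _ _ => Set.mem_univ _)
    rw [← Finset.smul_sum] at h
    simpa [avg, Finset.mul_sum] using h
  rw [errH_add_errF_eq hA hη hS hK]
  have hγR : 0 < 2 * p.γeff * R := by positivity
  have hmain : (∫ ω, Pr.freg p.η (run.avg Pr p R ω) ∂μ - Pr.freg p.η xs) * (2 * p.γeff * R) ≤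
      run.qsq Pr p μ xη R + R * b := by
    calc _ ≤ (1 / (R : ℝ) * ∑ r ∈ Finset.range R, F r - Pr.freg p.η xs) * (2 * p.γeff * R) := by
          gcongr
      _ = 2 * p.γeff * (∑ r ∈ Finset.range R, F r - R * Pr.freg p.η xs) := by
          field_simp
      _ ≤ _ := by linarith
  rw [← le_div_iff₀ hγR] at hmain
  refine hmain.trans ?_
  have e : (run.qsq Pr p μ xη R + R * b) / (2 * p.γeff * R) =
      run.qsq Pr p μ xη R / (2 * p.γeff * R) +
        (1 / 2 * (p.γeff ^ 2 / p.γg ^ 2 * wConst Pr c p xs) +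
          15 / 2 * (p.γeff / p.S * yConst Pr c p xs)) := by
    rw [hb]
    field_simp
  have h1 : 0 ≤ p.γeff ^ 2 / p.γg ^ 2 * wConst Pr c p xs := by positivity
  have h2 : 0 ≤ p.γeff / p.S * yConst Pr c p xs := by positivity
  rw [e]
  have e2 : 8 * p.γeff / p.S * yConst Pr c p xs = 8 * (p.γeff / p.S * yConst Pr c p xs) := by ring
  linarith

end FedRun

/-! ### Lower bounds on the outer error -/

namespace FedProblem

variable {n N : ℕ} {Ξ : Type u} {Z : Type v} [MeasurableSpace Ξ] [MeasurableSpace Z]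
variable {Pr : FedProblem n N Ξ Z} {c : FedConstants}

lemma iInf_h_eq {xs : Vec n} (hxs : xs ∈ Pr.Xh) : ⨅ y, Pr.h y = Pr.h xs :=
  le_antisymm (ciInf_le ⟨Pr.h xs, by rintro _ ⟨y, rfl⟩; exact hxs y⟩ xs) (le_ciInf hxs)

/-- The outer objective falls below its optimal bilevel value at most linearly in the distance to
the set of inner minimizers. -/
lemma Assumptions.f_sub_ge (hA : Pr.Assumptions c) {xs : Vec n} (hxs : Pr.IsSolution xs)
    (x : Vec n) :
    -(‖gradient Pr.f xs‖ * Metric.infDist x Pr.Xh) ≤ Pr.f x - Pr.f xs := by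
  have hcont : Continuous Pr.h := hA.differentiable_h.continuous
  have hclosed : IsClosed Pr.Xh := by
    have : Pr.Xh = ⋂ y, {x | Pr.h x ≤ Pr.h y} := by ext x; simp [Xh]
    rw [this]
    exact isClosed_iInter fun y => isClosed_le hcont continuous_const
  have hconvex : Convex ℝ Pr.Xh := by
    have : Pr.Xh = {x | x ∈ Set.univ ∧ Pr.h x ≤ Pr.h xs} := by
      ext x
      exact ⟨fun hx => ⟨trivial, hx xs⟩, fun hx y => hx.2.trans (hxs.1 y)⟩
    rw [this]
    exact hA.convexOn_h.convex_le _
  obtain ⟨q, hq, hqd⟩ := hclosed.exists_infDist_eq_dist ⟨xs, hxs.1⟩ x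
  -- first-order optimality of `xs` on the convex set of inner minimizers
  have hopt : 0 ≤ inner ℝ (gradient Pr.f xs) (q - xs) := by
    have hd := hasDerivAt_comp_segment hA.hasGradientAt_f xs (q - xs) 0
    rw [zero_smul, add_zero] at hd
    have hslope := hd.tendsto_slope_zero_right
    refine ge_of_tendsto hslope ?_
    filter_upwards [Ioc_mem_nhdsGT (zero_lt_one' ℝ)] with t ht
    have hmem : xs + t • (q - xs) ∈ Pr.Xh := by
      have := hconvex.add_smul_sub_mem hxs.1 hq ⟨ht.1.le, ht.2⟩
      exact this
    have := hxs.2 _ hmem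
    simp only [zero_add, zero_smul, add_zero, smul_eq_mul]
    exact mul_nonneg (inv_nonneg.2 ht.1.le) (sub_nonneg.2 this)
  have h1 := hA.convexOn_f.add_inner_gradient_le hA.hasGradientAt_f xs x
  have h2 : inner ℝ (gradient Pr.f xs) (x - xs) =
      inner ℝ (gradient Pr.f xs) (x - q) + inner ℝ (gradient Pr.f xs) (q - xs) := by
    rw [← inner_add_right]; congr 1; abel
  have h3 := (abs_le.1 (abs_real_inner_le_norm (gradient Pr.f xs) (x - q))).1
  rw [hqd, dist_eq_norm]
  linarith

end FedProblem

namespace FedRun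

variable {n N : ℕ} {Ξ : Type u} {Z : Type v} {Ω : Type w}
variable [MeasurableSpace Ξ] [MeasurableSpace Z] [mΩ : MeasurableSpace Ω]
variable {μ : Measure Ω} [IsProbabilityMeasure μ]
variable {run : FedRun n N Ξ Z Ω} {Pr : FedProblem n N Ξ Z} {c : FedConstants} {p : FedParams}
variable (hA : Pr.Assumptions c) (hη : 0 ≤ p.η) (hS : run.IsSampling Pr p.S μ)
include hA hη hS

lemma errH_nonneg (hK : 0 < p.K) {xs : Vec n} (hxs : Pr.IsSolution xs) (R : ℕ) :
    0 ≤ run.errH Pr p μ xs R := by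
  have h := integral_mono (integrable_const (Pr.h xs))
    (hA.integrable_h_comp (memLp_avg hA hη hS hK R)) fun ω => hxs.1 (run.avg Pr p R ω)
  rw [integral_const, probReal_univ, one_smul] at h
  exact sub_nonneg.2 h

lemma neg_errF_le (hK : 0 < p.K) (xs : Vec n) (R : ℕ) :
    -run.errF Pr p μ xs R ≤ Pr.f xs - ⨅ z, Pr.f z := by
  have h := integral_mono (integrable_const (⨅ z, Pr.f z))
    (hA.integrable_f_comp (memLp_avg hA hη hS hK R))
    fun ω => ciInf_le hA.bddBelow_f (run.avg Pr p R ω)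
  rw [integral_const, probReal_univ, one_smul] at h
  unfold errF
  linarith

/-- Under weak sharpness the inner error bounds the outer error from below, by Jensen's inequality
for `t ↦ t ^ κ`. -/
lemma neg_errF_rpow_le (hK : 0 < p.K) {xs : Vec n} (hxs : Pr.IsSolution xs) (R : ℕ) {α κ : ℝ}
    (hsharp : Pr.IsWeakSharp α κ) :
    α * (max (-run.errF Pr p μ xs R) 0) ^ κ ≤
      ‖gradient Pr.f xs‖ ^ κ * run.errH Pr p μ xs R := by
  obtain ⟨hα, hκ, hws⟩ := hsharp
  rw [FedProblem.iInf_h_eq hxs.1] at hws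
  have hL := memLp_avg hA hη hS hK R
  let d : Ω → ℝ := fun ω => Metric.infDist (run.avg Pr p R ω) Pr.Xh
  have hd0 : ∀ ω, 0 ≤ d ω := fun ω => Metric.infDist_nonneg
  have hdm : AEStronglyMeasurable d μ :=
    (Metric.continuous_infDist_pt Pr.Xh).comp_aestronglyMeasurable hL.aestronglyMeasurable
  have hdI : Integrable d μ := by
    refine ((hL.sub (memLp_const xs)).integrable one_le_two).norm.mono' hdm
      (Filter.Eventually.of_forall fun ω => ?_)
    rw [Real.norm_of_nonneg (hd0 ω)]
    simpa [dist_eq_norm] using Metric.infDist_le_dist_of_mem (x := run.avg Pr p R ω) hxs.1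
  have hhI : Integrable (fun ω => Pr.h (run.avg Pr p R ω) - Pr.h xs) μ :=
    (hA.integrable_h_comp hL).sub (integrable_const _)
  have hpI : Integrable (fun ω => d ω ^ κ) μ := by
    refine (hhI.const_mul (1 / α)).mono' ((Real.continuous_rpow_const (by linarith)
      ).comp_aestronglyMeasurable hdm) (Filter.Eventually.of_forall fun ω => ?_)
    rw [Real.norm_of_nonneg (Real.rpow_nonneg (hd0 ω) κ), one_div, ← div_eq_inv_mul,
      le_div_iff₀ hα, mul_comm]
    exact hws _
  have hjensen : (∫ ω, d ω ∂μ) ^ κ ≤ ∫ ω, d ω ^ κ ∂μ :=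
    (convexOn_rpow hκ).map_integral_le (Real.continuous_rpow_const (by linarith)).continuousOn
      isClosed_Ici (Filter.Eventually.of_forall hd0) hdI hpI
  have hH : α * ∫ ω, d ω ^ κ ∂μ ≤ run.errH Pr p μ xs R := by
    have h := integral_mono (hpI.const_mul α) hhI fun ω => hws _
    rw [integral_const_mul, integral_sub (hA.integrable_h_comp hL) (integrable_const _)] at h
    simpa [errH] using h
  have hF : -run.errF Pr p μ xs R ≤ ‖gradient Pr.f xs‖ * ∫ ω, d ω ∂μ := by
    have h := integral_mono (hdI.const_mul ‖gradient Pr.f xs‖).neg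
      ((hA.integrable_f_comp hL).sub (integrable_const (Pr.f xs)))
      fun ω => hA.f_sub_ge hxs (run.avg Pr p R ω)
    have e1 := integral_sub (hA.integrable_f_comp hL) (integrable_const (Pr.f xs))
    have e2 := integral_neg (μ := μ) fun ω => ‖gradient Pr.f xs‖ * d ω
    simp only [Pi.neg_apply, Pi.sub_apply] at h
    rw [e1, e2, integral_const_mul] at h
    simp only [integral_const, probReal_univ, one_smul] at h
    unfold errF
    linarith
  have hm0 : 0 ≤ ∫ ω, d ω ∂μ := integral_nonneg hd0
  calc α * (max (-run.errF Pr p μ xs R) 0) ^ κ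
      ≤ α * (‖gradient Pr.f xs‖ * ∫ ω, d ω ∂μ) ^ κ := by
        gcongr
        exact max_le hF (by positivity)
    _ = ‖gradient Pr.f xs‖ ^ κ * (α * (∫ ω, d ω ∂μ) ^ κ) := by
        rw [Real.mul_rpow (norm_nonneg _) hm0]; ring
    _ ≤ ‖gradient Pr.f xs‖ ^ κ * (α * ∫ ω, d ω ^ κ ∂μ) := by gcongr
    _ ≤ _ := by gcongr

lemma neg_errF_le_mul_errH (hK : 0 < p.K) {xs : Vec n} (hxs : Pr.IsSolution xs) (R : ℕ) {α : ℝ}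
    (hsharp : Pr.IsWeakSharp α 1) :
    -run.errF Pr p μ xs R ≤ ‖gradient Pr.f xs‖ / α * run.errH Pr p μ xs R := by
  have h1 := neg_errF_rpow_le hA hη hS hK hxs R hsharp
  rw [Real.rpow_one, Real.rpow_one] at h1
  rw [div_mul_eq_mul_div, le_div_iff₀ hsharp.1, mul_comm]
  exact (mul_le_mul_of_nonneg_left (le_max_left _ _) hsharp.1.le).trans h1

/-- A regularization parameter below the threshold `α / (2 ‖∇f(x*)‖)` lets half of the error
in `h` absorb a negative error in `f`. -/
lemma two_mul_neg_errF_le (hK : 0 < p.K) {xs : Vec n} (hxs : Pr.IsSolution xs)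
    (R : ℕ) {α : ℝ} (hsharp : Pr.IsWeakSharp α 1) (hηα : 2 * p.η * ‖gradient Pr.f xs‖ ≤ α) :
    2 * (p.η * -run.errF Pr p μ xs R) ≤ run.errH Pr p μ xs R := by
  have h1 := neg_errF_le_mul_errH hA hη hS hK hxs R hsharp
  have hH := errH_nonneg hA hη hS hK hxs R
  calc 2 * (p.η * -run.errF Pr p μ xs R)
      ≤ 2 * (p.η * (‖gradient Pr.f xs‖ / α * run.errH Pr p μ xs R)) := by gcongr
    _ = 2 * p.η * ‖gradient Pr.f xs‖ / α * run.errH Pr p μ xs R := by ring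
    _ ≤ 1 * run.errH Pr p μ xs R := by
        gcongr
        exact div_le_one_of_le₀ hηα hsharp.1.le
    _ = run.errH Pr p μ xs R := one_mul _

end FedRun

/-! ### From error bounds to complexities -/

section Arithmetic

/-- A complexity `C x ^ (1/s) ≤ R` is a bound `A x ≤ R ^ s`, when `C` is large enough. -/
lemma mul_le_rpow_of_complexity {A C R s x : ℝ} (hs : 0 < s) (hx : 0 ≤ x) (hA : 0 ≤ A)
    (hC : A ^ (1 / s) ≤ C) (h : C * x ^ (1 / s) ≤ R) : A * x ≤ R ^ s := by
  have h1 : (A * x) ^ (1 / s) ≤ R := by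
    rw [Real.mul_rpow hA hx]
    exact (mul_le_mul_of_nonneg_right hC (Real.rpow_nonneg hx _)).trans h
  calc A * x = ((A * x) ^ (1 / s)) ^ s := by
        rw [← Real.rpow_mul (mul_nonneg hA hx), one_div_mul_cancel hs.ne', Real.rpow_one]
    _ ≤ R ^ s := Real.rpow_le_rpow (Real.rpow_nonneg (mul_nonneg hA hx) _) h1 hs.le

/-- The three terms of the error bound at step size `R ^ (-a)`, measured against `t R ^ (-e)`. The
factor `32` is what makes the last term, with its coefficient `8`, at most a quarter of the target;
half of the target remains for other contributions. -/
lemma error_terms_le {R a e t Q W Y γg S : ℝ} (hR : 1 ≤ R) (ht : 0 < t) (hγg : 1 ≤ γg) (hS : 0 < S)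
    (h1 : 32 * (Q / t) ≤ R ^ (1 - (a + e))) (h2 : 32 * (W / (t * γg ^ 2)) ≤ R ^ (2 * a - e))
    (h3 : 32 * (Y / (t * S)) ≤ R ^ (a - e)) :
    Q / (2 * (1 / R ^ a) * R) + (1 / R ^ a) ^ 2 / γg ^ 2 * W + 8 * (1 / R ^ a) / S * Y ≤
      t * (1 / R ^ e) / 2 := by
  have hR0 : 0 < R := by linarith
  have hra : 0 < R ^ a := Real.rpow_pos_of_pos hR0 a
  have hre : 0 < R ^ e := Real.rpow_pos_of_pos hR0 e
  have e1 : R ^ (1 - (a + e)) = R / (R ^ a * R ^ e) := by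
    rw [Real.rpow_sub hR0, Real.rpow_add hR0, Real.rpow_one]
  have e2 : R ^ (2 * a - e) = (R ^ a) ^ 2 / R ^ e := by
    rw [Real.rpow_sub hR0, two_mul, Real.rpow_add hR0, sq]
  have e3 : R ^ (a - e) = R ^ a / R ^ e := Real.rpow_sub hR0 a e
  rw [e1] at h1; rw [e2] at h2; rw [e3] at h3
  have hu : 0 < 1 / R ^ e := by positivity
  have k1 : Q / (2 * (1 / R ^ a) * R) ≤ t * (1 / R ^ e) / 64 := by
    have := mul_le_mul_of_nonneg_left h1 (show 0 ≤ t * R ^ a / (64 * R) by positivity)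
    calc _ = t * R ^ a / (64 * R) * (32 * (Q / t)) := by field_simp; ring
      _ ≤ _ := this
      _ = _ := by field_simp
  have k2 : (1 / R ^ a) ^ 2 / γg ^ 2 * W ≤ t * (1 / R ^ e) / 32 := by
    have := mul_le_mul_of_nonneg_left h2 (show 0 ≤ t / (32 * (R ^ a) ^ 2) by positivity)
    calc _ = t / (32 * (R ^ a) ^ 2) * (32 * (W / (t * γg ^ 2))) := by field_simp
      _ ≤ _ := this
      _ = _ := by field_simp
  have k3 : 8 * (1 / R ^ a) / S * Y ≤ t * (1 / R ^ e) / 4 := by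
    have := mul_le_mul_of_nonneg_left h3 (show 0 ≤ t / (4 * R ^ a) by positivity)
    calc _ = t / (4 * R ^ a) * (32 * (Y / (t * S))) := by field_simp; ring
      _ ≤ _ := this
      _ = _ := by field_simp
  have hp : 0 < t * (1 / R ^ e) := by positivity
  linarith

/-- A constant, depending only on `a` and `b`, that is at least `32 ^ (1 / s)` for each of the
powers `R ^ s` to which the complexities are inverse. Powers `s ≤ 0`, for which no complexity is
claimed, are harmless. -/
def complexityConst (a b : ℝ) : ℝ :=
  (32 : ℝ) ^ (1 / (1 - (a + b))) + (32 : ℝ) ^ (1 / (2 * a - b)) + (32 : ℝ) ^ (1 / (a - b)) +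
    (32 : ℝ) ^ (1 / (1 - a)) + (32 : ℝ) ^ (1 / (2 * a)) + (32 : ℝ) ^ (1 / a) + (32 : ℝ) ^ (1 / b)

lemma le_complexityConst (a b : ℝ) :
    (32 : ℝ) ^ (1 / (1 - (a + b))) ≤ complexityConst a b ∧
    (32 : ℝ) ^ (1 / (2 * a - b)) ≤ complexityConst a b ∧
    (32 : ℝ) ^ (1 / (a - b)) ≤ complexityConst a b ∧
    (32 : ℝ) ^ (1 / (1 - a)) ≤ complexityConst a b ∧
    (32 : ℝ) ^ (1 / (2 * a)) ≤ complexityConst a b ∧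
    (32 : ℝ) ^ (1 / a) ≤ complexityConst a b ∧ (32 : ℝ) ^ (1 / b) ≤ complexityConst a b := by
  have h : ∀ s : ℝ, 0 < (32 : ℝ) ^ (1 / s) := fun s => Real.rpow_pos_of_pos (by norm_num) _
  have h1 := h (1 - (a + b)); have h2 := h (2 * a - b); have h3 := h (a - b)
  have h4 := h (1 - a); have h5 := h (2 * a); have h6 := h a; have h7 := h b
  unfold complexityConst
  refine ⟨?_, ?_, ?_, ?_, ?_, ?_, ?_⟩ <;> linarith

lemma complexityConst_pos (a b : ℝ) : 0 < complexityConst a b :=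
  lt_of_lt_of_le (Real.rpow_pos_of_pos (by norm_num) _) (le_complexityConst a b).1

/-- The explicit round complexity makes the error bound at most half of `t R ^ (-e)`. -/
lemma error_le_of_complexity {C R a e t Q W Y γg S : ℝ} (hR : 1 ≤ R) (ht : 0 < t) (hγg : 1 ≤ γg)
    (hS : 0 < S) (hQ : 0 ≤ Q) (hW : 0 ≤ W) (hY : 0 ≤ Y) (hC : 0 ≤ C)
    (hs1 : 0 < 1 - (a + e)) (hs2 : 0 < 2 * a - e) (hs3 : 0 < a - e)
    (hC1 : (32 : ℝ) ^ (1 / (1 - (a + e))) ≤ C) (hC2 : (32 : ℝ) ^ (1 / (2 * a - e)) ≤ C)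
    (hC3 : (32 : ℝ) ^ (1 / (a - e)) ≤ C)
    (h : C * ((Q / t) ^ (1 / (1 - (a + e))) + (W / (t * γg ^ 2)) ^ (1 / (2 * a - e)) +
      (Y / (t * S)) ^ (1 / (a - e))) ≤ R) :
    Q / (2 * (1 / R ^ a) * R) + (1 / R ^ a) ^ 2 / γg ^ 2 * W + 8 * (1 / R ^ a) / S * Y ≤
      t * (1 / R ^ e) / 2 := by
  have x1 : 0 ≤ Q / t := by positivity
  have x2 : 0 ≤ W / (t * γg ^ 2) := by positivity
  have x3 : 0 ≤ Y / (t * S) := by positivity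
  have y1 := mul_nonneg hC (Real.rpow_nonneg x1 (1 / (1 - (a + e))))
  have y2 := mul_nonneg hC (Real.rpow_nonneg x2 (1 / (2 * a - e)))
  have y3 := mul_nonneg hC (Real.rpow_nonneg x3 (1 / (a - e)))
  rw [mul_add, mul_add] at h
  exact error_terms_le hR ht hγg hS
    (mul_le_rpow_of_complexity hs1 x1 (by norm_num) hC1 (by linarith))
    (mul_le_rpow_of_complexity hs2 x2 (by norm_num) hC2 (by linarith))
    (mul_le_rpow_of_complexity hs3 x3 (by norm_num) hC3 (by linarith))

/-- The case without weights `R ^ (-e)`. -/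
lemma error_le_of_complexity_zero {C R a t Q W Y γg S : ℝ} (hR : 1 ≤ R) (ht : 0 < t)
    (hγg : 1 ≤ γg) (hS : 0 < S) (hQ : 0 ≤ Q) (hW : 0 ≤ W) (hY : 0 ≤ Y) (hC : 0 ≤ C)
    (ha : 0 < a) (ha1 : a < 1)
    (hC1 : (32 : ℝ) ^ (1 / (1 - a)) ≤ C) (hC2 : (32 : ℝ) ^ (1 / (2 * a)) ≤ C)
    (hC3 : (32 : ℝ) ^ (1 / a) ≤ C)
    (h : C * ((Q / t) ^ (1 / (1 - a)) + (W / (t * γg ^ 2)) ^ (1 / (2 * a)) +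
      (Y / (t * S)) ^ (1 / a)) ≤ R) :
    Q / (2 * (1 / R ^ a) * R) + (1 / R ^ a) ^ 2 / γg ^ 2 * W + 8 * (1 / R ^ a) / S * Y ≤
      t / 2 := by
  have := error_le_of_complexity (C := C) (R := R) (a := a) (e := 0) (t := t) (Q := Q) (W := W)
    (Y := Y) (γg := γg) (S := S) hR ht hγg hS hQ hW hY hC (by linarith)
    (by linarith) (by linarith) (by simpa using hC1) (by simpa using hC2) (by simpa using hC3)
    (by simpa using h)
  simpa using this

/-- The case without weights, together with a contribution `R ^ (-b) M` of the regularization. -/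
lemma error_le_of_complexity_add {C R a b t Q W Y M γg S : ℝ} (hR : 1 ≤ R) (ht : 0 < t)
    (hγg : 1 ≤ γg) (hS : 0 < S) (hQ : 0 ≤ Q) (hW : 0 ≤ W) (hY : 0 ≤ Y) (hM : 0 ≤ M) (hC : 0 ≤ C)
    (ha : 0 < a) (ha1 : a < 1) (hb : 0 < b)
    (hC1 : (32 : ℝ) ^ (1 / (1 - a)) ≤ C) (hC2 : (32 : ℝ) ^ (1 / (2 * a)) ≤ C)
    (hC3 : (32 : ℝ) ^ (1 / a) ≤ C) (hC4 : (32 : ℝ) ^ (1 / b) ≤ C)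
    (h : C * ((Q / t) ^ (1 / (1 - a)) + (W / (t * γg ^ 2)) ^ (1 / (2 * a)) +
      (Y / (t * S)) ^ (1 / a) + (M / t) ^ (1 / b)) ≤ R) :
    Q / (2 * (1 / R ^ a) * R) + (1 / R ^ a) ^ 2 / γg ^ 2 * W + 8 * (1 / R ^ a) / S * Y +
      1 / R ^ b * M ≤ t := by
  have x4 : 0 ≤ M / t := by positivity
  have y4 := mul_nonneg hC (Real.rpow_nonneg x4 (1 / b))
  have y1 : 0 ≤ C * ((Q / t) ^ (1 / (1 - a)) + (W / (t * γg ^ 2)) ^ (1 / (2 * a)) +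
      (Y / (t * S)) ^ (1 / a)) := by positivity
  rw [mul_add] at h
  have h1 := error_le_of_complexity_zero hR ht hγg hS hQ hW hY hC ha ha1 hC1 hC2 hC3
    (by linarith)
  have h2 := mul_le_rpow_of_complexity hb x4 (by norm_num) hC4 (show _ ≤ R by linarith)
  have hrb : 0 < R ^ b := Real.rpow_pos_of_pos (by linarith) b
  have h3 : 1 / R ^ b * M ≤ t / 32 := by
    rw [one_div_mul_eq_div, div_le_div_iff₀ hrb (by norm_num)]
    rw [mul_div_assoc', div_le_iff₀ ht] at h2
    linarith
  linarith

end Arithmetic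

/-! ### Rates for a fixed problem -/

namespace FedRun

variable {n N : ℕ} {Ξ : Type u} {Z : Type v}
variable [MeasurableSpace Ξ] [MeasurableSpace Z]
variable {Pr : FedProblem n N Ξ Z} {c : FedConstants}

/-- For regularization parameters `η ≤ η₀` and step size `R ^ (-1/2)` the error bound is
`O(R ^ (-1/2))`, uniformly in the run, and the step-size restriction holds for large `R`. -/
lemma exists_rate_const (hA : Pr.Assumptions c) (xs : Vec n) (D η₀ : ℝ) (hη₀ : 0 ≤ η₀) :
    ∃ κ : ℝ, 1 ≤ κ ∧
      ∀ (Ω : Type w) [MeasurableSpace Ω] (μ : Measure Ω) [IsProbabilityMeasure μ]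
        (p : FedParams) (_ : p.Valid N) (run : FedRun n N Ξ Z Ω) (_ : run.IsSampling Pr p.S μ)
        (xη : Vec n) (_ : Pr.IsRegMin p.η xη) (_ : ∫ ω, ‖run.x0 ω - xη‖ ^ 2 ∂μ ≤ D)
        (R : ℕ) (_ : 1 ≤ R) (_ : p.γeff = 1 / (R : ℝ) ^ (1 / 2 : ℝ)) (_ : p.η ≤ η₀)
        (_ : κ ≤ R),
        p.StepOK c ∧ run.errH Pr p μ xs R + p.η * run.errF Pr p μ xs R ≤
          κ * (1 / (R : ℝ) ^ (1 / 2 : ℝ)) := by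
  obtain ⟨hLf, hLh, -⟩ := hA.nonneg
  set L₀ := c.Lreg η₀ with hL₀
  set B₀ := c.Bsq η₀ with hB₀
  set V₀ := 2 * η₀ ^ 2 * c.σf ^ 2 + 2 * c.σh ^ 2 with hV₀
  set G₀ := Pr.Gsq c η₀ xs with hG₀
  have hL₀0 : 0 ≤ L₀ := hA.Lreg_nonneg hη₀
  have hB₀0 : 0 ≤ B₀ := le_max_of_le_right (by positivity)
  have hV₀0 : 0 ≤ V₀ := by positivity
  have hG₀0 : 0 ≤ G₀ := Gsq_nonneg hA η₀ xs
  set A := 16 * L₀ ^ 2 * (1 + B₀) with hAdef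
  have hA0 : 0 ≤ A := by positivity
  have hW₀0 : 0 ≤ 9 * L₀ * V₀ + 18 * L₀ * G₀ := by positivity
  refine ⟨1 + A ^ 2 + |D| + (9 * L₀ * V₀ + 18 * L₀ * G₀) + 8 * (V₀ + 4 * G₀), ?_, ?_⟩
  · have : 0 ≤ A ^ 2 := sq_nonneg A
    have := abs_nonneg D
    linarith
  intro Ω _ μ _ p hv run hS xη hx hD R hR hγ hηη₀ hκR
  obtain ⟨hS1, hSN, hK, hγl, hγg, hη⟩ := id hv
  have hR1 : (1 : ℝ) ≤ R := by exact_mod_cast hR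
  have hR0 : (0 : ℝ) < R := by linarith
  have hK1 : (1 : ℝ) ≤ p.K := by exact_mod_cast hK
  have hS1' : (1 : ℝ) ≤ p.S := by exact_mod_cast hS1
  set u := 1 / (R : ℝ) ^ (1 / 2 : ℝ) with hu
  have hrp : (1 : ℝ) ≤ (R : ℝ) ^ (1 / 2 : ℝ) := Real.one_le_rpow hR1 (by norm_num)
  have hrsq : ((R : ℝ) ^ (1 / 2 : ℝ)) ^ 2 = R := by
    rw [← Real.rpow_natCast, ← Real.rpow_mul hR0.le]; norm_num
  have hu0 : 0 < u := by positivity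
  have hu1 : u ≤ 1 := div_le_one_of_le₀ hrp (by positivity)
  have huR : u * R = 1 / u := by
    rw [hu, one_div_one_div, one_div_mul_eq_div, div_eq_iff (by positivity), ← sq, hrsq]
  -- monotonicity of the constants in `η`
  have hLle : c.Lreg p.η ≤ L₀ := by
    simp only [hL₀, FedConstants.Lreg]; gcongr
  have hLp := hA.Lreg_nonneg hη.le
  have hBle : c.Bsq p.η ≤ B₀ := by
    simp only [hB₀, FedConstants.Bsq]; gcongr
  have hBp : 0 ≤ c.Bsq p.η := le_max_of_le_right (by positivity)
  have hVle : 2 * p.η ^ 2 * c.σf ^ 2 + 2 * c.σh ^ 2 ≤ V₀ := by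
    simp only [hV₀]; gcongr
  have hVp : 0 ≤ 2 * p.η ^ 2 * c.σf ^ 2 + 2 * c.σh ^ 2 := by positivity
  have hGle : Pr.Gsq c p.η xs ≤ G₀ := by
    have hinf : 0 ≤ Pr.f xs - ⨅ z, Pr.f z := sub_nonneg.2 (ciInf_le hA.bddBelow_f xs)
    simp only [hG₀, FedProblem.Gsq]; gcongr
  have hGp := Gsq_nonneg hA p.η xs
  have hAR : A ≤ (R : ℝ) ^ (1 / 2 : ℝ) := by
    refine le_of_sq_le_sq ?_ (by positivity)
    rw [hrsq]
    have := abs_nonneg D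
    linarith
  have hstep : p.StepOK c := by
    have e : p.γl * (16 * c.Lreg p.η ^ 2 * (1 + c.Bsq p.η) * p.K * p.γg) =
        p.γeff * (16 * c.Lreg p.η ^ 2 * (1 + c.Bsq p.η)) := by unfold FedParams.γeff; ring
    unfold FedParams.StepOK
    rw [e, hγ]
    calc u * (16 * c.Lreg p.η ^ 2 * (1 + c.Bsq p.η)) ≤ u * A := by
          simp only [hAdef]; gcongr
      _ ≤ u * (R : ℝ) ^ (1 / 2 : ℝ) := by gcongr
      _ = 1 := by rw [hu]; field_simp
  refine ⟨hstep, ?_⟩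
  have hγL := γeff_mul_Lreg_le hA hη.le hstep (hγ ▸ hu0.le) (hγ ▸ hu1)
  refine (errH_add_errF_le hA hη.le hS hv hγL (hγ ▸ hu0) hx xs hR).trans ?_
  rw [hγ]
  have hQ : run.qsq Pr p μ xη R ≤ |D| := by
    refine max_le ?_ (abs_nonneg D)
    have : 0 ≤ ∫ ω, ‖run.iter Pr p ω R - xη‖ ^ 2 ∂μ := integral_nonneg fun _ => by positivity
    linarith [le_abs_self D]
  have hW : wConst Pr c p xs ≤ 9 * L₀ * V₀ + 18 * L₀ * G₀ := by
    unfold wConst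
    have h1 : 9 * c.Lreg p.η * (2 * p.η ^ 2 * c.σf ^ 2 + 2 * c.σh ^ 2) / p.K ≤ 9 * L₀ * V₀ :=
      (div_le_self (by positivity) hK1).trans (by gcongr)
    have h2 : 18 * c.Lreg p.η * Pr.Gsq c p.η xs ≤ 18 * L₀ * G₀ := by gcongr
    linarith
  have hY : yConst Pr c p xs ≤ V₀ + 4 * G₀ := by
    unfold yConst
    have h1 : (2 * p.η ^ 2 * c.σf ^ 2 + 2 * c.σh ^ 2) / p.K ≤ V₀ :=
      (div_le_self hVp hK1).trans hVle
    have h2 : 1 - (p.S : ℝ) / N ≤ 1 := sub_le_self _ (by positivity)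
    have h3 : 4 * (1 - (p.S : ℝ) / N) * Pr.Gsq c p.η xs ≤ 4 * 1 * G₀ := by gcongr
    linarith
  have t1 : run.qsq Pr p μ xη R / (2 * u * R) ≤ |D| * u := by
    have h1 : 2 * u * R = 2 / u := by rw [mul_assoc, huR]; ring
    rw [h1, div_div_eq_mul_div]
    have := mul_le_mul_of_nonneg_right hQ hu0.le
    have := qsq_nonneg (run := run) (Pr := Pr) (p := p) (μ := μ) xη R
    have : 0 ≤ run.qsq Pr p μ xη R * u := by positivity
    linarith
  have t2 : u ^ 2 / p.γg ^ 2 * wConst Pr c p xs ≤ u * (9 * L₀ * V₀ + 18 * L₀ * G₀) := by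
    have h1 : u ^ 2 / p.γg ^ 2 ≤ u :=
      (div_le_self (sq_nonneg u) (one_le_pow₀ hγg)).trans (by nlinarith)
    have := wConst_nonneg (p := p) hA hη.le xs
    gcongr
  have t3 : 8 * u / p.S * yConst Pr c p xs ≤ 8 * u * (V₀ + 4 * G₀) := by
    have h1 : 8 * u / p.S ≤ 8 * u := div_le_self (by positivity) hS1'
    have := yConst_nonneg (p := p) hA hSN xs
    gcongr
  have : 0 ≤ A ^ 2 * u := by positivity
  linarith

end FedRun

/-- Powers of the accuracy: a round number `R ≥ (A / ε) ^ m` makes `A R ^ (-1/m)` at most `ε`. -/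
lemma mul_one_div_rpow_le {A R ε m : ℝ} (hA : 0 ≤ A) (hR : 0 < R) (hε : 0 < ε) (hm : 0 < m)
    (h : A ^ m * (1 / ε) ^ m ≤ R) : A * (1 / R ^ (1 / m)) ≤ ε := by
  have hr : 0 < R ^ (1 / m) := Real.rpow_pos_of_pos hR _
  have h1 : (A * (1 / ε)) ≤ R ^ (1 / m) := by
    rw [← Real.mul_rpow hA (by positivity)] at h
    have h2 := Real.rpow_le_rpow (by positivity) h (show 0 ≤ 1 / m by positivity)
    rwa [← Real.rpow_mul (by positivity), mul_one_div_cancel hm.ne', Real.rpow_one] at h2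
  rw [mul_one_div, div_le_iff₀ hr]
  rwa [mul_one_div, div_le_iff₀ hε, mul_comm] at h1

/-! ### Round complexities and rates -/

namespace FedRun

variable {n N : ℕ} {Ξ : Type u} {Z : Type v} {Ω : Type w}
variable [MeasurableSpace Ξ] [MeasurableSpace Z] [MeasurableSpace Ω]
variable {Pr : FedProblem n N Ξ Z} {c : FedConstants} {p : FedParams} {μ : Measure Ω}
variable {run : FedRun n N Ξ Z Ω} [IsProbabilityMeasure μ]
variable {xs xη : Vec n} {R : ℕ} {a b ε : ℝ}
variable (hA : Pr.Assumptions c) (hv : p.Valid N) (hstep : p.StepOK c)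
variable (hS : run.IsSampling Pr p.S μ) (hx : Pr.IsRegMin p.η xη)
variable (hR : 1 ≤ R) (hγ : p.γeff = 1 / (R : ℝ) ^ a)
include hA hv hstep hS hx hR hγ

/-- The error bound for a step size `R ^ (-a)`, where the step-size restriction applies in the form
`γ L ≤ 1/4`. -/
lemma errH_add_errF_le_of_γeff (xs : Vec n) (ha : 0 < a) :
    run.errH Pr p μ xs R + p.η * run.errF Pr p μ xs R ≤
      run.qsq Pr p μ xη R / (2 * (1 / (R : ℝ) ^ a) * R) +
        (1 / (R : ℝ) ^ a) ^ 2 / p.γg ^ 2 * wConst Pr c p xs +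
        8 * (1 / (R : ℝ) ^ a) / p.S * yConst Pr c p xs := by
  have hR1 : (1 : ℝ) ≤ R := by exact_mod_cast hR
  have hra : (1 : ℝ) ≤ (R : ℝ) ^ a := Real.one_le_rpow hR1 ha.le
  have h0 : 0 < 1 / (R : ℝ) ^ a := by positivity
  have hγL := γeff_mul_Lreg_le hA hv.2.2.2.2.2.le hstep (hγ ▸ h0.le)
    (hγ ▸ div_le_one_of_le₀ hra (by positivity))
  have := errH_add_errF_le hA hv.2.2.2.2.2.le hS hv hγL (hγ ▸ h0) hx xs hR
  rwa [hγ] at this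

lemma errF_le_of_complexity_pow (hxs : Pr.IsSolution xs) (hε : 0 < ε) (hb : 0 ≤ b) (hba : b < a)
    (hab : a + b < 1) (hη : p.η = 1 / (R : ℝ) ^ b)
    (h : complexityConst a b * ((run.qsq Pr p μ xη R / ε) ^ (1 / (1 - (a + b))) +
      (wConst Pr c p xs / (ε * p.γg ^ 2)) ^ (1 / (2 * a - b)) +
      (yConst Pr c p xs / (ε * p.S)) ^ (1 / (a - b))) ≤ R) :
    run.errF Pr p μ xs R ≤ ε := by
  have hT := errH_add_errF_le_of_γeff hA hv hstep hS hx hR hγ xs (hb.trans_lt hba)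
  obtain ⟨hS1, hSN, hK, -, hγg, hη0⟩ := hv
  obtain ⟨c1, c2, c3, -⟩ := le_complexityConst a b
  have hE := error_le_of_complexity (R := (R : ℝ)) (S := p.S) (by exact_mod_cast hR) hε hγg
    (by exact_mod_cast hS1) (qsq_nonneg xη R) (wConst_nonneg hA hη0.le xs)
    (yConst_nonneg hA hSN xs) (complexityConst_pos a b).le (by linarith) (by linarith)
    (by linarith) c1 c2 c3 h
  have hH := errH_nonneg hA hη0.le hS hK hxs R
  rw [← hη] at hE
  have : p.η * run.errF Pr p μ xs R ≤ p.η * ε := by nlinarith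
  exact le_of_mul_le_mul_left this hη0

lemma errH_le_of_complexity_pow {M : ℝ} (hε : 0 < ε) (hM : 0 < M)
    (hFM : -run.errF Pr p μ xs R ≤ M) (ha : 0 < a) (ha1 : a < 1) (hb : 0 < b)
    (hη : p.η = 1 / (R : ℝ) ^ b)
    (h : complexityConst a b * ((run.qsq Pr p μ xη R / ε) ^ (1 / (1 - a)) +
      (wConst Pr c p xs / (ε * p.γg ^ 2)) ^ (1 / (2 * a)) +
      (yConst Pr c p xs / (ε * p.S)) ^ (1 / a) + (M / ε) ^ (1 / b)) ≤ R) :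
    run.errH Pr p μ xs R ≤ ε := by
  have hT := errH_add_errF_le_of_γeff hA hv hstep hS hx hR hγ xs ha
  obtain ⟨hS1, hSN, hK, -, hγg, hη0⟩ := hv
  obtain ⟨-, -, -, c4, c5, c6, c7⟩ := le_complexityConst a b
  have hE := error_le_of_complexity_add (R := (R : ℝ)) (S := p.S) (by exact_mod_cast hR) hε hγg
    (by exact_mod_cast hS1) (qsq_nonneg xη R) (wConst_nonneg hA hη0.le xs)
    (yConst_nonneg hA hSN xs) hM.le (complexityConst_pos a b).le ha ha1 hb c4 c5 c6 c7 h
  rw [← hη] at hE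
  have := mul_le_mul_of_nonneg_left hFM hη0.le
  linarith

/-- The accuracy `α ε ^ κ / ‖∇f(x*)‖ ^ κ` in `h` suffices, by weak sharpness. -/
lemma neg_le_errF_of_complexity_pow {α κ M : ℝ} (hxs : Pr.IsSolution xs)
    (hsharp : Pr.IsWeakSharp α κ) (hε : 0 < ε) (hM : 0 < M)
    (hFM : -run.errF Pr p μ xs R ≤ M) (ha : 0 < a) (ha1 : a < 1) (hb : 0 < b)
    (hη : p.η = 1 / (R : ℝ) ^ b)
    (h : complexityConst a b *
      ((‖gradient Pr.f xs‖ ^ κ * run.qsq Pr p μ xη R / (α * ε ^ κ)) ^ (1 / (1 - a)) +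
      (‖gradient Pr.f xs‖ ^ κ * wConst Pr c p xs / (α * ε ^ κ * p.γg ^ 2)) ^ (1 / (2 * a)) +
      (‖gradient Pr.f xs‖ ^ κ * yConst Pr c p xs / (α * ε ^ κ * p.S)) ^ (1 / a) +
      (‖gradient Pr.f xs‖ ^ κ * M / (α * ε ^ κ)) ^ (1 / b)) ≤ R) :
    -ε ≤ run.errF Pr p μ xs R := by
  have hα := hsharp.1
  have hκ : 0 < κ := one_pos.trans_le hsharp.2.1
  have hεκ : 0 < ε ^ κ := Real.rpow_pos_of_pos hε κ
  have key := neg_errF_rpow_le hA hv.2.2.2.2.2.le hS hv.2.2.1 hxs R hsharp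
  have hγg : 0 < p.γg := one_pos.trans_le hv.2.2.2.2.1
  have hS0 : (0 : ℝ) < p.S := by exact_mod_cast hv.1
  -- it is enough to bound the right-hand side of the weak sharpness estimate
  suffices hg : ‖gradient Pr.f xs‖ ^ κ * run.errH Pr p μ xs R ≤ α * ε ^ κ by
    have h1 : (max (-run.errF Pr p μ xs R) 0) ^ κ ≤ ε ^ κ :=
      le_of_mul_le_mul_left (key.trans hg) hα
    have h2 := (Real.rpow_le_rpow_iff (le_max_right _ _) hε.le hκ).1 h1
    linarith [le_max_left (-run.errF Pr p μ xs R) 0]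
  rcases (Real.rpow_nonneg (norm_nonneg (gradient Pr.f xs)) κ).eq_or_lt with h0 | h0
  · rw [← h0, zero_mul]; positivity
  set g := ‖gradient Pr.f xs‖ ^ κ with hgdef
  have e1 : ∀ x : ℝ, g * x / (α * ε ^ κ) = x / (α * ε ^ κ / g) := fun x => by field_simp
  have e2 : ∀ x : ℝ, g * x / (α * ε ^ κ * p.γg ^ 2) = x / (α * ε ^ κ / g * p.γg ^ 2) :=
    fun x => by field_simp
  have e3 : ∀ x : ℝ, g * x / (α * ε ^ κ * p.S) = x / (α * ε ^ κ / g * p.S) :=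
    fun x => by field_simp
  rw [e1, e2, e3, e1] at h
  have := errH_le_of_complexity_pow hA hv hstep hS hx hR hγ (ε := α * ε ^ κ / g) (by positivity)
    hM hFM ha ha1 hb hη h
  rwa [le_div_iff₀ h0, mul_comm] at this

/-- Regularization below the threshold `α / (2 ‖∇f(x*)‖)` is exact: with weak sharpness of
order `1`, both errors are controlled by the accuracy of the regularized problem. -/
lemma errors_le_of_complexity {C α t : ℝ} (hxs : Pr.IsSolution xs)
    (hsharp : Pr.IsWeakSharp α 1) (hηα : 2 * p.η * ‖gradient Pr.f xs‖ ≤ α) (ht : 0 < t)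
    (ha : 0 < a) (ha1 : a < 1) (hC : 0 ≤ C)
    (hC1 : (32 : ℝ) ^ (1 / (1 - a)) ≤ C) (hC2 : (32 : ℝ) ^ (1 / (2 * a)) ≤ C)
    (hC3 : (32 : ℝ) ^ (1 / a) ≤ C)
    (h : C * ((run.qsq Pr p μ xη R / t) ^ (1 / (1 - a)) +
      (wConst Pr c p xs / (t * p.γg ^ 2)) ^ (1 / (2 * a)) +
      (yConst Pr c p xs / (t * p.S)) ^ (1 / a)) ≤ R) :
    p.η * run.errF Pr p μ xs R ≤ t ∧ run.errH Pr p μ xs R ≤ t := by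
  have hT := errH_add_errF_le_of_γeff hA hv hstep hS hx hR hγ xs ha
  obtain ⟨hS1, hSN, hK, -, hγg, hη0⟩ := hv
  have hE := error_le_of_complexity_zero (R := (R : ℝ)) (S := p.S) (by exact_mod_cast hR) ht hγg
    (by exact_mod_cast hS1) (qsq_nonneg xη R) (wConst_nonneg hA hη0.le xs)
    (yConst_nonneg hA hSN xs) hC ha ha1 hC1 hC2 hC3 h
  have hH := errH_nonneg hA hη0.le hS hK hxs R
  have key := two_mul_neg_errF_le hA hη0.le hS hK hxs R hsharp hηα
  constructor <;> linarith

end FedRun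

theorem theorem3 :
    -- explicit round complexities, with a constant that depends only on `a` and `b`
    (∀ a b : ℝ, ∃ C : ℝ, 0 < C ∧
      ∀ (n N : ℕ) (Ξ : Type u) (Z : Type v) (Ω : Type w)
        [MeasurableSpace Ξ] [MeasurableSpace Z] [MeasurableSpace Ω]
        (Pr : FedProblem n N Ξ Z) (c : FedConstants) (_ : Pr.Assumptions c)
        (μ : Measure Ω) [IsProbabilityMeasure μ]
        (p : FedParams) (_ : p.Valid N) (_ : p.StepOK c)
        (run : FedRun n N Ξ Z Ω) (_ : run.IsSampling Pr p.S μ)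
        (xs : Vec n) (_ : Pr.IsSolution xs) (xη : Vec n) (_ : Pr.IsRegMin p.η xη)
        (R : ℕ) (_ : 1 ≤ R) (_ : p.γeff = 1 / (R : ℝ) ^ a),
        run.FiniteErrors Pr p μ xη R ∧
        -- Case i-1
        (∀ ε : ℝ, 0 < ε → 0 ≤ b → b < a → a + b < 1 → p.η = 1 / (R : ℝ) ^ b →
          C * ((run.qsq Pr p μ xη R / ε) ^ (1 / (1 - (a + b))) +
              (wConst Pr c p xs / (ε * p.γg ^ 2)) ^ (1 / (2 * a - b)) +
              (yConst Pr c p xs / (ε * p.S)) ^ (1 / (a - b))) ≤ R →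
          run.errF Pr p μ xs R ≤ ε) ∧
        -- Case i-2
        (∀ ε M : ℝ, 0 < ε → 0 < M → - run.errF Pr p μ xs R ≤ M →
          0 < b → b < a → a < 1 → p.η = 1 / (R : ℝ) ^ b →
          C * ((run.qsq Pr p μ xη R / ε) ^ (1 / (1 - a)) +
              (wConst Pr c p xs / (ε * p.γg ^ 2)) ^ (1 / (2 * a)) +
              (yConst Pr c p xs / (ε * p.S)) ^ (1 / a) +
              (M / ε) ^ (1 / b)) ≤ R →
          0 ≤ run.errH Pr p μ xs R ∧ run.errH Pr p μ xs R ≤ ε) ∧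
        -- Case ii
        (∀ α κ ε M : ℝ, Pr.IsWeakSharp α κ → 0 < ε → 0 < M → - run.errF Pr p μ xs R ≤ M →
          0 < a → a < 1 → 0 < b → b ≤ 1 → p.η = 1 / (R : ℝ) ^ b →
          C * ((‖gradient Pr.f xs‖ ^ κ * run.qsq Pr p μ xη R / (α * ε ^ κ)) ^ (1 / (1 - a)) +
              (‖gradient Pr.f xs‖ ^ κ * wConst Pr c p xs / (α * ε ^ κ * p.γg ^ 2))
                ^ (1 / (2 * a)) +
              (‖gradient Pr.f xs‖ ^ κ * yConst Pr c p xs / (α * ε ^ κ * p.S)) ^ (1 / a) +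
              (‖gradient Pr.f xs‖ ^ κ * M / (α * ε ^ κ)) ^ (1 / b)) ≤ R →
          -ε ≤ run.errF Pr p μ xs R) ∧
        -- Case iii
        (∀ α ε : ℝ, Pr.IsWeakSharp α 1 → 2 * p.η * ‖gradient Pr.f xs‖ ≤ α → 0 < ε →
          0 < a → a < 1 →
          (C * ((run.qsq Pr p μ xη R / (p.η * ε)) ^ (1 / (1 - a)) +
              (wConst Pr c p xs / (p.η * ε * p.γg ^ 2)) ^ (1 / (2 * a)) +
              (yConst Pr c p xs / (p.η * ε * p.S)) ^ (1 / a)) ≤ R →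
            run.errF Pr p μ xs R ≤ ε) ∧
          (C * ((run.qsq Pr p μ xη R / ε) ^ (1 / (1 - a)) +
              (wConst Pr c p xs / (ε * p.γg ^ 2)) ^ (1 / (2 * a)) +
              (yConst Pr c p xs / (ε * p.S)) ^ (1 / a)) ≤ R →
            0 ≤ run.errH Pr p μ xs R ∧ run.errH Pr p μ xs R ≤ ε) ∧
          (C * ((‖gradient Pr.f xs‖ / α * run.qsq Pr p μ xη R / ε) ^ (1 / (1 - a)) +
              (‖gradient Pr.f xs‖ / α * wConst Pr c p xs / (ε * p.γg ^ 2)) ^ (1 / (2 * a)) +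
              (‖gradient Pr.f xs‖ / α * yConst Pr c p xs / (ε * p.S)) ^ (1 / a)) ≤ R →
            -ε ≤ run.errF Pr p μ xs R))) ∧
    -- the resulting rates for a fixed problem: `a = 1/2`, `b = 1/4`
    (∀ (n N : ℕ) (Ξ : Type u) (Z : Type v) [MeasurableSpace Ξ] [MeasurableSpace Z]
      (Pr : FedProblem n N Ξ Z) (c : FedConstants) (_ : Pr.Assumptions c)
      (xs : Vec n) (_ : Pr.IsSolution xs) (D : ℝ),
      (∃ C : ℝ, 0 < C ∧
        ∀ (Ω : Type w) [MeasurableSpace Ω] (μ : Measure Ω) [IsProbabilityMeasure μ]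
          (p : FedParams) (_ : p.Valid N)
          (run : FedRun n N Ξ Z Ω) (_ : run.IsSampling Pr p.S μ)
          (xη : Vec n) (_ : Pr.IsRegMin p.η xη) (_ : ∫ ω, ‖run.x0 ω - xη‖ ^ 2 ∂μ ≤ D)
          (R : ℕ) (_ : 1 ≤ R) (_ : p.γeff = 1 / (R : ℝ) ^ (1 / 2 : ℝ))
          (_ : p.η = 1 / (R : ℝ) ^ (1 / 4 : ℝ))
          (ε : ℝ) (_ : 0 < ε) (_ : ε ≤ 1) (_ : C * (1 / ε) ^ 4 ≤ R),
          p.StepOK c ∧ run.errF Pr p μ xs R ≤ ε ∧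
            0 ≤ run.errH Pr p μ xs R ∧ run.errH Pr p μ xs R ≤ ε) ∧
      (∀ α κ : ℝ, Pr.IsWeakSharp α κ → ∃ C : ℝ, 0 < C ∧
        ∀ (Ω : Type w) [MeasurableSpace Ω] (μ : Measure Ω) [IsProbabilityMeasure μ]
          (p : FedParams) (_ : p.Valid N)
          (run : FedRun n N Ξ Z Ω) (_ : run.IsSampling Pr p.S μ)
          (xη : Vec n) (_ : Pr.IsRegMin p.η xη) (_ : ∫ ω, ‖run.x0 ω - xη‖ ^ 2 ∂μ ≤ D)
          (R : ℕ) (_ : 1 ≤ R) (_ : p.γeff = 1 / (R : ℝ) ^ (1 / 2 : ℝ))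
          (_ : p.η = 1 / (R : ℝ) ^ (1 / 4 : ℝ))
          (ε : ℝ) (_ : 0 < ε) (_ : ε ≤ 1) (_ : C * (1 / ε) ^ (4 * κ) ≤ R),
          p.StepOK c ∧ -ε ≤ run.errF Pr p μ xs R) ∧
      (∀ α η : ℝ, Pr.IsWeakSharp α 1 → 0 < η → 2 * η * ‖gradient Pr.f xs‖ ≤ α →
        ∃ C : ℝ, 0 < C ∧
        ∀ (Ω : Type w) [MeasurableSpace Ω] (μ : Measure Ω) [IsProbabilityMeasure μ]
          (p : FedParams) (_ : p.Valid N) (_ : p.η = η)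
          (run : FedRun n N Ξ Z Ω) (_ : run.IsSampling Pr p.S μ)
          (xη : Vec n) (_ : Pr.IsRegMin p.η xη) (_ : ∫ ω, ‖run.x0 ω - xη‖ ^ 2 ∂μ ≤ D)
          (R : ℕ) (_ : 1 ≤ R) (_ : p.γeff = 1 / (R : ℝ) ^ (1 / 2 : ℝ))
          (ε : ℝ) (_ : 0 < ε) (_ : ε ≤ 1) (_ : C * (1 / ε) ^ 2 ≤ R),
          p.StepOK c ∧ |run.errF Pr p μ xs R| ≤ ε ∧
            0 ≤ run.errH Pr p μ xs R ∧ run.errH Pr p μ xs R ≤ ε)) := by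
  constructor
  · intro a b
    refine ⟨complexityConst a b, complexityConst_pos a b, ?_⟩
    intro n N Ξ Z Ω _ _ _ Pr c hA μ _ p hv hstep run hS xs hxs xη hx R hR hγ
    obtain ⟨hS1, hSN, hK, hγl, hγg, hη⟩ := id hv
    obtain ⟨-, -, -, c4, c5, c6, -⟩ := le_complexityConst a b
    have hC := complexityConst_pos a b
    have hH := FedRun.errH_nonneg hA hη.le hS hK hxs R
    refine ⟨FedRun.finiteErrors hA hη.le hS hK xη R, ?_, ?_, ?_, ?_⟩
    · intro ε hε hb hba hab hηb h
      exact FedRun.errF_le_of_complexity_pow hA hv hstep hS hx hR hγ hxs hε hb hba hab hηb h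
    · intro ε M hε hM hFM hb hba ha1 hηb h
      exact ⟨hH, FedRun.errH_le_of_complexity_pow hA hv hstep hS hx hR hγ hε hM hFM
        (hb.trans hba) ha1 hb hηb h⟩
    · intro α κ ε M hsharp hε hM hFM ha ha1 hb _ hηb h
      exact FedRun.neg_le_errF_of_complexity_pow hA hv hstep hS hx hR hγ hxs hsharp hε hM hFM
        ha ha1 hb hηb h
    · intro α ε hsharp hηα hε ha ha1
      have main : ∀ t : ℝ, 0 < t → _ := fun t ht =>
        FedRun.errors_le_of_complexity hA hv hstep hS hx hR hγ hxs hsharp hηα ht ha ha1 hC.le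
          c4 c5 c6
      refine ⟨fun h => ?_, fun h => ⟨hH, (main ε hε h).2⟩, fun h => ?_⟩
      · exact le_of_mul_le_mul_left (main (p.η * ε) (by positivity) h).1 hη
      · have key := FedRun.neg_errF_le_mul_errH hA hη.le hS hK hxs R hsharp
        have hα := hsharp.1
        rcases (show 0 ≤ ‖gradient Pr.f xs‖ / α by positivity).eq_or_lt with h0 | h0
        · rw [← h0, zero_mul] at key
          linarith
        set ρ := ‖gradient Pr.f xs‖ / α
        have hγg0 : 0 < p.γg := one_pos.trans_le hγg
        have hS0 : (0 : ℝ) < p.S := by exact_mod_cast hS1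
        have e1 : ∀ x : ℝ, ρ * x / ε = x / (ε / ρ) := fun x => by field_simp
        have e2 : ∀ x : ℝ, ρ * x / (ε * p.γg ^ 2) = x / (ε / ρ * p.γg ^ 2) :=
          fun x => by field_simp
        have e3 : ∀ x : ℝ, ρ * x / (ε * p.S) = x / (ε / ρ * p.S) := fun x => by field_simp
        rw [e1, e2, e3] at h
        have h1 := (main (ε / ρ) (by positivity) h).2
        rw [le_div_iff₀ h0] at h1
        linarith
  · intro n N Ξ Z _ _ Pr c hA xs hxs D
    have hM : 0 ≤ Pr.f xs - ⨅ z, Pr.f z := sub_nonneg.2 (ciInf_le hA.bddBelow_f xs)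
    set M := Pr.f xs - ⨅ z, Pr.f z with hMdef
    obtain ⟨κ₁, hκ₁, hrate₁⟩ := FedRun.exists_rate_const.{u, v, w} hA xs D 1 zero_le_one
    have hA₁ : 1 ≤ κ₁ + M := by linarith
    -- both errors for vanishing regularization
    have hvan : ∀ (Ω : Type w) [MeasurableSpace Ω] (μ : Measure Ω) [IsProbabilityMeasure μ]
        (p : FedParams) (_ : p.Valid N) (run : FedRun n N Ξ Z Ω) (_ : run.IsSampling Pr p.S μ)
        (xη : Vec n) (_ : Pr.IsRegMin p.η xη) (_ : ∫ ω, ‖run.x0 ω - xη‖ ^ 2 ∂μ ≤ D)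
        (R : ℕ) (_ : 1 ≤ R) (_ : p.γeff = 1 / (R : ℝ) ^ (1 / 2 : ℝ))
        (_ : p.η = 1 / (R : ℝ) ^ (1 / 4 : ℝ)) (_ : κ₁ ≤ R),
        p.StepOK c ∧ run.errF Pr p μ xs R ≤ (κ₁ + M) * (1 / (R : ℝ) ^ (1 / 4 : ℝ)) ∧
          0 ≤ run.errH Pr p μ xs R ∧
          run.errH Pr p μ xs R ≤ (κ₁ + M) * (1 / (R : ℝ) ^ (1 / 4 : ℝ)) := by
      intro Ω _ μ _ p hv run hS xη hx hD R hR hγ hηR hκR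
      obtain ⟨-, -, hK, -, -, hη⟩ := id hv
      have hR1 : (1 : ℝ) ≤ R := by exact_mod_cast hR
      have hR0 : (0 : ℝ) < R := by linarith
      have hη1 : p.η ≤ 1 := by
        rw [hηR]
        exact div_le_one_of_le₀ (Real.one_le_rpow hR1 (by norm_num)) (by positivity)
      obtain ⟨hstep, hT⟩ := hrate₁ Ω μ p hv run hS xη hx hD R hR hγ hη1 hκR
      have hsq : 1 / (R : ℝ) ^ (1 / 2 : ℝ) = p.η * p.η := by
        rw [hηR, div_mul_div_comm, ← Real.rpow_add hR0]; norm_num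
      rw [hsq] at hT
      have hH := FedRun.errH_nonneg hA hη.le hS hK hxs R
      have hF := FedRun.neg_errF_le hA hη.le hS hK xs R
      refine ⟨hstep, ?_, hH, ?_⟩
      · rw [← hηR]
        have h1 : p.η * run.errF Pr p μ xs R ≤ p.η * (κ₁ * p.η) := by linarith
        have h2 := le_of_mul_le_mul_left h1 hη
        have h3 := mul_nonneg hM hη.le
        linarith
      · rw [← hηR]
        have h1 := mul_le_mul_of_nonneg_left hF hη.le
        have h2 : κ₁ * (p.η * p.η) ≤ κ₁ * (p.η * 1) := by gcongr
        linarith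
    -- the threshold on `R` needed for the step-size restriction is implied by the complexities
    have hpow : ∀ {A x : ℝ}, 1 ≤ A → κ₁ ≤ A → 1 ≤ x → κ₁ ≤ A ^ 4 * x := fun h1 h2 h3 =>
      h2.trans ((le_self_pow₀ h1 four_ne_zero).trans (le_mul_of_one_le_right (by positivity) h3))
    refine ⟨⟨(κ₁ + M) ^ 4, by positivity, ?_⟩, ?_, ?_⟩
    · intro Ω _ μ _ p hv run hS xη hx hD R hR hγ hηR ε hε hε1 h
      have hR0 : (0 : ℝ) < R := by exact_mod_cast hR
      have h1ε : 1 ≤ 1 / ε := (one_le_div hε).2 hε1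
      obtain ⟨hstep, hF, hH0, hH⟩ := hvan Ω μ p hv run hS xη hx hD R hR hγ hηR
        ((hpow hA₁ (by linarith) (one_le_pow₀ h1ε)).trans h)
      have h4 := mul_one_div_rpow_le (A := κ₁ + M) (m := 4) (by linarith) hR0 hε (by norm_num)
        (by exact_mod_cast h)
      exact ⟨hstep, hF.trans h4, hH0, hH.trans h4⟩
    · intro α κ hsharp
      have hα := hsharp.1
      have hκ := hsharp.2.1
      have hg : 0 ≤ ‖gradient Pr.f xs‖ ^ κ := Real.rpow_nonneg (norm_nonneg _) κ
      set g := ‖gradient Pr.f xs‖ ^ κ with hgdef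
      have hA₂ : κ₁ + M ≤ (1 + g / α) * (κ₁ + M) :=
        le_mul_of_one_le_left (by linarith) (by linarith [show 0 ≤ g / α by positivity])
      have hA₂0 : 0 ≤ (1 + g / α) * (κ₁ + M) := by linarith
      -- the summand `1` keeps the constant above `κ₁` also for a vanishing gradient
      refine ⟨((1 + g / α) * (κ₁ + M)) ^ 4, by positivity, ?_⟩
      intro Ω _ μ _ p hv run hS xη hx hD R hR hγ hηR ε hε hε1 h
      have hR0 : (0 : ℝ) < R := by exact_mod_cast hR
      have h1ε : 1 ≤ 1 / ε := (one_le_div hε).2 hε1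
      have hεκ : 0 < ε ^ κ := Real.rpow_pos_of_pos hε κ
      obtain ⟨hstep, -, hH0, hH⟩ := hvan Ω μ p hv run hS xη hx hD R hR hγ hηR
        ((hpow (hA₁.trans hA₂) (by linarith)
          (Real.one_le_rpow h1ε (by linarith))).trans h)
      refine ⟨hstep, ?_⟩
      have e : (1 / ε) ^ (4 * κ) = (1 / ε ^ κ) ^ 4 := by
        rw [mul_comm, Real.rpow_mul (by positivity), Real.div_rpow zero_le_one hε.le,
          Real.one_rpow]
        exact_mod_cast rfl
      rw [e] at h
      have h4 := mul_one_div_rpow_le (m := 4) hA₂0 hR0 hεκ (by norm_num) (by exact_mod_cast h)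
      have hr : 0 ≤ (κ₁ + M) * (1 / (R : ℝ) ^ (1 / 4 : ℝ)) := hH0.trans hH
      have key := FedRun.neg_errF_rpow_le hA hv.2.2.2.2.2.le hS hv.2.2.1 hxs R hsharp
      have h5 : g * run.errH Pr p μ xs R ≤ α * ε ^ κ := by
        calc g * run.errH Pr p μ xs R ≤ g * ((κ₁ + M) * (1 / (R : ℝ) ^ (1 / 4 : ℝ))) := by gcongr
          _ = α * (g / α * ((κ₁ + M) * (1 / (R : ℝ) ^ (1 / 4 : ℝ)))) := by field_simp
          _ ≤ α * ε ^ κ := by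
            gcongr
            linarith
      have h6 := (Real.rpow_le_rpow_iff (le_max_right _ _) hε.le (by linarith)).1
        (le_of_mul_le_mul_left (key.trans h5) hα)
      linarith [le_max_left (-run.errF Pr p μ xs R) 0]
    · intro α η hsharp hη hηα
      have hα := hsharp.1
      obtain ⟨κ₂, hκ₂, hrate₂⟩ := FedRun.exists_rate_const.{u, v, w} hA xs D η hη.le
      have hρ : 0 ≤ ‖gradient Pr.f xs‖ / α := by positivity
      have hη' : 0 ≤ 1 / η := by positivity
      set ρ := ‖gradient Pr.f xs‖ / α with hρdef
      have hB : κ₂ ≤ κ₂ * (2 + 1 / η + 2 * ρ) := le_mul_of_one_le_right (by linarith) (by linarith)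
      have hB0 : 0 ≤ κ₂ * (2 + 1 / η + 2 * ρ) := by linarith
      -- the summands bound the inner error, the outer error from above, and from below
      refine ⟨(κ₂ * (2 + 1 / η + 2 * ρ)) ^ 2, by positivity, ?_⟩
      intro Ω _ μ _ p hv hpη run hS xη hx hD R hR hγ ε hε hε1 h
      have hR0 : (0 : ℝ) < R := by exact_mod_cast hR
      have h1ε : 1 ≤ 1 / ε := (one_le_div hε).2 hε1
      have hκR : κ₂ ≤ R := (hB.trans ((le_self_pow₀ (hκ₂.trans hB) two_ne_zero).trans
        (le_mul_of_one_le_right (by positivity) (one_le_pow₀ h1ε)))).trans h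
      obtain ⟨hstep, hT⟩ := hrate₂ Ω μ p hv run hS xη hx hD R hR hγ hpη.le hκR
      obtain ⟨-, -, hK, -, -, hη0⟩ := id hv
      have h2 := mul_one_div_rpow_le (m := 2) hB0 hR0 hε (by norm_num) (by exact_mod_cast h)
      have hu : 0 ≤ κ₂ * (1 / (R : ℝ) ^ (1 / 2 : ℝ)) := by positivity
      have hH := FedRun.errH_nonneg hA hη0.le hS hK hxs R
      have k1 := FedRun.two_mul_neg_errF_le hA hη0.le hS hK hxs R hsharp (by rw [hpη]; exact hηα)
      have k2 := FedRun.neg_errF_le_mul_errH hA hη0.le hS hK hxs R hsharp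
      set u := κ₂ * (1 / (R : ℝ) ^ (1 / 2 : ℝ)) with hudef
      have h2' : 2 * u + 1 / η * u + 2 * ρ * u ≤ ε := by
        refine le_trans (le_of_eq ?_) h2
        rw [hudef]; ring
      have hu1 : 0 ≤ 1 / η * u := by positivity
      have hu2 : 0 ≤ 2 * ρ * u := by positivity
      have hH2 : run.errH Pr p μ xs R ≤ 2 * u := by linarith
      have hF2 : run.errF Pr p μ xs R ≤ 1 / η * u := by
        rw [one_div_mul_eq_div, le_div_iff₀ hη, ← hpη]
        linarith
      have hF3 : ρ * run.errH Pr p μ xs R ≤ ρ * (2 * u) := by gcongr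
      exact ⟨hstep, abs_le.2 ⟨by linarith, by linarith⟩, hH, by linarith⟩

end
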